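/- For $k\in\mathbb{C}$ with $0<|k|<1$ let $\mathrm{sn}(z;k)$ be Jacobi's elliptic sine, i.e. the unique meromorphic function $s$ on $\mathbb{C}$ with $s(0)=0$, $s'(0)=1$ and $(s')^2=(1-s^2)(1-k^2s^2)$ (existence and uniqueness are part of the statement). Let $A^2=k$, $G(z):=A\,\mathrm{sn}(z;k)$, $m:=k^2$, and $$h(m):=\sum_{j=0}^{\infty}\frac{\Gamma(j+1/2)^2}{\Gamma(j+1)^2}\,m^j ,$$ a series that converges for $|m|<1$. A closed contour (for $m$) is a closed $C^1$ path $u$ together with a continuous, nowhere vanishing determination $v$ of $\sqrt{(1-u^2)(1-mu^2)}$ along it that returns to its initial value; the complete elliptic integral of the first kind over it is $$\Omega=\oint\frac{\mathrm{d}u}{\sqrt{(1-u^2)(1-k^2u^2)}}=\oint\frac{\mathrm{d}u}{v}.$$ (1) Let $U\subseteq\{0<|m|<1\}$ be open, and let $u$ be a path which, with determinations $v_m$ jointly continuous in $m\in U$ and in the path parameter, is a closed contour for every $m\in U$. Then the integral $\Omega(m)=\oint\mathrm{d}u/v_m$ is holomorphic on $U$ and satisfies the hypergeometric equation $m(1-m)\Omega''+(1-2m)\Omega'-\tfrac14\Omega=0$.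 (2) The function $G$ has two fundamental periods $$\Omega_1=2h(m),\qquad \Omega_2=i\,h(1-m):$$ they are linearly independent over $\mathbb{R}$, and $\{\omega: G(z+\omega)=G(z)\ \text{for all } z\}=\mathbb{Z}\Omega_1+\mathbb{Z}\Omega_2$. Each of $\Omega_1,\Omega_2$ is the elliptic integral over a closed contour, and the elliptic integral over any closed contour lies in $\mathbb{Z}\Omega_1+\mathbb{Z}\Omega_2$. Here, $i\,h(1-m)$ is the sum of the series if $|1-m|<1$; for the other $m$ with $0<|m|<1$ it is understood by analytic continuation in a logarithm of $m$: there is a holomorphic function $P$ on $\{\operatorname{Re}w<0\}$ with $P(\operatorname{Log}m)=i\,h(1-m)$ ($\operatorname{Log}$ the principal branch) whenever $0<|m|<1$ and $|1-m|<1$, and (2) holds with $\Omega_2=P(w)$ for every $w$ with $e^w=k^2$. The function $2h(m)$ on $|m|<1$, and the function $P(\operatorname{Log}m)$ on the part of $|m|<1$ outside $(-\infty,0]$, are holomorphic and satisfy the hypergeometric equation of (1). -/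

import Mathlib

/-- `s` is Jacobi's elliptic sine of modulus `k`: the meromorphic function on `ℂ` that inverts
the elliptic integral of the first kind, i.e. `s' ^ 2 = (1 - s ^ 2) (1 - k ^ 2 s ^ 2)` with
`s 0 = 0` and `s' 0 = 1`. A meromorphic function is represented by its normal form, which takes
the value `0` at the poles; the differential equation is required away from the poles. -/
structure IsJacobiSn (k : ℂ) (s : ℂ → ℂ) : Prop where
  meromorphic : MeromorphicNFOn s Set.univ
  map_zero : s 0 = 0
  deriv_zero : deriv s 0 = 1
  ode : ∀ z : ℂ, AnalyticAt ℂ s z →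
    deriv s z ^ 2 = (1 - s z ^ 2) * (1 - k ^ 2 * s z ^ 2)

/-- Jacobi's elliptic sine `sn (z; k)`: the function `s` with `IsJacobiSn k s`
(that there is exactly one is part of the theorem). -/
noncomputable def jacobiSn (k : ℂ) : ℂ → ℂ :=
  Classical.epsilon (IsJacobiSn k)

/-- The pair `(ω₁, ω₂)` is a pair of fundamental periods of `G`: it is linearly independent over
`ℝ` (in particular both are nonzero) and the periods of `G` are exactly its integer
combinations. -/
def IsFundamentalPeriodPair (G : ℂ → ℂ) (ω₁ ω₂ : ℂ) : Prop :=
  LinearIndependent ℝ ![ω₁, ω₂] ∧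
    ∀ ω : ℂ, (∀ z : ℂ, G (z + ω) = G z) ↔ ∃ a b : ℤ, ω = a * ω₁ + b * ω₂

/-- A closed contour for the integrand `1 / √((1 - u²) (1 - m u²))`: a closed `C¹` path `u` in
the plane together with a determination `v` of the square root that is continuous along the path,
does not vanish, and returns to its initial value. -/
structure IsClosedContour (m : ℂ) (u v : ℝ → ℂ) : Prop where
  contDiffOn_u : ContDiffOn ℝ 1 u (Set.Icc 0 1)
  continuousOn_v : ContinuousOn v (Set.Icc 0 1)
  sq_eq : ∀ t ∈ Set.Icc (0 : ℝ) 1, v t ^ 2 = (1 - u t ^ 2) * (1 - m * u t ^ 2)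
  ne_zero : ∀ t ∈ Set.Icc (0 : ℝ) 1, v t ≠ 0
  closed_u : u 0 = u 1
  closed_v : v 0 = v 1

/-- The contour integral `∮ du / v`. -/
noncomputable def ellipticIntegral (u v : ℝ → ℂ) : ℂ :=
  ∫ t in (0 : ℝ)..1, deriv u t / v t

/-- The coefficients `Γ(j + 1/2)² / Γ(j + 1)²`. -/
noncomputable def periodCoeff (j : ℕ) : ℂ :=
  Complex.Gamma ((j : ℂ) + 1 / 2) ^ 2 / Complex.Gamma ((j : ℂ) + 1) ^ 2

/-- The power series `h(m) = ∑ Γ(j + 1/2)² / Γ(j + 1)² m ^ j`. -/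
noncomputable def periodSeries (m : ℂ) : ℂ :=
  ∑' j : ℕ, periodCoeff j * m ^ j

/-- `F` is holomorphic on the (open) set `U` and solves there the hypergeometric equation
`m (1 - m) F'' + (1 - 2 m) F' - F / 4 = 0`. -/
def SolvesPeriodODE (F : ℂ → ℂ) (U : Set ℂ) : Prop :=
  DifferentiableOn ℂ F U ∧
    ∀ m ∈ U, m * (1 - m) * deriv (deriv F) m + (1 - 2 * m) * deriv F m - 1 / 4 * F m = 0

/-! Put `m = k ^ 2`. The substitution `u = sn z`, `v = sn' z` uniformizes the curve `v² = (1 - u²)(1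
- m u²)` and turns `du / v` into `dz`, so integrals over closed contours are periods of `sn`, and
nonzero periods are such integrals. There remain the global existence of `sn`, a proof that the two
given periods generate all others, and the dependence on `m`.

Existence: the elliptic integral is inverted near `0` to give `s`. If `l'' = m s²`, then `N = exp
(-l)` and `S = s N` behave like theta functions: they obey polynomial duplication formulas, which
extend them to entire functions without common zeros (`exists_snPair`). From there on everything
rests on uniqueness for the second order equation `s'' = snAccel m s`, which, unlike the first order
one, has no ambiguous square root. It shows that two points with the same `(s, s')`, up to a common
sign, differ by a period up to sign (`SnPair.signPeriod_of_eq`), and that paths on the curve lift to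
the `z`-plane (`SnPair.lift`).

Fundamental periods: the zeros of `S` are the periods of `sn` up to sign. Translation by a zero `ω`
adds a constant `eta ω` to `-S'/S`, additively in `ω`. Integration around a fundamental
parallelogram gives Legendre's relation `η₁ ω₂ - η₂ ω₁ = ± 2πi` for any basis. Conversely, two zeros
whose Legendre expression is `2πi` are related to a basis by an integer matrix of determinant `± 1`,
hence form a basis (`SnPair.generate`). For `i h(1 - m)` and `h(m)` that expression is `2i` times a
Wronskian of two solutions of the hypergeometric equation, which is constant and is evaluated as `m
→ 0+` (`ellWronskian_eq`). Since `h(m)` reverses the sign of `sn`, the period is `2 h(m)`.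

Continuation: the derivative of `i h(1 - m) / h(m)` has a simple pole at `0` with residue `1 /
(πi)`; integrating it produces `P`, with `P(w + 2πi) = P(w) + 2 h(e ^ w)`, so another logarithm only
shears the basis. Negative `m` is reached as a limit from above along a rotated path of integration
(`SnPair.exists_basis`).

The hypergeometric equation holds because the corresponding combination of integrands is an exact
differential (`ellH_ode`, `integral_exact_differential`). -/

namespace JacobiElliptic
open Set Filter Topology MeasureTheory

/-! ### Integrals depending on a parameter. -/

section ParametricIntegral

theorem continuousOn_slice {X : Type*} [TopologicalSpace X] {U : Set X} {s : Set ℝ}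
    {F : X → ℝ → ℂ} (hF : ContinuousOn (fun p : X × ℝ => F p.1 p.2) (U ×ˢ s))
    {x : X} (hx : x ∈ U) : ContinuousOn (F x) s :=
  hF.comp (f := fun t : ℝ => (x, t)) (by fun_prop) (fun _ ht => ⟨hx, ht⟩)

theorem hasDerivAt_integral_param {𝕜 : Type*} [RCLike 𝕜] [NormedSpace 𝕜 ℂ] {U : Set 𝕜}
    (hU : IsOpen U) {a b : ℝ} {F F' : 𝕜 → ℝ → ℂ}
    (hF : ContinuousOn (fun p : 𝕜 × ℝ => F p.1 p.2) (U ×ˢ uIcc a b))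
    (hF' : ContinuousOn (fun p : 𝕜 × ℝ => F' p.1 p.2) (U ×ˢ uIcc a b))
    (hd : ∀ x ∈ U, ∀ t ∈ uIcc a b, HasDerivAt (fun y => F y t) (F' x t) x)
    {x₀ : 𝕜} (hx₀ : x₀ ∈ U) :
    HasDerivAt (fun x => ∫ t in a..b, F x t) (∫ t in a..b, F' x₀ t) x₀ := by
  obtain ⟨ε, hε, hball⟩ := Metric.nhds_basis_closedBall.mem_iff.1 (hU.mem_nhds hx₀)
  have hK : IsCompact (Metric.closedBall x₀ ε ×ˢ uIcc a b) :=
    (isCompact_closedBall x₀ ε).prod isCompact_uIcc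
  obtain ⟨C, hC⟩ := hK.exists_bound_of_continuousOn
    (hF'.mono (prod_mono hball Subset.rfl))
  refine (intervalIntegral.hasDerivAt_integral_of_dominated_loc_of_deriv_le
    (μ := volume) (bound := fun _ => C) (s := Metric.closedBall x₀ ε)
    (Metric.closedBall_mem_nhds x₀ hε) ?_ ?_ ?_ ?_ ?_ ?_).2
  · filter_upwards [hU.mem_nhds hx₀] with x hx
    exact ((continuousOn_slice hF hx).mono uIoc_subset_uIcc).aestronglyMeasurable
      measurableSet_uIoc
  · exact (continuousOn_slice hF hx₀).intervalIntegrable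
  · exact ((continuousOn_slice hF' hx₀).mono uIoc_subset_uIcc).aestronglyMeasurable
      measurableSet_uIoc
  · exact Eventually.of_forall fun t ht x hx => hC (x, t) ⟨hx, uIoc_subset_uIcc ht⟩
  · exact intervalIntegrable_const
  · exact Eventually.of_forall fun t ht x hx => hd x (hball hx) t (uIoc_subset_uIcc ht)

theorem continuousAt_integral_param {X : Type*} [TopologicalSpace X] [FirstCountableTopology X]
    [LocallyCompactSpace X] {U : Set X} (hU : IsOpen U) {a b : ℝ} {F : X → ℝ → ℂ}
    (hF : ContinuousOn (fun p : X × ℝ => F p.1 p.2) (U ×ˢ uIcc a b)) {x₀ : X} (hx₀ : x₀ ∈ U) :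
    ContinuousAt (fun x => ∫ t in a..b, F x t) x₀ := by
  obtain ⟨K, hK, hKU, hKc⟩ := LocallyCompactSpace.local_compact_nhds x₀ U (hU.mem_nhds hx₀)
  obtain ⟨C, hC⟩ := (hKc.prod (isCompact_uIcc (a := a) (b := b))).exists_bound_of_continuousOn
    (hF.mono (prod_mono hKU Subset.rfl))
  refine intervalIntegral.continuousAt_of_dominated_interval (bound := fun _ => C) ?_ ?_ ?_ ?_
  · filter_upwards [hU.mem_nhds hx₀] with x hx
    exact ((continuousOn_slice hF hx).mono uIoc_subset_uIcc).aestronglyMeasurable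
      measurableSet_uIoc
  · filter_upwards [hK] with x hx
    exact Eventually.of_forall fun t ht => hC (x, t) ⟨hx, uIoc_subset_uIcc ht⟩
  · exact intervalIntegrable_const
  · refine Eventually.of_forall fun t ht => ?_
    have h1 : ContinuousOn (fun x => F x t) U :=
      hF.comp (f := fun x : X => (x, t)) (by fun_prop) (fun x hx => ⟨hx, uIoc_subset_uIcc ht⟩)
    exact h1.continuousAt (hU.mem_nhds hx₀)

end ParametricIntegral

/-! ### Uniqueness for the second order equation of the elliptic sine. -/

section Uniqueness

/-- The right-hand side of the second order equation `s'' = snAccel m s` of the elliptic sine. -/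
noncomputable def snAccel (m x : ℂ) : ℂ := -(1 + m) * x + 2 * m * x ^ 3

/-- Solutions of the (time-changed) second order equation are determined by their initial data. -/
theorem system_unique {m : ℂ} {a b : ℝ} {c x y x' y' : ℝ → ℂ} (hc : ContinuousOn c (Icc a b))
    (hx : ContinuousOn x (Icc a b)) (hy : ContinuousOn y (Icc a b))
    (hx' : ContinuousOn x' (Icc a b)) (hy' : ContinuousOn y' (Icc a b))
    (dx : ∀ t ∈ Ico a b, HasDerivWithinAt x (c t * y t) (Ici t) t)
    (dy : ∀ t ∈ Ico a b, HasDerivWithinAt y (c t * snAccel m (x t)) (Ici t) t)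
    (dx' : ∀ t ∈ Ico a b, HasDerivWithinAt x' (c t * y' t) (Ici t) t)
    (dy' : ∀ t ∈ Ico a b, HasDerivWithinAt y' (c t * snAccel m (x' t)) (Ici t) t)
    (h0 : x a = x' a) (h1 : y a = y' a) :
    ∀ t ∈ Icc a b, x t = x' t ∧ y t = y' t := by
  obtain ⟨C, hC⟩ := isCompact_Icc.exists_bound_of_continuousOn hc
  obtain ⟨R₁, hR₁⟩ := isCompact_Icc.exists_bound_of_continuousOn hx
  obtain ⟨R₂, hR₂⟩ := isCompact_Icc.exists_bound_of_continuousOn hx'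
  set R := max (max R₁ R₂) 0 with hR
  have hR0 : 0 ≤ R := le_max_right _ _
  -- `M` is a Lipschitz constant of `snAccel m` on the disc of radius `R`, since `|p² + pq + q²| ≤ 3
  -- R²` there.
  set M := ‖1 + m‖ + 6 * ‖m‖ * R ^ 2 with hM
  have hM0 : 0 ≤ M := by positivity
  have hC0 : 0 ≤ max C 0 := le_max_right _ _
  -- Only the first coordinate needs a bound, because the field is linear in the second. The factor
  -- `c` is the velocity `dz/dt` of an arbitrary path in the `z`-plane.
  let v : ℝ → ℂ × ℂ → ℂ × ℂ := fun t p => (c t * p.2, c t * snAccel m p.1)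
  let s : ℝ → Set (ℂ × ℂ) := fun _ => {p | ‖p.1‖ ≤ R}
  have hlip : ∀ t ∈ Ico a b, LipschitzOnWith (⟨max C 0 * (1 + M), by positivity⟩ : NNReal)
      (v t) (s t) := by
    intro t ht
    refine LipschitzOnWith.of_dist_le_mul ?_
    intro p hp q hq
    have hct : ‖c t‖ ≤ max C 0 := (hC t (Ico_subset_Icc_self ht)).trans (le_max_left _ _)
    have hp' : ‖p.1‖ ≤ R := hp
    have hq' : ‖q.1‖ ≤ R := hq
    have e1 : ‖p.1 - q.1‖ ≤ dist p q := by rw [dist_eq_norm]; exact norm_fst_le (p - q)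
    have e2 : ‖p.2 - q.2‖ ≤ dist p q := by rw [dist_eq_norm]; exact norm_snd_le (p - q)
    have hg : ‖snAccel m p.1 - snAccel m q.1‖ ≤ M * ‖p.1 - q.1‖ := by
      have : snAccel m p.1 - snAccel m q.1
          = (-(1 + m) + 2 * m * (p.1 ^ 2 + p.1 * q.1 + q.1 ^ 2)) * (p.1 - q.1) := by
        unfold snAccel; ring
      rw [this, norm_mul]
      gcongr
      refine (norm_add_le _ _).trans ?_
      rw [norm_neg, hM]
      gcongr
      rw [norm_mul, norm_mul, Complex.norm_ofNat]
      have : ‖p.1 ^ 2 + p.1 * q.1 + q.1 ^ 2‖ ≤ 3 * R ^ 2 := by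
        refine (norm_add₃_le).trans ?_
        rw [norm_pow, norm_mul, norm_pow]
        have := norm_nonneg p.1
        have := norm_nonneg q.1
        nlinarith [mul_le_mul hp' hq' (norm_nonneg _) hR0, pow_le_pow_left₀ this hq' 2,
          pow_le_pow_left₀ (norm_nonneg p.1) hp' 2]
      calc 2 * ‖m‖ * ‖p.1 ^ 2 + p.1 * q.1 + q.1 ^ 2‖ ≤ 2 * ‖m‖ * (3 * R ^ 2) := by gcongr
        _ = 6 * ‖m‖ * R ^ 2 := by ring
    have hd0 : 0 ≤ dist p q := dist_nonneg
    rw [dist_eq_norm]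
    change ‖(c t * p.2 - c t * q.2, c t * snAccel m p.1 - c t * snAccel m q.1)‖
      ≤ max C 0 * (1 + M) * dist p q
    rw [Prod.norm_mk, ← mul_sub, ← mul_sub, norm_mul, norm_mul]
    refine max_le ?_ ?_
    · calc ‖c t‖ * ‖p.2 - q.2‖ ≤ max C 0 * dist p q := by gcongr
        _ ≤ max C 0 * (1 + M) * dist p q := by
          gcongr; nlinarith
    · calc ‖c t‖ * ‖snAccel m p.1 - snAccel m q.1‖ ≤ max C 0 * (M * dist p q) := by
            gcongr; exact hg.trans (by gcongr)
        _ ≤ max C 0 * (1 + M) * dist p q := by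
          rw [mul_assoc]; gcongr; linarith
  have key := ODE_solution_unique_of_mem_Icc_right (v := v) (s := s)
    (f := fun t => (x t, y t)) (g := fun t => (x' t, y' t)) hlip
    (hx.prodMk hy) (fun t ht => (dx t ht).prodMk (dy t ht))
    (fun t ht => (hR₁ t (Ico_subset_Icc_self ht)).trans
      ((le_max_left _ _).trans (le_max_left _ _)))
    (hx'.prodMk hy') (fun t ht => (dx' t ht).prodMk (dy' t ht))
    (fun t ht => (hR₂ t (Ico_subset_Icc_self ht)).trans
      ((le_max_right _ _).trans (le_max_left _ _)))
    (by simp [h0, h1])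
  intro t ht
  have := key ht
  simpa [Prod.ext_iff] using this

/-- Two solutions of `s'' = snAccel m s` on a ball with equal initial data at the centre agree. -/
theorem eqOn_ball_of_snAccel {m z₀ : ℂ} {r : ℝ} {f f₁ g g₁ : ℂ → ℂ}
    (hf : ∀ z ∈ Metric.ball z₀ r, HasDerivAt f (f₁ z) z)
    (hf₁ : ∀ z ∈ Metric.ball z₀ r, HasDerivAt f₁ (snAccel m (f z)) z)
    (hg : ∀ z ∈ Metric.ball z₀ r, HasDerivAt g (g₁ z) z)
    (hg₁ : ∀ z ∈ Metric.ball z₀ r, HasDerivAt g₁ (snAccel m (g z)) z)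
    (h0 : f z₀ = g z₀) (h1 : f₁ z₀ = g₁ z₀) : ∀ z ∈ Metric.ball z₀ r, f z = g z := by
  intro z hz
  have hmem : ∀ t ∈ Icc (0 : ℝ) 1, z₀ + t * (z - z₀) ∈ Metric.ball z₀ r := by
    intro t ht
    rw [Metric.mem_ball, dist_eq_norm] at hz ⊢
    rw [add_sub_cancel_left, norm_mul, Complex.norm_real, Real.norm_of_nonneg ht.1]
    nlinarith [norm_nonneg (z - z₀), ht.1, ht.2]
  have hline : ∀ t : ℝ, HasDerivAt (fun t : ℝ => z₀ + (t : ℂ) * (z - z₀)) (z - z₀) t := by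
    intro t
    simpa using ((Complex.ofRealCLM.hasDerivAt (x := t)).mul_const (z - z₀)).const_add z₀
  have comp : ∀ {F : ℂ → ℂ} {F' : ℂ → ℂ}, (∀ z ∈ Metric.ball z₀ r, HasDerivAt F (F' z) z) →
      ∀ t ∈ Icc (0 : ℝ) 1, HasDerivAt (fun t : ℝ => F (z₀ + (t : ℂ) * (z - z₀)))
        ((z - z₀) * F' (z₀ + (t : ℂ) * (z - z₀))) t := by
    intro F F' hF t ht
    exact (hF _ (hmem t ht)).scomp t (hline t)
  have cont : ∀ {F : ℂ → ℂ} {F' : ℂ → ℂ}, (∀ z ∈ Metric.ball z₀ r, HasDerivAt F (F' z) z) →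
      ContinuousOn (fun t : ℝ => F (z₀ + (t : ℂ) * (z - z₀))) (Icc 0 1) := fun hF t ht =>
    (comp hF t ht).continuousAt.continuousWithinAt
  have := system_unique (m := m) (a := 0) (b := 1) (c := fun _ => z - z₀) continuousOn_const
    (cont hf) (cont hf₁) (cont hg) (cont hg₁)
    (fun t ht => (comp hf t (Ico_subset_Icc_self ht)).hasDerivWithinAt)
    (fun t ht => (comp hf₁ t (Ico_subset_Icc_self ht)).hasDerivWithinAt)
    (fun t ht => (comp hg t (Ico_subset_Icc_self ht)).hasDerivWithinAt)
    (fun t ht => (comp hg₁ t (Ico_subset_Icc_self ht)).hasDerivWithinAt)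
    (by simpa using h0) (by simpa using h1) 1 ⟨zero_le_one, le_rfl⟩
  simpa using this.1

end Uniqueness

/-! ### Zeros of entire functions. -/

section Entire

theorem entire_eq_of_eventuallyEq {f g : ℂ → ℂ} (hf : Differentiable ℂ f)
    (hg : Differentiable ℂ g) {z₀ : ℂ} (h : f =ᶠ[𝓝 z₀] g) (z : ℂ) : f z = g z :=
  congrFun (AnalyticOnNhd.eq_of_eventuallyEq (fun z _ => hf.analyticAt z)
    (fun z _ => hg.analyticAt z) h) z

theorem entire_eventually_ne_zero {f : ℂ → ℂ} (hf : Differentiable ℂ f) (h : ∃ z, f z ≠ 0)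
    (z : ℂ) : ∀ᶠ w in 𝓝[≠] z, f w ≠ 0 := by
  rcases (hf.analyticAt z).eventually_eq_zero_or_eventually_ne_zero with h0 | h0
  · obtain ⟨w, hw⟩ := h
    exact absurd (entire_eq_of_eventuallyEq hf (differentiable_const 0) h0 w) hw
  · exact h0

theorem countable_zeros {f : ℂ → ℂ} (hf : Differentiable ℂ f) (h : ∃ z, f z ≠ 0) :
    {z | f z = 0}.Countable := by
  have hcl : IsClosed {z | f z = 0} := isClosed_eq hf.continuous continuous_const
  refine hcl.isLindelof.countable ?_
  rw [discreteTopology_subtype_iff]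
  intro x _
  rw [← disjoint_iff, disjoint_principal_right]
  exact entire_eventually_ne_zero hf h x

/-- Removing countably many points does not disconnect the plane. This makes the increment of a
logarithmic derivative a global constant. -/
theorem isPreconnected_ne_zero {f : ℂ → ℂ} (hf : Differentiable ℂ f) (h : ∃ z, f z ≠ 0) :
    IsPreconnected {z | f z ≠ 0} :=
  ((countable_zeros hf h).isPathConnected_compl_of_one_lt_rank
    (by simp [Complex.rank_real_complex])).isConnected.isPreconnected

end Entire

end JacobiElliptic


namespace JacobiElliptic
open Set Filter Topology MeasureTheory

/-! ### The local elliptic sine and its duplication formulas. -/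

section LocalSolution

/-- A local solution `s` of the differential equation of the elliptic sine, with derivative `s₁`,
together with a second antiderivative `l` of `m * s ^ 2`. -/
structure LocalSn (m : ℂ) (r : ℝ) (s s₁ l l₁ : ℂ → ℂ) : Prop where
  pos : 0 < r
  hs : ∀ z ∈ Metric.ball (0 : ℂ) r, HasDerivAt s (s₁ z) z
  hs₁ : ∀ z ∈ Metric.ball (0 : ℂ) r, HasDerivAt s₁ (snAccel m (s z)) z
  ode : ∀ z ∈ Metric.ball (0 : ℂ) r, s₁ z ^ 2 = (1 - s z ^ 2) * (1 - m * s z ^ 2)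
  hl : ∀ z ∈ Metric.ball (0 : ℂ) r, HasDerivAt l (l₁ z) z
  hl₁ : ∀ z ∈ Metric.ball (0 : ℂ) r, HasDerivAt l₁ (m * s z ^ 2) z
  ne : ∀ z ∈ Metric.ball (0 : ℂ) r, 1 - m * s z ^ 4 ≠ 0
  s0 : s 0 = 0
  s₁0 : s₁ 0 = 1
  l0 : l 0 = 0
  l₁0 : l₁ 0 = 0

/-- With `f u = (1 - u²)(1 - m u²)` and `q = √f` near `0`, `s` is the local inverse of a primitive
of `1 / q`, so `s' = q(s)`. From `(q²)' = 2 snAccel` one gets `q' = snAccel / q`, and the chain rule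
cancels `q` in `s''`. -/
theorem exists_inverse_solution (m : ℂ) :
    ∃ s q : ℂ → ℂ, s 0 = 0 ∧ q (s 0) = 1 ∧ ContinuousAt s 0 ∧
      ∀ᶠ z in 𝓝 (0 : ℂ), HasDerivAt s (q (s z)) z ∧
        HasDerivAt (fun z => q (s z)) (snAccel m (s z)) z ∧
        q (s z) ^ 2 = (1 - s z ^ 2) * (1 - m * s z ^ 2) := by
  set f : ℂ → ℂ := fun u => (1 - u ^ 2) * (1 - m * u ^ 2) with hf
  have hfc : Continuous f := by fun_prop
  have hf0 : f 0 = 1 := by simp [hf]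
  have hev : ∀ᶠ u in 𝓝 (0 : ℂ), f u ∈ Complex.slitPlane :=
    hfc.continuousAt.eventually_mem
      (Complex.isOpen_slitPlane.mem_nhds (by rw [hf0]; exact Complex.one_mem_slitPlane))
  obtain ⟨r, hr, hball⟩ := Metric.nhds_basis_ball.mem_iff.1 hev
  set q : ℂ → ℂ := fun u => f u ^ (1 / 2 : ℂ) with hq
  have hq2 : ∀ u, q u ^ 2 = f u := by
    intro u
    change (f u ^ (1 / 2 : ℂ)) ^ 2 = f u
    rw [← Complex.cpow_mul_nat]
    norm_num
  have hfd : ∀ u, HasDerivAt f (2 * snAccel m u) u := by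
    intro u
    have h1 : HasDerivAt (fun u : ℂ => 1 - u ^ 2) (-(2 * u)) u := by
      simpa using (hasDerivAt_pow 2 u).const_sub 1
    have h2 : HasDerivAt (fun u : ℂ => 1 - m * u ^ 2) (-(m * (2 * u))) u := by
      simpa using ((hasDerivAt_pow 2 u).const_mul m).const_sub 1
    refine (h1.mul h2).congr_deriv ?_
    unfold snAccel; ring
  have hq0 : ∀ u ∈ Metric.ball (0 : ℂ) r, q u ≠ 0 := by
    intro u hu h
    have := hq2 u
    rw [h] at this
    exact Complex.slitPlane_ne_zero (hball hu) (by rw [← this]; ring)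
  have hqd : ∀ u ∈ Metric.ball (0 : ℂ) r, HasDerivAt q (snAccel m u / q u) u := by
    intro u hu
    have h1 : DifferentiableAt ℂ q u :=
      ((hfd u).differentiableAt).cpow_const (hball hu)
    have h2 : HasDerivAt (fun u => q u ^ 2) (2 * snAccel m u) u :=
      (hfd u).congr_of_eventuallyEq (Eventually.of_forall hq2)
    have h3 := (h1.hasDerivAt.pow 2).unique h2
    have h4 : deriv q u = snAccel m u / q u := by
      rw [eq_div_iff (hq0 u hu)]
      have : (2 : ℂ) * (deriv q u * q u) = 2 * snAccel m u := by
        rw [← h3]; push_cast; ring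
      exact mul_left_cancel₀ two_ne_zero this
    rw [← h4]; exact h1.hasDerivAt
  have hex : DifferentiableOn ℂ (fun u => (q u)⁻¹) (Metric.ball 0 r) := fun u hu =>
    ((hqd u hu).differentiableAt.inv (hq0 u hu)).differentiableWithinAt
  obtain ⟨F, hF0, hF⟩ := hex.isExactOn_ball.with_val_at 0 0
  have h0mem : (0 : ℂ) ∈ Metric.ball (0 : ℂ) r := Metric.mem_ball_self hr
  have hFan : AnalyticAt ℂ F 0 := by
    have : DifferentiableOn ℂ F (Metric.ball 0 r) := fun u hu =>
      (hF u hu).differentiableAt.differentiableWithinAt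
    exact this.analyticAt (Metric.ball_mem_nhds 0 hr)
  have hq00 : q 0 = 1 := by simp [hq, hf0]
  have hF' : deriv F 0 ≠ 0 := by rw [(hF 0 h0mem).deriv, hq00]; simp
  set s := hFan.hasStrictDerivAt.localInverse _ _ _ hF' with hs
  have hsan : AnalyticAt ℂ s 0 := by
    have := hFan.analyticAt_localInverse hF'
    rwa [hF0] at this
  have hs0 : s 0 = 0 := by
    have := hFan.hasStrictDerivAt.eventually_left_inverse hF'
    have := this.self_of_nhds
    rwa [hF0] at this
  have hinv : ∀ᶠ z in 𝓝 (0 : ℂ), F (s z) = z := by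
    have := hFan.hasStrictDerivAt.eventually_right_inverse hF'
    rwa [hF0] at this
  have hmem : ∀ᶠ z in 𝓝 (0 : ℂ), s z ∈ Metric.ball (0 : ℂ) r :=
    hsan.continuousAt.eventually_mem (by rw [hs0]; exact Metric.ball_mem_nhds 0 hr)
  refine ⟨s, q, hs0, by rw [hs0, hq00], hsan.continuousAt, ?_⟩
  filter_upwards [hinv.eventually_nhds, hmem, hsan.eventually_analyticAt] with z h1 h2 h3
  have hd : HasDerivAt s (q (s z)) z := by
    have h4 := (hF _ h2).comp z h3.differentiableAt.hasDerivAt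
    have h5 : HasDerivAt (F ∘ s) 1 z := (hasDerivAt_id z).congr_of_eventuallyEq h1
    have h6 := h4.unique h5
    have : deriv s z = q (s z) := by
      have := hq0 _ h2
      field_simp at h6
      exact h6
    rw [← this]; exact h3.differentiableAt.hasDerivAt
  refine ⟨hd, ?_, hq2 _⟩
  refine ((hqd _ h2).comp z hd).congr_deriv ?_
  rw [div_mul_cancel₀ _ (hq0 _ h2)]

theorem exists_localSn (m : ℂ) : ∃ r s s₁ l l₁, LocalSn m r s s₁ l l₁ := by
  obtain ⟨s, q, hs0, hq0, hsc, hev⟩ := exists_inverse_solution m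
  have hne : ∀ᶠ z in 𝓝 (0 : ℂ), 1 - m * s z ^ 4 ≠ 0 := by
    have : ContinuousAt (fun z => 1 - m * s z ^ 4) 0 := by fun_prop
    exact this.eventually_ne (by simp [hs0])
  obtain ⟨r, hr, hball⟩ := Metric.nhds_basis_ball.mem_iff.1 (hev.and hne)
  have hd : DifferentiableOn ℂ (fun z => m * s z ^ 2) (Metric.ball 0 r) := fun z hz =>
    (((hball hz).1.1.differentiableAt.pow 2).const_mul m).differentiableWithinAt
  -- Two integrations of `m s²`: the function `exp (-l)` will become the denominator of `sn`.
  obtain ⟨l₁, hl₁0, hl₁⟩ := hd.isExactOn_ball.with_val_at 0 0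
  have hd₁ : DifferentiableOn ℂ l₁ (Metric.ball 0 r) := fun z hz =>
    (hl₁ z hz).differentiableAt.differentiableWithinAt
  obtain ⟨l, hl0, hl⟩ := hd₁.isExactOn_ball.with_val_at 0 0
  exact ⟨r, s, fun z => q (s z), l, l₁, hr, fun z hz => (hball hz).1.1,
    fun z hz => (hball hz).1.2.1, fun z hz => (hball hz).1.2.2, hl, hl₁,
    fun z hz => (hball hz).2, hs0, hq0, hl0, hl₁0⟩

variable {m : ℂ} {r : ℝ} {s s₁ l l₁ : ℂ → ℂ}

theorem half_mem_ball {z : ℂ} {r : ℝ} (hz : z ∈ Metric.ball (0 : ℂ) r) :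
    z / 2 ∈ Metric.ball (0 : ℂ) r := by
  rw [mem_ball_zero_iff] at hz ⊢
  rw [norm_div, Complex.norm_ofNat]
  linarith [norm_nonneg z]

/-- The derivative of the right-hand side of the doubling formula, up to its denominator. -/
noncomputable def doubleDeriv (m x : ℂ) : ℂ :=
  ((1 - x ^ 2) * (1 - m * x ^ 2) + x * snAccel m x) * (1 - m * x ^ 4)
    + 4 * m * x ^ 4 * ((1 - x ^ 2) * (1 - m * x ^ 2))

theorem hasDerivAt_half (z : ℂ) : HasDerivAt (fun z : ℂ => z / 2) (1 / 2) z :=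
  (hasDerivAt_id z).div_const 2

theorem LocalSn.hasDerivAt_s_half (h : LocalSn m r s s₁ l l₁) {z : ℂ}
    (hz : z ∈ Metric.ball (0 : ℂ) r) :
    HasDerivAt (fun z => s (z / 2)) (s₁ (z / 2) * (1 / 2)) z :=
  (h.hs _ (half_mem_ball hz)).comp z (hasDerivAt_half z)

theorem LocalSn.hasDerivAt_double (h : LocalSn m r s s₁ l l₁) {z : ℂ}
    (hz : z ∈ Metric.ball (0 : ℂ) r) :
    HasDerivAt (fun z => 2 * s (z / 2) * s₁ (z / 2) / (1 - m * s (z / 2) ^ 4))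
      (doubleDeriv m (s (z / 2)) / (1 - m * s (z / 2) ^ 4) ^ 2) z := by
  have hz2 := half_mem_ball hz
  have e1 := h.hasDerivAt_s_half hz
  have e2 : HasDerivAt (fun z => s₁ (z / 2)) (snAccel m (s (z / 2)) * (1 / 2)) z :=
    (h.hs₁ _ hz2).comp z (hasDerivAt_half z)
  have hne := h.ne _ hz2
  have := ((e1.const_mul 2).mul e2).div (((e1.pow 4).const_mul m).const_sub 1) hne
  refine this.congr_deriv ?_
  have ho := h.ode _ hz2
  simp only [Pi.mul_apply, Pi.pow_apply]
  unfold doubleDeriv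
  congr 1
  linear_combination (1 - m * s (z / 2) ^ 4 + 4 * m * s (z / 2) ^ 4) * ho

/-- Doubling formula of the elliptic sine, in the half argument. -/
theorem LocalSn.sn_double (h : LocalSn m r s s₁ l l₁) :
    ∀ z ∈ Metric.ball (0 : ℂ) r,
      s z = 2 * s (z / 2) * s₁ (z / 2) / (1 - m * s (z / 2) ^ 4) := by
  -- Both sides solve the same second order equation with the same data at `0`; the check is
  -- algebraic once `ode` eliminates even powers of `s₁`.
  refine eqOn_ball_of_snAccel (m := m) (f₁ := s₁)
    (g₁ := fun z => doubleDeriv m (s (z / 2)) / (1 - m * s (z / 2) ^ 4) ^ 2) h.hs h.hs₁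
    (fun z hz => h.hasDerivAt_double hz) ?_ ?_ ?_
  · intro z hz
    have hz2 := half_mem_ball hz
    have e1 := h.hasDerivAt_s_half hz
    have hne := h.ne _ hz2
    have ho := h.ode _ hz2
    unfold doubleDeriv snAccel
    have p1 := (e1.pow 2).const_sub 1
    have p2 := ((e1.pow 2).const_mul m).const_sub 1
    have p3 := ((e1.const_mul (-(1 + m))).add ((e1.pow 3).const_mul (2 * m)))
    have p4 := ((e1.pow 4).const_mul m).const_sub 1
    have p5 := (e1.pow 4).const_mul (4 * m)
    have := ((((p1.mul p2).add (e1.mul p3)).mul p4).add (p5.mul (p1.mul p2))).div (p4.pow 2)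
      (pow_ne_zero 2 hne)
    refine this.congr_deriv ?_
    simp only [Pi.mul_apply, Pi.pow_apply, Pi.add_apply]
    clear this p1 p2 p3 p4 p5
    generalize s (z / 2) = x at *
    generalize s₁ (z / 2) = y at *
    push_cast
    field_simp
    congr 1
    linear_combination (-32 * m * x ^ 3 * y) * ho
  · simp [h.s0]
  · simp [h.s0, h.s₁0, doubleDeriv]

theorem LocalSn.s₁_double (h : LocalSn m r s s₁ l l₁) {z : ℂ}
    (hz : z ∈ Metric.ball (0 : ℂ) r) :
    s₁ z = doubleDeriv m (s (z / 2)) / (1 - m * s (z / 2) ^ 4) ^ 2 := by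
  refine (h.hs z hz).unique ((h.hasDerivAt_double hz).congr_of_eventuallyEq ?_)
  filter_upwards [Metric.isOpen_ball.mem_nhds hz] with w hw using h.sn_double w hw

theorem eq_on_ball_of_hasDerivAt_zero {f : ℂ → ℂ} {r : ℝ}
    (hf : ∀ z ∈ Metric.ball (0 : ℂ) r, HasDerivAt f 0 z) {z : ℂ}
    (hz : z ∈ Metric.ball (0 : ℂ) r) : f z = f 0 := by
  have hr : 0 < r := (norm_nonneg z).trans_lt (mem_ball_zero_iff.1 hz)
  exact Metric.isOpen_ball.is_const_of_deriv_eq_zero (convex_ball 0 r).isPreconnected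
    (fun w hw => (hf w hw).differentiableAt.differentiableWithinAt)
    (fun w hw => (hf w hw).deriv) hz (Metric.mem_ball_self hr)

/-- The duplication formula for the integral of the second kind: by `sn_double` the difference of
the two sides has derivative zero. -/
theorem LocalSn.l₁_double (h : LocalSn m r s s₁ l l₁) {z : ℂ}
    (hz : z ∈ Metric.ball (0 : ℂ) r) :
    l₁ z = 2 * l₁ (z / 2) + m * s (z / 2) ^ 2 * s z := by
  rw [← sub_eq_zero]
  have key := eq_on_ball_of_hasDerivAt_zero
    (f := fun z => l₁ z - (2 * l₁ (z / 2) + m * s (z / 2) ^ 2 * s z)) (r := r) ?_ hz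
  · rw [key]; simp [h.s0, h.l₁0]
  intro w hw
  have hw2 := half_mem_ball hw
  have e1 := h.hasDerivAt_s_half hw
  have e2 : HasDerivAt (fun z => l₁ (z / 2)) (m * s (w / 2) ^ 2 * (1 / 2)) w :=
    (h.hl₁ _ hw2).comp w (hasDerivAt_half w)
  have := (h.hl₁ w hw).sub ((e2.const_mul 2).add (((e1.pow 2).const_mul m).mul (h.hs w hw)))
  refine this.congr_deriv ?_
  have ho := h.ode _ hw2
  have hne := h.ne _ hw2
  simp only [Pi.pow_apply]
  rw [h.s₁_double hw, h.sn_double w hw]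
  clear this e1 e2
  unfold doubleDeriv snAccel
  generalize s (w / 2) = x at *
  generalize s₁ (w / 2) = y at *
  push_cast
  field_simp
  linear_combination (2 * x ^ 2 * m * (2 - (1 - m * x ^ 4))) * ho

/-- By `l₁_double` and `sn_double` both sides have the same logarithmic derivative. Multiplied out
with `S = s N`, this is the denominator-free formula `N(z) = N(z/2)⁴ - m S(z/2)⁴`. -/
theorem LocalSn.exp_double (h : LocalSn m r s s₁ l l₁) {z : ℂ}
    (hz : z ∈ Metric.ball (0 : ℂ) r) :
    Complex.exp (-l z) = Complex.exp (-l (z / 2)) ^ 4 * (1 - m * s (z / 2) ^ 4) := by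
  have key := eq_on_ball_of_hasDerivAt_zero
    (f := fun z => Complex.exp (-l z + 4 * l (z / 2)) / (1 - m * s (z / 2) ^ 4)) (r := r) ?_ hz
  · simp only [h.l0] at key
    have hne := h.ne _ (half_mem_ball hz)
    rw [div_eq_iff hne, Complex.exp_add] at key
    simp only [zero_div, h.s0, h.l0] at key
    have e : Complex.exp (4 * l (z / 2)) * Complex.exp (-l (z / 2)) ^ 4 = 1 := by
      rw [← Complex.exp_nat_mul, ← Complex.exp_add]
      simp
    calc Complex.exp (-l z)
        = Complex.exp (-l z) * Complex.exp (4 * l (z / 2)) * Complex.exp (-l (z / 2)) ^ 4 := by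
          rw [mul_assoc, e, mul_one]
      _ = _ := by rw [key]; simp; ring
  intro w hw
  have hw2 := half_mem_ball hw
  have e1 := h.hasDerivAt_s_half hw
  have hne := h.ne _ hw2
  have e2 : HasDerivAt (fun z => l (z / 2)) (l₁ (w / 2) * (1 / 2)) w :=
    (h.hl _ hw2).comp w (hasDerivAt_half w)
  have := (((h.hl w hw).neg.add (e2.const_mul 4)).cexp).div
    (((e1.pow 4).const_mul m).const_sub 1) hne
  refine this.congr_deriv ?_
  simp only [Pi.pow_apply, Pi.add_apply, Pi.neg_apply]
  rw [h.l₁_double hw, h.sn_double w hw]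
  clear this e1 e2
  generalize s (w / 2) = x at *
  push_cast
  field_simp
  ring

end LocalSolution
end JacobiElliptic


namespace JacobiElliptic
open Set Filter Topology MeasureTheory

/-! ### Entire extension by repeated duplication. -/

section Extension

/-- The numerator `S ^ 2 * (S / N)'`-type Wronskian `S' N - S N'`. -/
noncomputable def wr (S N : ℂ → ℂ) (z : ℂ) : ℂ := deriv S z * N z - S z * deriv N z

/-- The doubling operator on pairs of functions. -/
noncomputable def doubling (m : ℂ) (p : (ℂ → ℂ) × (ℂ → ℂ)) : (ℂ → ℂ) × (ℂ → ℂ) :=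
  (fun z => 2 * p.1 (z / 2) * p.2 (z / 2) * wr p.1 p.2 (z / 2),
    fun z => p.2 (z / 2) ^ 4 - m * p.1 (z / 2) ^ 4)

/-- Equality of pairs of functions on a set. -/
def PairEqOn (p q : (ℂ → ℂ) × (ℂ → ℂ)) (s : Set ℂ) : Prop :=
  EqOn p.1 q.1 s ∧ EqOn p.2 q.2 s

theorem half_mem_ball_iff {z : ℂ} {r : ℝ} :
    z / 2 ∈ Metric.ball (0 : ℂ) r ↔ z ∈ Metric.ball (0 : ℂ) (2 * r) := by
  rw [mem_ball_zero_iff, mem_ball_zero_iff, norm_div, Complex.norm_ofNat,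
    div_lt_iff₀ two_pos, mul_comm]

theorem PairEqOn.doubling {m : ℂ} {p q : (ℂ → ℂ) × (ℂ → ℂ)} {r : ℝ}
    (h : PairEqOn p q (Metric.ball 0 r)) :
    PairEqOn (doubling m p) (doubling m q) (Metric.ball 0 (2 * r)) := by
  constructor
  · intro z hz
    have hz2 := half_mem_ball_iff.2 hz
    have hn := Metric.isOpen_ball.mem_nhds hz2
    have d1 : deriv p.1 (z / 2) = deriv q.1 (z / 2) :=
      (h.1.eventuallyEq_of_mem hn).deriv_eq
    have d2 : deriv p.2 (z / 2) = deriv q.2 (z / 2) :=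
      (h.2.eventuallyEq_of_mem hn).deriv_eq
    simp only [JacobiElliptic.doubling, wr, h.1 hz2, h.2 hz2, d1, d2]
  · intro z hz
    have hz2 := half_mem_ball_iff.2 hz
    simp only [JacobiElliptic.doubling, h.1 hz2, h.2 hz2]

theorem differentiableOn_doubling {m : ℂ} {p : (ℂ → ℂ) × (ℂ → ℂ)} {r : ℝ}
    (h1 : DifferentiableOn ℂ p.1 (Metric.ball 0 r))
    (h2 : DifferentiableOn ℂ p.2 (Metric.ball 0 r)) :
    DifferentiableOn ℂ (doubling m p).1 (Metric.ball 0 (2 * r)) ∧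
      DifferentiableOn ℂ (doubling m p).2 (Metric.ball 0 (2 * r)) := by
  have hm : MapsTo (fun z : ℂ => z / 2) (Metric.ball 0 (2 * r)) (Metric.ball 0 r) :=
    fun z hz => half_mem_ball_iff.2 hz
  have hd : DifferentiableOn ℂ (fun z : ℂ => z / 2) (Metric.ball 0 (2 * r)) := by fun_prop
  have c1 := h1.comp hd hm
  have c2 := h2.comp hd hm
  have c3 := (h1.deriv Metric.isOpen_ball).comp hd hm
  have c4 := (h2.deriv Metric.isOpen_ball).comp hd hm
  exact ⟨((c1.const_mul 2).mul c2).mul ((c3.mul c2).sub (c1.mul c4)),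
    (c2.pow 4).sub ((c1.pow 4).const_mul m)⟩

/-- As `doubling` reads its argument at `z / 2`, each application doubles the ball on which an
identity is known. Successive iterates thus agree on growing balls. -/
theorem pairEqOn_iterate {m : ℂ} {p : (ℂ → ℂ) × (ℂ → ℂ)} {r : ℝ} (hr : 0 < r)
    (hp : PairEqOn (doubling m p) p (Metric.ball 0 r)) {i j : ℕ} (hij : i ≤ j) :
    PairEqOn ((doubling m)^[j] p) ((doubling m)^[i] p) (Metric.ball 0 (2 ^ i * r)) := by
  have step : ∀ n : ℕ, PairEqOn ((doubling m)^[n + 1] p) ((doubling m)^[n] p)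
      (Metric.ball 0 (2 ^ n * r)) := by
    intro n
    induction n with
    | zero => simpa using hp
    | succ n ih =>
      rw [Function.iterate_succ_apply' _ (n + 1), Function.iterate_succ_apply' _ n, pow_succ,
        mul_comm (2 ^ n) (2 : ℝ), mul_assoc]
      rw [Function.iterate_succ_apply'] at ih
      exact ih.doubling
  induction j, hij using Nat.le_induction with
  | base => exact ⟨fun _ _ => rfl, fun _ _ => rfl⟩
  | succ j hij ih =>
    have hsub : Metric.ball (0 : ℂ) (2 ^ i * r) ⊆ Metric.ball 0 (2 ^ j * r) := by
      apply Metric.ball_subset_ball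
      gcongr
      norm_num
    exact ⟨fun z hz => ((step j).1 (hsub hz)).trans (ih.1 hz),
      fun z hz => ((step j).2 (hsub hz)).trans (ih.2 hz)⟩

/-- A pair of holomorphic functions on a ball that is invariant under the doubling operator
extends to a pair of entire functions. -/
theorem exists_entire_extension {m : ℂ} {p : (ℂ → ℂ) × (ℂ → ℂ)} {r : ℝ} (hr : 0 < r)
    (h1 : DifferentiableOn ℂ p.1 (Metric.ball 0 r))
    (h2 : DifferentiableOn ℂ p.2 (Metric.ball 0 r))
    (hp : PairEqOn (doubling m p) p (Metric.ball 0 r)) :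
    ∃ q : (ℂ → ℂ) × (ℂ → ℂ), Differentiable ℂ q.1 ∧ Differentiable ℂ q.2 ∧
      PairEqOn q p (Metric.ball 0 r) := by
  have hdiff : ∀ n : ℕ, DifferentiableOn ℂ ((doubling m)^[n] p).1 (Metric.ball 0 (2 ^ n * r)) ∧
      DifferentiableOn ℂ ((doubling m)^[n] p).2 (Metric.ball 0 (2 ^ n * r)) := by
    intro n
    induction n with
    | zero => simpa using ⟨h1, h2⟩
    | succ n ih =>
      rw [Function.iterate_succ_apply', pow_succ, mul_comm (2 ^ n) (2 : ℝ), mul_assoc]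
      exact differentiableOn_doubling ih.1 ih.2
  -- Since `n < 2 ^ n`, this many iterations suffice to reach `z`; compatibility of the iterates
  -- makes `q` locally equal to one holomorphic iterate.
  let K : ℂ → ℕ := fun z => ⌈‖z‖ / r⌉₊
  have hK : ∀ z, z ∈ Metric.ball (0 : ℂ) (2 ^ K z * r) := by
    intro z
    rw [mem_ball_zero_iff, ← div_lt_iff₀ hr]
    refine (Nat.le_ceil _).trans_lt ?_
    exact_mod_cast Nat.lt_two_pow_self
  let q : (ℂ → ℂ) × (ℂ → ℂ) :=
    (fun z => ((doubling m)^[K z] p).1 z, fun z => ((doubling m)^[K z] p).2 z)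
  have hq : ∀ n, PairEqOn q ((doubling m)^[n] p) (Metric.ball 0 (2 ^ n * r)) := by
    intro n
    constructor
    · intro z hz
      rcases le_total n (K z) with h | h
      · exact (pairEqOn_iterate hr hp h).1 hz
      · exact ((pairEqOn_iterate hr hp h).1 (hK z)).symm
    · intro z hz
      rcases le_total n (K z) with h | h
      · exact (pairEqOn_iterate hr hp h).2 hz
      · exact ((pairEqOn_iterate hr hp h).2 (hK z)).symm
  refine ⟨q, fun z => ?_, fun z => ?_, by simpa using hq 0⟩
  · have hn := Metric.isOpen_ball.mem_nhds (hK z)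
    exact ((hdiff (K z)).1.differentiableAt hn).congr_of_eventuallyEq
      ((hq (K z)).1.eventuallyEq_of_mem hn)
  · have hn := Metric.isOpen_ball.mem_nhds (hK z)
    exact ((hdiff (K z)).2.differentiableAt hn).congr_of_eventuallyEq
      ((hq (K z)).2.eventuallyEq_of_mem hn)

end Extension

/-! ### The entire numerator and denominator of the elliptic sine. -/

section SnPair

/-- Entire functions `S`, `N` without common zeros whose quotient is the elliptic sine of
parameter `m = k ^ 2`, normalised like Jacobi's theta functions. -/
structure SnPair (m : ℂ) (S N : ℂ → ℂ) : Prop where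
  diffS : Differentiable ℂ S
  diffN : Differentiable ℂ N
  S_zero : S 0 = 0
  N_zero : N 0 = 1
  deriv_S_zero : deriv S 0 = 1
  wr_sq : ∀ z, wr S N z ^ 2 = (N z ^ 2 - S z ^ 2) * (N z ^ 2 - m * S z ^ 2)
  deriv_wr : ∀ z, deriv (wr S N) z * N z - 2 * wr S N z * deriv N z
    = -(1 + m) * S z * N z ^ 2 + 2 * m * S z ^ 3
  logN : ∀ z, deriv N z ^ 2 - deriv (deriv N) z * N z = m * S z ^ 2
  logS : ∀ z, deriv S z ^ 2 - deriv (deriv S) z * S z = N z ^ 2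
  no_common_zero : ∀ z, N z = 0 → S z ≠ 0

/-- A common zero `z` forces common zeros at `z / 2 ^ n` for all `n`, and these tend to `0`, where
`N = 1`. -/
theorem no_common_zero_of_double {m : ℂ} (hm0 : m ≠ 0) (hm1 : m ≠ 1) {S N : ℂ → ℂ}
    (hN : Continuous N) (hN0 : N 0 = 1)
    (hT : ∀ z, wr S N z ^ 2 = (N z ^ 2 - S z ^ 2) * (N z ^ 2 - m * S z ^ 2))
    (hS2 : ∀ z, S z = 2 * S (z / 2) * N (z / 2) * wr S N (z / 2))
    (hN2 : ∀ z, N z = N (z / 2) ^ 4 - m * S (z / 2) ^ 4) (z : ℂ) (hz : N z = 0) : S z ≠ 0 := by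
  intro hSz
  have step : ∀ w, N w = 0 ∧ S w = 0 → N (w / 2) = 0 ∧ S (w / 2) = 0 := by
    rintro w ⟨h1, h2⟩
    rw [hN2] at h1
    rw [hS2] at h2
    have h3 := hT (w / 2)
    generalize S (w / 2) = x at *
    generalize N (w / 2) = y at *
    have hx : x = 0 → y = 0 := by
      rintro rfl
      simpa using h1
    have hx' : x = 0 := by
      -- If the Wronskian vanishes, then `y² = x²` or `y² = m x²`; together with `y⁴ = m x⁴` this
      -- leaves a nonzero multiple of `x⁴` equal to zero.
      have hmm : m * (m - 1) ≠ 0 := mul_ne_zero hm0 (sub_ne_zero.2 hm1)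
      rcases mul_eq_zero.1 h2 with h | h
      · rcases mul_eq_zero.1 h with h | h
        · simpa using h
        · rw [h] at h1
          simpa [hm0] using h1
      · rw [h] at h3
        rcases mul_eq_zero.1 (h3.symm.trans (by norm_num : (0 : ℂ) ^ 2 = 0)) with h4 | h4
        · have : (m - 1) * x ^ 4 = 0 := by linear_combination -h1 + (y ^ 2 + x ^ 2) * h4
          simpa [sub_ne_zero.2 hm1] using this
        · have : m * (m - 1) * x ^ 4 = 0 := by
            linear_combination h1 - (y ^ 2 + m * x ^ 2) * h4
          exact pow_eq_zero_iff (four_ne_zero) |>.1 ((mul_eq_zero.1 this).resolve_left hmm)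
    exact ⟨hx hx', hx'⟩
  have hall : ∀ n : ℕ, N (z / 2 ^ n) = 0 ∧ S (z / 2 ^ n) = 0 := by
    intro n
    induction n with
    | zero => simpa using ⟨hz, hSz⟩
    | succ n ih => simpa [pow_succ, div_div] using step _ ih
  have hlim : Tendsto (fun n : ℕ => z / 2 ^ n) atTop (𝓝 0) := by
    have := (tendsto_pow_atTop_nhds_zero_of_norm_lt_one (x := (1 / 2 : ℂ)) (by norm_num)).const_mul z
    simpa [div_eq_mul_inv] using this
  have h1 : Tendsto (fun n : ℕ => N (z / 2 ^ n)) atTop (𝓝 (N 0)) :=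
    (hN.tendsto 0).comp hlim
  simp only [fun n => (hall n).1] at h1
  have := tendsto_nhds_unique h1 tendsto_const_nhds
  rw [hN0] at this
  exact one_ne_zero this

theorem exists_snPair {m : ℂ} (hm0 : m ≠ 0) (hm1 : m ≠ 1) : ∃ S N, SnPair m S N := by
  obtain ⟨r, s, s₁, l, l₁, h⟩ := exists_localSn m
  set n : ℂ → ℂ := fun z => Complex.exp (-l z) with hn
  have B := fun z (hz : z ∈ Metric.ball (0 : ℂ) r) => Metric.isOpen_ball.mem_nhds hz
  have dn : ∀ z ∈ Metric.ball (0 : ℂ) r, HasDerivAt n (-l₁ z * n z) z := fun z hz =>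
    ((h.hl z hz).neg.cexp).congr_deriv (by simp only [hn, Pi.neg_apply]; ring)
  have dsn : ∀ z ∈ Metric.ball (0 : ℂ) r,
      HasDerivAt (fun z => s z * n z) ((s₁ z - s z * l₁ z) * n z) z := fun z hz =>
    ((h.hs z hz).mul (dn z hz)).congr_deriv (by ring)
  have hwr : ∀ z ∈ Metric.ball (0 : ℂ) r, wr (fun z => s z * n z) n z = s₁ z * n z ^ 2 := by
    intro z hz
    rw [wr, (dsn z hz).deriv, (dn z hz).deriv]; ring
  -- The local pair `(s n, n)` is a fixed point of `doubling`. Although `n` is an exponential, its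
  -- extension may vanish: its zeros are the poles of `sn`.
  obtain ⟨⟨S, N⟩, dS, dN, hS, hN⟩ := exists_entire_extension (m := m)
    (p := (fun z => s z * n z, n)) h.pos
    (fun z hz => (dsn z hz).differentiableAt.differentiableWithinAt)
    (fun z hz => (dn z hz).differentiableAt.differentiableWithinAt) (by
      constructor
      · intro z hz
        have hz2 := half_mem_ball hz
        change 2 * (s (z / 2) * n (z / 2)) * n (z / 2) * wr (fun z => s z * n z) n (z / 2)
          = s z * n z
        have hne := h.ne _ hz2
        have e : n z = n (z / 2) ^ 4 * (1 - m * s (z / 2) ^ 4) := h.exp_double hz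
        rw [hwr _ hz2, h.sn_double z hz, e]
        generalize 1 - m * s (z / 2) ^ 4 = Q at *
        field_simp
      · intro z hz
        have e : n z = n (z / 2) ^ 4 * (1 - m * s (z / 2) ^ 4) := h.exp_double hz
        change n (z / 2) ^ 4 - m * (s (z / 2) * n (z / 2)) ^ 4 = n z
        rw [e]; ring)
  simp only at dS dN hS hN
  have h0 : (0 : ℂ) ∈ Metric.ball (0 : ℂ) r := Metric.mem_ball_self h.pos
  have DN : ∀ z ∈ Metric.ball (0 : ℂ) r, deriv N z = -l₁ z * n z := fun z hz =>
    ((dn z hz).congr_of_eventuallyEq (hN.eventuallyEq_of_mem (B z hz))).deriv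
  have DS : ∀ z ∈ Metric.ball (0 : ℂ) r, deriv S z = (s₁ z - s z * l₁ z) * n z := fun z hz =>
    ((dsn z hz).congr_of_eventuallyEq (hS.eventuallyEq_of_mem (B z hz))).deriv
  have DDN : ∀ z ∈ Metric.ball (0 : ℂ) r,
      deriv (deriv N) z = (l₁ z ^ 2 - m * s z ^ 2) * n z := fun z hz =>
    ((((h.hl₁ z hz).neg.mul (dn z hz)).congr_of_eventuallyEq
      (EqOn.eventuallyEq_of_mem DN (B z hz))).deriv).trans (by simp only [Pi.neg_apply]; ring)
  have DDS : ∀ z ∈ Metric.ball (0 : ℂ) r, deriv (deriv S) z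
      = (snAccel m (s z) - s₁ z * l₁ z - s z * (m * s z ^ 2)) * n z
        - (s₁ z - s z * l₁ z) * l₁ z * n z := fun z hz =>
    (((((h.hs₁ z hz).sub ((h.hs z hz).mul (h.hl₁ z hz))).mul (dn z hz)).congr_of_eventuallyEq
      (EqOn.eventuallyEq_of_mem DS (B z hz))).deriv).trans (by
        simp only [Pi.sub_apply, Pi.mul_apply]; ring)
  have hN' : ∀ z ∈ Metric.ball (0 : ℂ) r, N z = n z := hN
  have hS' : ∀ z ∈ Metric.ball (0 : ℂ) r, S z = s z * n z := hS
  have W : ∀ z ∈ Metric.ball (0 : ℂ) r, wr S N z = s₁ z * n z ^ 2 := fun z hz => by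
    rw [wr, DN z hz, DS z hz, hN' z hz, hS' z hz]; ring
  have DW : ∀ z ∈ Metric.ball (0 : ℂ) r,
      deriv (wr S N) z = (snAccel m (s z) - 2 * s₁ z * l₁ z) * n z ^ 2 := fun z hz =>
    ((((h.hs₁ z hz).mul ((dn z hz).pow 2)).congr_of_eventuallyEq
      (EqOn.eventuallyEq_of_mem W (B z hz))).deriv).trans (by
        simp only [Pi.pow_apply]; push_cast; ring)
  have dW : Differentiable ℂ (wr S N) := (dS.deriv.mul dN).sub (dS.mul dN.deriv)
  -- Every identity of `SnPair` except the absence of common zeros is polynomial in entire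
  -- functions, so it need only be verified near `0`.
  have ext : ∀ {f g : ℂ → ℂ}, Differentiable ℂ f → Differentiable ℂ g →
      (∀ z ∈ Metric.ball (0 : ℂ) r, f z = g z) → ∀ z, f z = g z := fun hf hg hfg =>
    entire_eq_of_eventuallyEq hf hg (EqOn.eventuallyEq_of_mem hfg (B 0 h0))
  have wr_sq : ∀ z, wr S N z ^ 2 = (N z ^ 2 - S z ^ 2) * (N z ^ 2 - m * S z ^ 2) := by
    refine ext (by fun_prop) (by fun_prop) fun z hz => ?_
    rw [W z hz, hN' z hz, hS' z hz]
    linear_combination n z ^ 4 * h.ode z hz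
  have hl0 : n 0 = 1 := by simp [hn, h.l0]
  refine ⟨S, N, dS, dN, by rw [hS' 0 h0, h.s0, zero_mul], by rw [hN' 0 h0, hl0],
    by rw [DS 0 h0, h.s0, h.s₁0, hl0]; ring, wr_sq, ?_, ?_, ?_, ?_⟩
  · have := dW.deriv
    have := dN.deriv
    refine ext (by fun_prop) (by fun_prop) fun z hz => ?_
    rw [DW z hz, W z hz, DN z hz, hN' z hz, hS' z hz, snAccel]; ring
  · have := dN.deriv
    have := dN.deriv.deriv
    refine ext (by fun_prop) (by fun_prop) fun z hz => ?_
    rw [DDN z hz, DN z hz, hN' z hz, hS' z hz]; ring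
  · have := dS.deriv
    have := dS.deriv.deriv
    refine ext (by fun_prop) (by fun_prop) fun z hz => ?_
    rw [DDS z hz, DS z hz, hN' z hz, hS' z hz, snAccel]
    linear_combination n z ^ 2 * h.ode z hz
  · refine no_common_zero_of_double hm0 hm1 dN.continuous (by rw [hN' 0 h0, hl0]) wr_sq ?_ ?_
    · refine ext dS ?_ fun z hz => ?_
      · fun_prop
      · have hz2 := half_mem_ball hz
        have e : n z = n (z / 2) ^ 4 * (1 - m * s (z / 2) ^ 4) := h.exp_double hz
        have hne := h.ne _ hz2
        rw [W _ hz2, hN' _ hz2, hS' _ hz2, hS' _ hz, h.sn_double z hz, e]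
        generalize 1 - m * s (z / 2) ^ 4 = Q at *
        field_simp
    · refine ext dN ?_ fun z hz => ?_
      · fun_prop
      · have hz2 := half_mem_ball hz
        have e : n z = n (z / 2) ^ 4 * (1 - m * s (z / 2) ^ 4) := h.exp_double hz
        rw [hN' _ hz2, hS' _ hz2, hN' _ hz, e]; ring

end SnPair
end JacobiElliptic


namespace JacobiElliptic
open Set Filter Topology MeasureTheory

/-! ### The quotient, its differential equations and its periods up to sign. -/

section Quotient

/-- The quotient `S / N`; division by zero gives it the value `0` at the poles. -/
noncomputable def quo (S N : ℂ → ℂ) (z : ℂ) : ℂ := S z / N z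

/-- The derivative of `quo S N` away from the zeros of `N`. -/
noncomputable def quoD (S N : ℂ → ℂ) (z : ℂ) : ℂ := wr S N z / N z ^ 2

variable {m : ℂ} {S N : ℂ → ℂ}

theorem SnPair.differentiable_wr (h : SnPair m S N) : Differentiable ℂ (wr S N) :=
  (h.diffS.deriv.mul h.diffN).sub (h.diffS.mul h.diffN.deriv)

theorem SnPair.hasDerivAt_quo (h : SnPair m S N) {z : ℂ} (hz : N z ≠ 0) :
    HasDerivAt (quo S N) (quoD S N z) z :=
  (h.diffS z).hasDerivAt.div (h.diffN z).hasDerivAt hz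

theorem SnPair.hasDerivAt_quoD (h : SnPair m S N) {z : ℂ} (hz : N z ≠ 0) :
    HasDerivAt (quoD S N) (snAccel m (quo S N z)) z := by
  have := (h.differentiable_wr z).hasDerivAt.div ((h.diffN z).hasDerivAt.pow 2)
    (pow_ne_zero 2 hz)
  refine this.congr_deriv ?_
  have e := h.deriv_wr z
  simp only [Pi.pow_apply]
  unfold quo snAccel
  push_cast
  field_simp
  linear_combination e

theorem SnPair.quoD_sq (h : SnPair m S N) {z : ℂ} (hz : N z ≠ 0) :
    quoD S N z ^ 2 = (1 - quo S N z ^ 2) * (1 - m * quo S N z ^ 2) := by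
  unfold quo quoD
  rw [div_pow, h.wr_sq]
  field_simp

theorem SnPair.hasDerivAt_logN (h : SnPair m S N) {z : ℂ} (hz : N z ≠ 0) :
    HasDerivAt (fun z => -deriv N z / N z) (m * quo S N z ^ 2) z := by
  have := (h.diffN.deriv z).hasDerivAt.neg.div (h.diffN z).hasDerivAt hz
  refine this.congr_deriv ?_
  unfold quo
  have := h.logN z
  simp only [Pi.neg_apply]
  field_simp
  linear_combination this

theorem SnPair.hasDerivAt_logS (h : SnPair m S N) {z : ℂ} (hz : S z ≠ 0) :
    HasDerivAt (fun z => -deriv S z / S z) ((N z / S z) ^ 2) z := by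
  have := (h.diffS.deriv z).hasDerivAt.neg.div (h.diffS z).hasDerivAt hz
  refine this.congr_deriv ?_
  have := h.logS z
  simp only [Pi.neg_apply]
  field_simp
  linear_combination this

theorem SnPair.quo_zero (h : SnPair m S N) : quo S N 0 = 0 := by simp [quo, h.S_zero]

theorem SnPair.quoD_zero (h : SnPair m S N) : quoD S N 0 = 1 := by
  simp [quoD, wr, h.S_zero, h.N_zero, h.deriv_S_zero]

theorem SnPair.exists_S_ne_zero (h : SnPair m S N) : ∃ z, S z ≠ 0 := by
  by_contra! hS
  have : deriv S 0 = 0 := by rw [show S = fun _ => 0 from funext hS]; simp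
  rw [h.deriv_S_zero] at this
  exact one_ne_zero this

theorem SnPair.exists_N_ne_zero (h : SnPair m S N) : ∃ z, N z ≠ 0 :=
  ⟨0, by rw [h.N_zero]; exact one_ne_zero⟩

theorem SnPair.quo_eq_iff (h : SnPair m S N) {z x : ℂ} (hx : S z = x * N z) :
    N z ≠ 0 ∧ quo S N z = x := by
  have : N z ≠ 0 := fun h0 => h.no_common_zero z h0 (by rw [hx, h0, mul_zero])
  exact ⟨this, by rw [quo, hx, mul_div_cancel_right₀ _ this]⟩

/-- `ω` is a period of `S / N` up to the factor `σ`. -/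
def SignPeriod (S N : ℂ → ℂ) (σ ω : ℂ) : Prop := ∀ z, S (z + ω) * N z = σ * S z * N (z + ω)

theorem snAccel_mul {σ : ℂ} (hσ : σ ^ 2 = 1) (x : ℂ) : snAccel m (σ * x) = σ * snAccel m x := by
  unfold snAccel
  linear_combination (2 * m * x ^ 3 * σ) * hσ

/-- Since `snAccel` commutes with `σ`, both translates of the quotient solve the same equation with
matching data, hence agree locally. Cross-multiplication turns this into an identity of entire
functions, valid also at poles. -/
theorem SnPair.signPeriod_of_eq (h : SnPair m S N) {σ z₀ z₁ : ℂ} (hσ : σ ^ 2 = 1)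
    (h0 : N z₀ ≠ 0) (h1 : N z₁ ≠ 0) (hq : quo S N z₁ = σ * quo S N z₀)
    (hqD : quoD S N z₁ = σ * quoD S N z₀) : SignPeriod S N σ (z₁ - z₀) := by
  have c0 : ∀ᶠ z in 𝓝 (0 : ℂ), N (z + z₀) ≠ 0 ∧ N (z + z₁) ≠ 0 := by
    have a0 : ContinuousAt (fun z => N (z + z₀)) 0 := by
      have := h.diffN.continuous; fun_prop
    have a1 : ContinuousAt (fun z => N (z + z₁)) 0 := by
      have := h.diffN.continuous; fun_prop
    exact (a0.eventually_ne (by simpa using h0)).and (a1.eventually_ne (by simpa using h1))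
  obtain ⟨r, hr, hball⟩ := Metric.nhds_basis_ball.mem_iff.1 c0
  have key := eqOn_ball_of_snAccel (m := m) (z₀ := 0) (r := r)
    (f := fun z => quo S N (z + z₁)) (f₁ := fun z => quoD S N (z + z₁))
    (g := fun z => σ * quo S N (z + z₀)) (g₁ := fun z => σ * quoD S N (z + z₀))
    (fun z hz => (h.hasDerivAt_quo (hball hz).2).comp_add_const z z₁)
    (fun z hz => (h.hasDerivAt_quoD (hball hz).2).comp_add_const z z₁)
    (fun z hz => ((h.hasDerivAt_quo (hball hz).1).comp_add_const z z₀).const_mul σ)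
    (fun z hz => by
      rw [snAccel_mul hσ]
      exact ((h.hasDerivAt_quoD (hball hz).1).comp_add_const z z₀).const_mul σ)
    (by simpa using hq) (by simpa using hqD)
  have dS := h.diffS
  have dN := h.diffN
  have ent := entire_eq_of_eventuallyEq (f := fun z => S (z + z₁) * N (z + z₀))
    (g := fun z => σ * S (z + z₀) * N (z + z₁)) (by fun_prop) (by fun_prop)
    (z₀ := 0) (by
      filter_upwards [Metric.ball_mem_nhds 0 hr] with z hz
      have e := key z hz
      have n0 := (hball hz).1
      have n1 := (hball hz).2
      simp only [quo] at e
      field_simp at e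
      linear_combination e)
  intro z
  have := ent (z - z₀)
  simp only [sub_add_cancel] at this
  rw [show z - z₀ + z₁ = z + (z₁ - z₀) by ring] at this
  exact this

theorem SnPair.N_add_eq_zero_iff (h : SnPair m S N) {σ ω : ℂ} (hσ : σ ≠ 0)
    (hp : SignPeriod S N σ ω) (z : ℂ) : N (z + ω) = 0 ↔ N z = 0 := by
  have e := hp z
  constructor
  · intro h0
    rw [h0, mul_zero] at e
    exact (mul_eq_zero.1 e).resolve_left (h.no_common_zero _ h0)
  · intro h0
    rw [h0, mul_zero] at e
    exact (mul_eq_zero.1 e.symm).resolve_left (mul_ne_zero hσ (h.no_common_zero _ h0))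

theorem SnPair.S_add_eq_zero_iff (h : SnPair m S N) {σ ω : ℂ} (hσ : σ ≠ 0)
    (hp : SignPeriod S N σ ω) (z : ℂ) : S (z + ω) = 0 ↔ S z = 0 := by
  have e := hp z
  constructor
  · intro h0
    have hN : N (z + ω) ≠ 0 := fun h1 => h.no_common_zero _ h1 h0
    rw [h0, zero_mul] at e
    simpa [hσ, hN] using e.symm
  · intro h0
    have hN : N z ≠ 0 := fun h1 => h.no_common_zero _ h1 h0
    rw [h0, mul_zero, zero_mul] at e
    simpa [hN] using e

theorem SnPair.quo_add (h : SnPair m S N) {σ ω : ℂ} (hσ : σ ≠ 0)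
    (hp : SignPeriod S N σ ω) (z : ℂ) : quo S N (z + ω) = σ * quo S N z := by
  by_cases h0 : N z = 0
  · simp [quo, h0, (h.N_add_eq_zero_iff hσ hp z).2 h0]
  · have h1 : N (z + ω) ≠ 0 := fun h1 => h0 ((h.N_add_eq_zero_iff hσ hp z).1 h1)
    have e := hp z
    unfold quo
    field_simp
    linear_combination e

theorem SnPair.quoD_add (h : SnPair m S N) {σ ω : ℂ} (hσ : σ ≠ 0)
    (hp : SignPeriod S N σ ω) {z : ℂ} (h0 : N z ≠ 0) :
    quoD S N (z + ω) = σ * quoD S N z := by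
  have h1 : N (z + ω) ≠ 0 := fun h1 => h0 ((h.N_add_eq_zero_iff hσ hp z).1 h1)
  have d1 := (h.hasDerivAt_quo h1).comp_add_const z ω
  have d2 := (h.hasDerivAt_quo h0).const_mul σ
  have e : (fun z => quo S N (z + ω)) = fun z => σ * quo S N z := funext (h.quo_add hσ hp)
  rw [e] at d1
  exact d1.unique d2

/-- At a zero the differential equation reads `s'² = 1`; the sign of `s'` is `σ`, and the data there
are `σ` times those at `0`. -/
theorem SnPair.exists_signPeriod (h : SnPair m S N) {ω : ℂ} (hω : S ω = 0) :
    ∃ σ : ℂ, (σ = 1 ∨ σ = -1) ∧ quoD S N ω = σ ∧ SignPeriod S N σ ω := by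
  have hN : N ω ≠ 0 := fun h1 => h.no_common_zero _ h1 hω
  have hq : quo S N ω = 0 := by simp [quo, hω]
  have h2 := h.quoD_sq hN
  rw [hq] at h2
  have h2' : quoD S N ω ^ 2 = 1 := by rw [h2]; ring
  refine ⟨quoD S N ω, mul_self_eq_one_iff.1 (by rw [← h2', sq]), rfl, ?_⟩
  have := h.signPeriod_of_eq h2' (z₀ := 0) (by rw [h.N_zero]; exact one_ne_zero) hN
    (by rw [hq, h.quo_zero, mul_zero]) (by rw [h.quoD_zero, mul_one])
  simpa using this

theorem SnPair.S_eq_zero_of_signPeriod (h : SnPair m S N) {σ ω : ℂ}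
    (hp : SignPeriod S N σ ω) : S ω = 0 := by
  have := hp 0
  simpa [h.S_zero, h.N_zero] using this

theorem SnPair.signPeriod_one_iff (h : SnPair m S N) {ω : ℂ} :
    SignPeriod S N 1 ω ↔ S ω = 0 ∧ quoD S N ω = 1 := by
  constructor
  · intro hp
    refine ⟨h.S_eq_zero_of_signPeriod hp, ?_⟩
    have := h.quoD_add one_ne_zero hp (z := 0) (by rw [h.N_zero]; exact one_ne_zero)
    simpa [h.quoD_zero] using this
  · rintro ⟨h0, h1⟩
    obtain ⟨σ, _, h2, h3⟩ := h.exists_signPeriod h0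
    rwa [← h2, h1] at h3

theorem SnPair.period_iff (h : SnPair m S N) {ω : ℂ} :
    (∀ z, quo S N (z + ω) = quo S N z) ↔ SignPeriod S N 1 ω := by
  constructor
  · intro hq
    have h0 : quo S N ω = 0 := by
      have := hq 0
      rwa [zero_add, h.quo_zero] at this
    -- The value `0` of `quo` at `ω` could also come from division by zero at a pole. The
    -- cross-multiplied periodicity, continued to `z = 0` by limits, rules this out.
    have hS : S ω = 0 := by
      by_contra hS
      have hN : N ω = 0 := by simpa [quo, hS] using h0
      have e1 : ∀ᶠ z in 𝓝[≠] (0 : ℂ), N z ≠ 0 :=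
        nhdsWithin_le_nhds ((h.diffN.continuous.continuousAt (x := 0)).eventually_ne
          (by rw [h.N_zero]; exact one_ne_zero))
      have e2 : ∀ᶠ z in 𝓝[≠] (0 : ℂ), N (z + ω) ≠ 0 :=
        entire_eventually_ne_zero (f := fun z => N (z + ω))
          (by have := h.diffN; fun_prop) ⟨-ω, by simp [h.N_zero]⟩ 0
      have e3 : ∀ᶠ z in 𝓝[≠] (0 : ℂ), S (z + ω) * N z = S z * N (z + ω) := by
        filter_upwards [e1, e2] with z n0 n1
        have := hq z
        simp only [quo] at this
        field_simp at this
        linear_combination this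
      have cS := h.diffS.continuous
      have cN := h.diffN.continuous
      have t1 : Tendsto (fun z => S (z + ω) * N z) (𝓝[≠] 0) (𝓝 (S (0 + ω) * N 0)) :=
        (Continuous.tendsto (by fun_prop) 0).mono_left nhdsWithin_le_nhds
      have t2 : Tendsto (fun z => S z * N (z + ω)) (𝓝[≠] 0) (𝓝 (S 0 * N (0 + ω))) :=
        (Continuous.tendsto (by fun_prop) 0).mono_left nhdsWithin_le_nhds
      have := tendsto_nhds_unique (t1.congr' e3) t2
      simp [h.S_zero, h.N_zero] at this
      exact hS this
    refine h.signPeriod_one_iff.2 ⟨hS, ?_⟩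
    have hN : N ω ≠ 0 := fun h1 => h.no_common_zero _ h1 hS
    have d1 := (h.hasDerivAt_quo (z := 0 + ω) (by simpa using hN)).comp_add_const 0 ω
    rw [show (fun z => quo S N (z + ω)) = quo S N from funext hq] at d1
    have := d1.unique (h.hasDerivAt_quo (z := 0) (by rw [h.N_zero]; exact one_ne_zero))
    rwa [zero_add, h.quoD_zero] at this
  · intro hp z
    simpa using h.quo_add one_ne_zero hp z

theorem SnPair.quo_neg (h : SnPair m S N) (z : ℂ) : S (-z) * N z = -(S z * N (-z)) := by
  have c0 : ∀ᶠ z in 𝓝 (0 : ℂ), N z ≠ 0 ∧ N (-z) ≠ 0 := by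
    have a0 : ContinuousAt (fun z => N z) 0 := h.diffN.continuous.continuousAt
    have a1 : ContinuousAt (fun z => N (-z)) 0 := by
      have := h.diffN.continuous; fun_prop
    exact (a0.eventually_ne (by simp [h.N_zero])).and (a1.eventually_ne (by simp [h.N_zero]))
  obtain ⟨r, hr, hball⟩ := Metric.nhds_basis_ball.mem_iff.1 c0
  have key := eqOn_ball_of_snAccel (m := m) (z₀ := 0) (r := r)
    (f := fun z => quo S N (-z)) (f₁ := fun z => -quoD S N (-z))
    (g := fun z => -quo S N z) (g₁ := fun z => -quoD S N z)
    (fun z hz => by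
      exact ((h.hasDerivAt_quo (hball hz).2).comp z (hasDerivAt_neg z)).congr_deriv (by ring))
    (fun z hz => by
      exact ((h.hasDerivAt_quoD (hball hz).2).comp z (hasDerivAt_neg z)).neg.congr_deriv
        (by ring))
    (fun z hz => (h.hasDerivAt_quo (hball hz).1).neg)
    (fun z hz => by
      have := snAccel_mul (m := m) (σ := -1) (by norm_num) (quo S N z)
      rw [neg_one_mul, neg_one_mul] at this
      rw [this]
      exact (h.hasDerivAt_quoD (hball hz).1).neg)
    (by simp [h.quo_zero]) (by simp)
  have dS := h.diffS
  have dN := h.diffN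
  refine entire_eq_of_eventuallyEq (f := fun z => S (-z) * N z)
    (g := fun z => -(S z * N (-z))) (by fun_prop) (by fun_prop)
    (z₀ := 0) (by
      filter_upwards [Metric.ball_mem_nhds 0 hr] with z hz
      have e := key z hz
      have n0 := (hball hz).1
      have n1 := (hball hz).2
      simp only [quo] at e
      field_simp at e
      linear_combination e) z

end Quotient

/-! ### Existence and uniqueness of the elliptic sine. -/

section JacobiSn

variable {k : ℂ} {S N : ℂ → ℂ}

theorem SnPair.isJacobiSn (h : SnPair (k ^ 2) S N) : IsJacobiSn k (quo S N) where
  meromorphic z _ := by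
    have e : quo S N = S / N := rfl
    rw [e]
    refine MeromorphicNFOn.div (h.diffS.analyticAt z) (h.diffN.analyticAt z).meromorphicNFAt ?_
    by_cases hz : N z = 0
    · exact Or.inr (h.no_common_zero z hz)
    · exact Or.inl hz
  map_zero := h.quo_zero
  deriv_zero := by
    rw [(h.hasDerivAt_quo (by rw [h.N_zero]; exact one_ne_zero)).deriv, h.quoD_zero]
  ode z hz := by
    -- Analyticity excludes poles: if `N z = 0`, then continuity of `quo` would make `quo * N = S`
    -- tend to `0`, against the absence of common zeros.
    have hN : N z ≠ 0 := by
      intro hN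
      have e1 : ∀ᶠ w in 𝓝[≠] z, quo S N w * N w = S w := by
        filter_upwards [entire_eventually_ne_zero h.diffN h.exists_N_ne_zero z] with w hw
        exact div_mul_cancel₀ _ hw
      have t1 : Tendsto (fun w => quo S N w * N w) (𝓝[≠] z) (𝓝 (quo S N z * N z)) :=
        (hz.continuousAt.mul h.diffN.continuous.continuousAt).tendsto.mono_left
          nhdsWithin_le_nhds
      have t2 : Tendsto S (𝓝[≠] z) (𝓝 (S z)) :=
        (h.diffS.continuous.tendsto z).mono_left nhdsWithin_le_nhds
      have := tendsto_nhds_unique (t1.congr' e1) t2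
      rw [hN, mul_zero] at this
      exact h.no_common_zero z hN this.symm
    rw [(h.hasDerivAt_quo hN).deriv, h.quoD_sq hN]

/-- Differentiating the first order equation and dividing by `2 t'`, which is nonzero near `0`,
gives the second order one, hence local equality. The meromorphic identity theorem spreads it, and
the normal form fixes the values at poles. -/
theorem SnPair.eq_of_isJacobiSn (h : SnPair (k ^ 2) S N) {t : ℂ → ℂ} (ht : IsJacobiSn k t) :
    t = quo S N := by
  -- `deriv` defaults to `0`, so the condition `deriv t 0 = 1` already contains differentiability.
  have hd : DifferentiableAt ℂ t 0 := by
    by_contra hd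
    have := ht.deriv_zero
    rw [deriv_zero_of_not_differentiableAt hd] at this
    exact zero_ne_one this
  have han : AnalyticAt ℂ t 0 :=
    (ht.meromorphic (mem_univ 0)).meromorphicAt.analyticAt hd.continuousAt
  have hne : ∀ᶠ z in 𝓝 (0 : ℂ), deriv t z ≠ 0 :=
    han.deriv.continuousAt.eventually_ne (by rw [ht.deriv_zero]; exact one_ne_zero)
  have hN : ∀ᶠ z in 𝓝 (0 : ℂ), N z ≠ 0 :=
    h.diffN.continuous.continuousAt.eventually_ne (by rw [h.N_zero]; exact one_ne_zero)
  obtain ⟨r, hr, hball⟩ := Metric.nhds_basis_ball.mem_iff.1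
    ((han.eventually_analyticAt.and hne).and hN)
  have key := eqOn_ball_of_snAccel (m := k ^ 2) (z₀ := 0) (r := r)
    (f := t) (f₁ := deriv t) (g := quo S N) (g₁ := quoD S N)
    (fun z hz => (hball hz).1.1.differentiableAt.hasDerivAt)
    (fun z hz => by
      have a := (hball hz).1.1
      have d1 := a.differentiableAt.hasDerivAt
      have d2 := a.deriv.differentiableAt.hasDerivAt
      have e : (fun w => deriv t w ^ 2) =ᶠ[𝓝 z]
          fun w => (1 - t w ^ 2) * (1 - k ^ 2 * t w ^ 2) := by
        filter_upwards [a.eventually_analyticAt] with w hw using ht.ode w hw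
      have d3 := (d2.pow 2).unique ((((d1.pow 2).const_sub 1).mul
        (((d1.pow 2).const_mul (k ^ 2)).const_sub 1)).congr_of_eventuallyEq e)
      have hz' := (hball hz).1.2
      have : deriv (deriv t) z = snAccel (k ^ 2) (t z) := by
        simp only [Pi.pow_apply] at d3
        push_cast at d3
        apply mul_left_cancel₀ (mul_ne_zero two_ne_zero hz')
        unfold snAccel
        linear_combination d3
      rw [← this]; exact d2)
    (fun z hz => h.hasDerivAt_quo (hball hz).2)
    (fun z hz => h.hasDerivAt_quoD (hball hz).2)
    (by rw [ht.map_zero, h.quo_zero]) (by rw [ht.deriv_zero, h.quoD_zero])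
  have hq := h.isJacobiSn
  have hmer : MeromorphicOn (t - quo S N) univ :=
    ht.meromorphic.meromorphicOn.sub hq.meromorphic.meromorphicOn
  have h0 : meromorphicOrderAt (t - quo S N) 0 = ⊤ := by
    rw [meromorphicOrderAt_eq_top_iff]
    apply nhdsWithin_le_nhds
    filter_upwards [Metric.ball_mem_nhds 0 hr] with z hz
    simp [key z hz]
  funext z
  have hz : meromorphicOrderAt (t - quo S N) z = ⊤ := by
    by_contra hz
    have := (hmer.exists_meromorphicOrderAt_ne_top_iff_forall isConnected_univ).1
      ⟨⟨z, mem_univ z⟩, hz⟩ ⟨0, mem_univ 0⟩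
    exact this h0
  rw [meromorphicOrderAt_eq_top_iff] at hz
  have e : t =ᶠ[𝓝[≠] z] quo S N := by
    filter_upwards [hz] with w hw
    simpa [sub_eq_zero] using hw
  exact ((MeromorphicNFAt.eventuallyEq_nhdsNE_iff_eventuallyEq_nhds
    (ht.meromorphic (mem_univ z)) (hq.meromorphic (mem_univ z))).1 e).self_of_nhds

theorem sq_ne_zero_and_ne_one (h0 : 0 < ‖k‖) (h1 : ‖k‖ < 1) : k ^ 2 ≠ 0 ∧ k ^ 2 ≠ 1 := by
  refine ⟨pow_ne_zero 2 (norm_pos_iff.1 h0), fun h => ?_⟩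
  have := congrArg norm h
  rw [norm_pow, norm_one] at this
  nlinarith

theorem existsUnique_isJacobiSn (h0 : 0 < ‖k‖) (h1 : ‖k‖ < 1) :
    ∃! s : ℂ → ℂ, IsJacobiSn k s := by
  obtain ⟨S, N, h⟩ := exists_snPair (sq_ne_zero_and_ne_one h0 h1).1 (sq_ne_zero_and_ne_one h0 h1).2
  exact ⟨quo S N, h.isJacobiSn, fun t ht => h.eq_of_isJacobiSn ht⟩

theorem SnPair.jacobiSn_eq (h : SnPair (k ^ 2) S N) : jacobiSn k = quo S N :=
  h.eq_of_isJacobiSn (Classical.epsilon_spec ⟨_, h.isJacobiSn⟩)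

end JacobiSn
end JacobiElliptic


namespace JacobiElliptic
open Set Filter Topology MeasureTheory

/-! ### Lifting paths from the elliptic curve to the plane. -/

section Lift

variable {m : ℂ} {S N : ℂ → ℂ}

/-- The path in the `z`-plane with velocity `c`. -/
noncomputable def liftPath (z₀ : ℂ) (c : ℝ → ℂ) (t : ℝ) : ℂ := z₀ + ∫ x in (0 : ℝ)..t, c x

theorem hasDerivAt_liftPath {z₀ : ℂ} {c : ℝ → ℂ} (hc : Continuous c) (t : ℝ) :
    HasDerivAt (liftPath z₀ c) (c t) t :=
  (hc.integral_hasStrictDerivAt 0 t).hasDerivAt.const_add z₀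

theorem continuous_liftPath {z₀ : ℂ} {c : ℝ → ℂ} (hc : Continuous c) :
    Continuous (liftPath z₀ c) :=
  continuous_iff_continuousAt.2 fun t => (hasDerivAt_liftPath hc t).continuousAt

theorem liftPath_zero (z₀ : ℂ) (c : ℝ → ℂ) : liftPath z₀ c 0 = z₀ := by simp [liftPath]

/-- A solution `(u, v)` of the time-changed equation lifts to the `z`-plane. -/
theorem SnPair.lift (h : SnPair m S N) {b : ℝ} {c u v : ℝ → ℂ} {z₀ : ℂ}
    (hc : Continuous c) (hu : ContinuousOn u (Icc 0 b)) (hv : ContinuousOn v (Icc 0 b))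
    (du : ∀ t ∈ Ico 0 b, HasDerivWithinAt u (c t * v t) (Ici t) t)
    (dv : ∀ t ∈ Ico 0 b, HasDerivWithinAt v (c t * snAccel m (u t)) (Ici t) t)
    (h0 : N z₀ ≠ 0) (h1 : quo S N z₀ = u 0) (h2 : quoD S N z₀ = v 0) :
    ∀ t ∈ Icc 0 b, N (liftPath z₀ c t) ≠ 0 ∧ quo S N (liftPath z₀ c t) = u t ∧
      quoD S N (liftPath z₀ c t) = v t := by
  set Z := liftPath z₀ c with hZ
  have cZ : Continuous Z := continuous_liftPath hc
  have cN := h.diffN.continuous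
  have cS := h.diffS.continuous
  have cW := h.differentiable_wr.continuous
  set s : Set ℝ := {t | N (Z t) ≠ 0 ∧ quo S N (Z t) = u t ∧ quoD S N (Z t) = v t} with hs
  have hclosed : IsClosed (s ∩ Icc 0 b) := by
    -- Written as `S = u N` and `W = v N²`, the conditions are closed. They also force `N ≠ 0`, for
    -- `S` and `N` have no common zero; so the lift cannot run into a pole.
    have e : s ∩ Icc 0 b = Icc 0 b ∩ (fun t => (S (Z t) - u t * N (Z t),
        wr S N (Z t) - v t * N (Z t) ^ 2)) ⁻¹' {0} := by
      ext t
      simp only [mem_inter_iff, mem_preimage, mem_singleton_iff, Prod.mk_eq_zero, sub_eq_zero]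
      rw [and_comm]
      refine and_congr_right fun ht => ⟨?_, ?_⟩
      · rintro ⟨a0, a1, a2⟩
        rw [← a1, ← a2, quo, quoD]
        constructor <;> field_simp
      · rintro ⟨a1, a2⟩
        obtain ⟨b1, b2⟩ := h.quo_eq_iff a1
        exact ⟨b1, b2, by rw [quoD, a2]; field_simp⟩
    rw [e]
    refine ContinuousOn.preimage_isClosed_of_isClosed ?_ isClosed_Icc isClosed_singleton
    exact ((cS.comp cZ).continuousOn.sub (hu.mul (cN.comp cZ).continuousOn)).prodMk
      ((cW.comp cZ).continuousOn.sub (hv.mul ((cN.comp cZ).pow 2).continuousOn))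
  have hZ0 : Z 0 = z₀ := liftPath_zero z₀ c
  have key : Icc 0 b ⊆ s := by
    -- Continuous induction: uniqueness of solutions extends the agreement a little to the right.
    refine hclosed.Icc_subset_of_forall_mem_nhdsWithin ⟨by rwa [hZ0], by rwa [hZ0], by rwa [hZ0]⟩ ?_
    rintro t ⟨⟨a0, a1, a2⟩, ht⟩
    have hev : ∀ᶠ x in 𝓝 t, N (Z x) ≠ 0 := (cN.comp cZ).continuousAt.eventually_ne a0
    obtain ⟨ε, hε, hball⟩ := Metric.nhds_basis_ball.mem_iff.1 hev
    set t' := min b (t + ε / 2) with ht'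
    have htt' : t < t' := lt_min ht.2 (by linarith)
    have hsub : Icc t t' ⊆ Icc 0 b := Icc_subset_Icc ht.1 (min_le_left _ _)
    have hsub' : Ico t t' ⊆ Ico 0 b := Ico_subset_Ico ht.1 (min_le_left _ _)
    have hne : ∀ x ∈ Icc t t', N (Z x) ≠ 0 := by
      intro x hx
      apply hball
      rw [Metric.mem_ball, Real.dist_eq, abs_of_nonneg (by linarith [hx.1])]
      linarith [hx.2, min_le_right b (t + ε / 2)]
    have d1 : ∀ x ∈ Icc t t', HasDerivAt (fun x => quo S N (Z x)) (c x * quoD S N (Z x)) x :=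
      fun x hx => (h.hasDerivAt_quo (hne x hx)).scomp x (hasDerivAt_liftPath hc x)
    have d2 : ∀ x ∈ Icc t t',
        HasDerivAt (fun x => quoD S N (Z x)) (c x * snAccel m (quo S N (Z x))) x :=
      fun x hx => (h.hasDerivAt_quoD (hne x hx)).scomp x (hasDerivAt_liftPath hc x)
    have := system_unique (m := m) (a := t) (b := t') hc.continuousOn
      (fun x hx => (d1 x hx).continuousAt.continuousWithinAt)
      (fun x hx => (d2 x hx).continuousAt.continuousWithinAt)
      (hu.mono hsub) (hv.mono hsub)
      (fun x hx => (d1 x (Ico_subset_Icc_self hx)).hasDerivWithinAt)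
      (fun x hx => (d2 x (Ico_subset_Icc_self hx)).hasDerivWithinAt)
      (fun x hx => du x (hsub' hx)) (fun x hx => dv x (hsub' hx)) a1 a2
    refine mem_of_superset (Ioc_mem_nhdsGT htt') fun x hx => ?_
    have hx' : x ∈ Icc t t' := Ioc_subset_Icc_self hx
    exact ⟨hne x hx', this x hx'⟩
  exact key

end Lift

/-! ### Quasi-periods of the logarithmic derivatives. -/

section QuasiPeriod

variable {m : ℂ} {S N : ℂ → ℂ}

/-- `ω` is a quasi-period of the logarithmic derivatives of `S` and `N`, with increment `-η`. -/
def HasQuasiPeriod (S N : ℂ → ℂ) (ω η : ℂ) : Prop :=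
  (∀ z, S z ≠ 0 → S (z + ω) ≠ 0 ∧ -deriv S (z + ω) / S (z + ω) = -deriv S z / S z + η) ∧
    ∀ z, N z ≠ 0 → N (z + ω) ≠ 0 ∧ -deriv N (z + ω) / N (z + ω) = -deriv N z / N z + η

theorem exists_increment {F κ : ℂ → ℂ} (hF : Differentiable ℂ F) (hne : ∃ z, F z ≠ 0) {ω : ℂ}
    (hd : ∀ z, F z ≠ 0 → HasDerivAt (fun z => -deriv F z / F z) (κ z) z)
    (hω : ∀ z, F z ≠ 0 → F (z + ω) ≠ 0) (hκ : ∀ z, F z ≠ 0 → κ (z + ω) = κ z) :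
    ∃ η, ∀ z, F z ≠ 0 →
      F (z + ω) ≠ 0 ∧ -deriv F (z + ω) / F (z + ω) = -deriv F z / F z + η := by
  have hopen : IsOpen {z | F z ≠ 0} := isOpen_ne_fun hF.continuous continuous_const
  have hdd : ∀ z, F z ≠ 0 → HasDerivAt
      (fun z => -deriv F (z + ω) / F (z + ω) - -deriv F z / F z) 0 z := by
    intro z hz
    have := ((hd _ (hω z hz)).comp_add_const z ω).sub (hd z hz)
    exact this.congr_deriv (by rw [hκ z hz, sub_self])
  obtain ⟨η, hη⟩ := hopen.exists_is_const_of_deriv_eq_zero (isPreconnected_ne_zero hF hne)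
    (fun z hz => (hdd z hz).differentiableAt.differentiableWithinAt)
    (fun z hz => (hdd z hz).deriv)
  exact ⟨η, fun z hz => ⟨hω z hz, by linear_combination hη z hz⟩⟩

theorem SnPair.exists_S_N_ne_zero (h : SnPair m S N) : ∃ z, S z ≠ 0 ∧ N z ≠ 0 :=
  ((entire_eventually_ne_zero h.diffS h.exists_S_ne_zero 0).and
    (entire_eventually_ne_zero h.diffN h.exists_N_ne_zero 0)).exists

/-- The derivatives `(N/S)²` and `m (S/N)²` of `-S'/S` and `-N'/N` do not see the sign `σ`, so both
increments are constant. They coincide because `S'/S - N'/N = s'/s` is invariant under `ω`. -/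
theorem SnPair.exists_quasiPeriod (h : SnPair m S N) {ω : ℂ} (hω : S ω = 0) :
    ∃ η, HasQuasiPeriod S N ω η := by
  obtain ⟨σ, hσ, -, hp⟩ := h.exists_signPeriod hω
  have hσ0 : σ ≠ 0 := by rcases hσ with rfl | rfl <;> norm_num
  have hσ2 : σ ^ 2 = 1 := by rcases hσ with rfl | rfl <;> norm_num
  have hq := h.quo_add hσ0 hp
  obtain ⟨η, hη⟩ := exists_increment h.diffS h.exists_S_ne_zero (ω := ω)
    (κ := fun z => (N z / S z) ^ 2) (fun z hz => h.hasDerivAt_logS hz)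
    (fun z hz h0 => hz ((h.S_add_eq_zero_iff hσ0 hp z).1 h0)) (fun z _ => by
      have e : ∀ z, N z / S z = (quo S N z)⁻¹ := fun z => by rw [quo, inv_div]
      simp only [e, hq, mul_inv, mul_pow]
      rw [inv_pow, hσ2]; simp)
  obtain ⟨η', hη'⟩ := exists_increment h.diffN h.exists_N_ne_zero (ω := ω)
    (κ := fun z => m * quo S N z ^ 2) (fun z hz => h.hasDerivAt_logN hz)
    (fun z hz h0 => hz ((h.N_add_eq_zero_iff hσ0 hp z).1 h0)) (fun z _ => by
      simp only [hq, mul_pow, hσ2, one_mul])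
  have : η' = η := by
    obtain ⟨z, hS, hN⟩ := h.exists_S_N_ne_zero
    have e1 := hη z hS
    have e2 := hη' z hN
    have e3 : quoD S N (z + ω) / quo S N (z + ω) = quoD S N z / quo S N z := by
      rw [hq, h.quoD_add hσ0 hp hN, mul_div_mul_left _ _ hσ0]
    have e4 : ∀ w, S w ≠ 0 → N w ≠ 0 →
        quoD S N w / quo S N w = deriv S w / S w - deriv N w / N w := by
      intro w h1 h2
      unfold quo quoD wr
      field_simp
    rw [e4 _ e1.1 e2.1, e4 _ hS hN] at e3
    have e5 := e1.2
    have e6 := e2.2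
    simp only [neg_div] at e5 e6
    linear_combination e3 + e5 - e6
  rw [this] at hη'
  exact ⟨η, hη, hη'⟩

theorem SnPair.quasiPeriod_unique (h : SnPair m S N) {ω η η' : ℂ}
    (h1 : HasQuasiPeriod S N ω η) (h2 : HasQuasiPeriod S N ω η') : η = η' := by
  have hN : N 0 ≠ 0 := by rw [h.N_zero]; exact one_ne_zero
  have := (h1.2 0 hN).2.symm.trans (h2.2 0 hN).2
  exact add_left_cancel this

theorem HasQuasiPeriod.add {ω η ω' η' : ℂ} (h1 : HasQuasiPeriod S N ω η)
    (h2 : HasQuasiPeriod S N ω' η') : HasQuasiPeriod S N (ω + ω') (η + η') := by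
  constructor
  · intro z hz
    obtain ⟨a, b⟩ := h1.1 z hz
    obtain ⟨c, d⟩ := h2.1 _ a
    rw [add_assoc] at c d
    exact ⟨c, by rw [d, b]; ring⟩
  · intro z hz
    obtain ⟨a, b⟩ := h1.2 z hz
    obtain ⟨c, d⟩ := h2.2 _ a
    rw [add_assoc] at c d
    exact ⟨c, by rw [d, b]; ring⟩

/-- The zeros of `S`, i.e. the periods of `S / N` up to sign. -/
def SnPair.zeros (h : SnPair m S N) : AddSubgroup ℂ where
  carrier := {ω | S ω = 0}
  zero_mem' := h.S_zero
  add_mem' {a b} ha hb := by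
    obtain ⟨σ, hσ, -, hp⟩ := h.exists_signPeriod (ω := b) hb
    exact (h.S_add_eq_zero_iff (by rcases hσ with rfl | rfl <;> norm_num) hp a).2 ha
  neg_mem' {a} ha := by
    have := h.quo_neg a
    change S a = 0 at ha
    change S (-a) = 0
    have hN : N a ≠ 0 := fun h1 => h.no_common_zero _ h1 ha
    simpa [ha, hN] using this

/-- The increment of a logarithmic derivative, as a homomorphism on the zeros of `S`. -/
noncomputable def SnPair.eta (h : SnPair m S N) : h.zeros →+ ℂ where
  toFun ω := (h.exists_quasiPeriod ω.2).choose
  map_zero' := h.quasiPeriod_unique (h.exists_quasiPeriod (0 : h.zeros).2).choose_spec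
    ⟨fun z hz => by simpa using hz, fun z hz => by simpa using hz⟩
  map_add' a b := h.quasiPeriod_unique (h.exists_quasiPeriod (a + b).2).choose_spec
    ((h.exists_quasiPeriod a.2).choose_spec.add (h.exists_quasiPeriod b.2).choose_spec)

theorem SnPair.eta_spec (h : SnPair m S N) (ω : h.zeros) : HasQuasiPeriod S N ω (h.eta ω) :=
  (h.exists_quasiPeriod ω.2).choose_spec

/-- The increment along a lifted path. -/
theorem SnPair.eta_eq_integral (h : SnPair m S N) {b : ℝ} {c u : ℝ → ℂ} {z₀ : ℂ} (hb : 0 ≤ b)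
    (hc : Continuous c) (hu : ContinuousOn u (Icc 0 b))
    (hl : ∀ t ∈ Icc 0 b, N (liftPath z₀ c t) ≠ 0 ∧ quo S N (liftPath z₀ c t) = u t)
    (ω : h.zeros) (hω : (ω : ℂ) = ∫ t in (0 : ℝ)..b, c t) :
    h.eta ω = ∫ t in (0 : ℝ)..b, c t * (m * u t ^ 2) := by
  have d : ∀ t ∈ uIcc 0 b, HasDerivAt
      (fun t => -deriv N (liftPath z₀ c t) / N (liftPath z₀ c t)) (c t * (m * u t ^ 2)) t := by
    intro t ht
    rw [uIcc_of_le hb] at ht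
    obtain ⟨h1, h2⟩ := hl t ht
    rw [← h2]
    exact (h.hasDerivAt_logN h1).scomp t (hasDerivAt_liftPath hc t)
  have hint : IntervalIntegrable (fun t => c t * (m * u t ^ 2)) volume 0 b := by
    apply ContinuousOn.intervalIntegrable
    rw [uIcc_of_le hb]
    fun_prop
  rw [intervalIntegral.integral_eq_sub_of_hasDerivAt d hint]
  have h0 := (hl 0 ⟨le_rfl, hb⟩).1
  rw [liftPath_zero] at h0
  have := ((h.eta_spec ω).2 z₀ h0).2
  have e : liftPath z₀ c b = z₀ + ω := by rw [liftPath, hω]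
  simp only [e, liftPath_zero, this]
  ring

end QuasiPeriod
end JacobiElliptic


namespace JacobiElliptic
open Set Filter Topology MeasureTheory ComplexConjugate

/-! ### Integration around a parallelogram. -/

section Parallelogram

/-- The integral of `f` along the boundary of the parallelogram with centre `0` and sides
`ω₁`, `ω₂`. -/
noncomputable def paraIntegral (ω₁ ω₂ : ℂ) (f : ℂ → ℂ) : ℂ :=
  ω₁ * ((∫ t in (-1 / 2 : ℝ)..(1 / 2), f (t * ω₁ - ω₂ / 2)) -
      ∫ t in (-1 / 2 : ℝ)..(1 / 2), f (t * ω₁ + ω₂ / 2)) +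
    ω₂ * ((∫ t in (-1 / 2 : ℝ)..(1 / 2), f (t * ω₂ + ω₁ / 2)) -
      ∫ t in (-1 / 2 : ℝ)..(1 / 2), f (t * ω₂ - ω₁ / 2))

/-- Cauchy's theorem, pulled back to a square by `L`: the field `(ω₂ f, -ω₁ f)` has divergence `ω₂
f' ω₁ - ω₁ f' ω₂ = 0`. -/
theorem paraIntegral_eq_zero {ω₁ ω₂ : ℂ} {f : ℂ → ℂ}
    (hf : ∀ x ∈ Icc (-1 / 2 : ℝ) (1 / 2), ∀ y ∈ Icc (-1 / 2 : ℝ) (1 / 2),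
      DifferentiableAt ℂ f (x * ω₁ + y * ω₂)) : paraIntegral ω₁ ω₂ f = 0 := by
  let L : ℝ × ℝ →L[ℝ] ℂ := (ContinuousLinearMap.fst ℝ ℝ ℝ).smulRight ω₁ +
    (ContinuousLinearMap.snd ℝ ℝ ℝ).smulRight ω₂
  have hL : ∀ p : ℝ × ℝ, L p = p.1 * ω₁ + p.2 * ω₂ := fun p => by simp [L]
  have le : (-1 / 2 : ℝ) ≤ 1 / 2 := by norm_num
  have hd : ∀ p ∈ Icc (-1 / 2 : ℝ) (1 / 2) ×ˢ Icc (-1 / 2 : ℝ) (1 / 2),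
      HasFDerivAt (fun p => f (L p)) (((deriv f (L p)) • (1 : ℂ →L[ℝ] ℂ)).comp L) p := by
    intro p hp
    have h1 := hf p.1 hp.1 p.2 hp.2
    rw [← hL] at h1
    exact (h1.hasDerivAt.complexToReal_fderiv).comp p L.hasFDerivAt
  have hcont : ContinuousOn (fun p => f (L p))
      (uIcc (-1 / 2 : ℝ) (1 / 2) ×ˢ uIcc (-1 / 2 : ℝ) (1 / 2)) := by
    rw [uIcc_of_le le]
    exact fun p hp => (hd p hp).continuousAt.continuousWithinAt
  have key := integral2_divergence_prod_of_hasFDerivAt_off_countable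
    (fun p => ω₂ * f (L p)) (fun p => -ω₁ * f (L p))
    (fun p => ω₂ • (((deriv f (L p)) • (1 : ℂ →L[ℝ] ℂ)).comp L))
    (fun p => -ω₁ • (((deriv f (L p)) • (1 : ℂ →L[ℝ] ℂ)).comp L))
    (-1 / 2) (-1 / 2) (1 / 2) (1 / 2) ∅ countable_empty
    (continuousOn_const.mul hcont) (continuousOn_const.mul hcont)
    (fun p hp => by
      rw [min_eq_left le, max_eq_right le] at hp
      exact (hd p ⟨Ioo_subset_Icc_self hp.1.1, Ioo_subset_Icc_self hp.1.2⟩).const_smul ω₂)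
    (fun p hp => by
      rw [min_eq_left le, max_eq_right le] at hp
      exact (hd p ⟨Ioo_subset_Icc_self hp.1.1, Ioo_subset_Icc_self hp.1.2⟩).const_smul (-ω₁))
    (by
      have : (fun p : ℝ × ℝ => (ω₂ • (((deriv f (L p)) • (1 : ℂ →L[ℝ] ℂ)).comp L)) (1, 0)
          + (-ω₁ • (((deriv f (L p)) • (1 : ℂ →L[ℝ] ℂ)).comp L)) (0, 1)) = fun _ => 0 := by
        funext p
        simp [hL]; ring
      rw [this]
      exact integrableOn_zero)
  have e : ∀ p : ℝ × ℝ, (ω₂ • (((deriv f (L p)) • (1 : ℂ →L[ℝ] ℂ)).comp L)) (1, 0)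
          + (-ω₁ • (((deriv f (L p)) • (1 : ℂ →L[ℝ] ℂ)).comp L)) (0, 1) = 0 := by
    intro p
    simp [hL]; ring
  simp only [e, intervalIntegral.integral_zero] at key
  simp only [hL, intervalIntegral.integral_const_mul] at key
  rw [paraIntegral]
  have e1 : ∀ t : ℝ, (t : ℂ) * ω₁ - ω₂ / 2 = t * ω₁ + ((-1 / 2 : ℝ) : ℂ) * ω₂ := fun t => by
    push_cast; ring
  have e2 : ∀ t : ℝ, (t : ℂ) * ω₁ + ω₂ / 2 = t * ω₁ + ((1 / 2 : ℝ) : ℂ) * ω₂ := fun t => by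
    push_cast; ring
  have e3 : ∀ t : ℝ, (t : ℂ) * ω₂ + ω₁ / 2 = ((1 / 2 : ℝ) : ℂ) * ω₁ + t * ω₂ := fun t => by
    push_cast; ring
  have e4 : ∀ t : ℝ, (t : ℂ) * ω₂ - ω₁ / 2 = ((-1 / 2 : ℝ) : ℂ) * ω₁ + t * ω₂ := fun t => by
    push_cast; ring
  simp only [e1, e2, e3, e4]
  linear_combination -key

theorem integral_inv_segment {ρ α β : ℂ} (hρ : ρ ≠ 0)
    (h : ∀ t ∈ Icc (-1 / 2 : ℝ) (1 / 2), ρ * (t * α + β) ∈ Complex.slitPlane) :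
    α * ∫ t in (-1 / 2 : ℝ)..(1 / 2), (t * α + β)⁻¹ =
      Complex.log (ρ * (α / 2 + β)) - Complex.log (ρ * (-α / 2 + β)) := by
  have le : (-1 / 2 : ℝ) ≤ 1 / 2 := by norm_num
  have hd : ∀ t ∈ uIcc (-1 / 2 : ℝ) (1 / 2),
      HasDerivAt (fun t : ℝ => Complex.log (ρ * (t * α + β))) (α * (t * α + β)⁻¹) t := by
    intro t ht
    rw [uIcc_of_le le] at ht
    have h1 : HasDerivAt (fun t : ℝ => ρ * ((t : ℂ) * α + β)) (ρ * α) t := by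
      simpa using (((Complex.ofRealCLM.hasDerivAt (x := t)).mul_const α).add_const β).const_mul ρ
    have := h1.clog_real (h t ht)
    refine this.congr_deriv ?_
    rw [mul_div_mul_left _ _ hρ, div_eq_mul_inv]
  have hne : ∀ t ∈ uIcc (-1 / 2 : ℝ) (1 / 2), (t : ℂ) * α + β ≠ 0 := by
    intro t ht h0
    rw [uIcc_of_le le] at ht
    have := h t ht
    rw [h0, mul_zero] at this
    exact Complex.slitPlane_ne_zero this rfl
  have hi : IntervalIntegrable (fun t : ℝ => α * ((t : ℂ) * α + β)⁻¹) volume (-1 / 2) (1 / 2) :=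
    (continuousOn_const.mul ((by fun_prop : Continuous fun t : ℝ => (t : ℂ) * α + β).continuousOn.inv₀
      hne)).intervalIntegrable
  rw [← intervalIntegral.integral_const_mul, intervalIntegral.integral_eq_sub_of_hasDerivAt hd hi]
  push_cast
  congr 2 <;> ring_nf

theorem ne_zero_of_im_mul_conj {ω₁ ω₂ : ℂ} (h : (ω₁ * conj ω₂).im ≠ 0) {x y : ℝ}
    (hxy : x ≠ 0 ∨ y ≠ 0) : (x : ℂ) * ω₁ + y * ω₂ ≠ 0 := by
  intro h0
  have a : ((x * ω₁ + y * ω₂) * conj ω₂).im = 0 := by rw [h0]; simp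
  have b : ((x * ω₁ + y * ω₂) * conj ω₁).im = 0 := by rw [h0]; simp
  simp at a b h
  rcases hxy with hx | hy
  · apply hx
    have : x * (-(ω₁.re * ω₂.im) + ω₁.im * ω₂.re) = 0 := by linarith
    rcases mul_eq_zero.1 this with h1 | h1
    · exact h1
    · exact absurd h1 h
  · apply hy
    have : y * (-(ω₁.re * ω₂.im) + ω₁.im * ω₂.re) = 0 := by linarith
    rcases mul_eq_zero.1 this with h1 | h1
    · exact h1
    · exact absurd h1 h

theorem paraIntegral_inv {ω₁ ω₂ : ℂ} (h : 0 < (ω₁ * conj ω₂).im) :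
    paraIntegral ω₁ ω₂ (fun z => z⁻¹) = -(2 * Real.pi * Complex.I) := by
  set a := (ω₁ + ω₂) / 2 with ha
  have hne := @ne_zero_of_im_mul_conj ω₁ ω₂ h.ne'
  have ha0 : a ≠ 0 := by
    have := hne (x := 1 / 2) (y := 1 / 2) (Or.inl (by norm_num))
    rw [ha]
    convert this using 1
    push_cast; ring
  have hare : a.re = (ω₁.re + ω₂.re) / 2 := by rw [ha]; simp
  have haim : a.im = (ω₁.im + ω₂.im) / 2 := by rw [ha]; simp
  -- `ρ` turns the two sides leading from the corner `-a` to `a` into the closed right half-plane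
  -- minus `0`, with ends `i` and `-i`. They contribute `log (-i) - log i = -πi`, and by central
  -- symmetry so do the other two.
  set ρ := -Complex.I / a with hρ
  have hρ0 : ρ ≠ 0 := div_ne_zero (neg_ne_zero.2 Complex.I_ne_zero) ha0
  have hN : 0 < Complex.normSq a := Complex.normSq_pos.2 ha0
  have hre : ∀ z, (ρ * z).re = (z * conj a).im / Complex.normSq a := by
    intro z
    rw [hρ, div_mul_eq_mul_div, Complex.div_re]
    simp
    field_simp
    ring
  have hslit : ∀ z : ℂ, z ≠ 0 → 0 ≤ (z * conj a).im → ρ * z ∈ Complex.slitPlane := by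
    intro z hz h0
    rw [Complex.mem_slitPlane_iff]
    by_contra! hc
    have h1 : 0 ≤ (ρ * z).re := by rw [hre]; positivity
    have : ρ * z = 0 := Complex.ext (le_antisymm hc.1 h1) hc.2
    exact mul_ne_zero hρ0 hz this
  have i1 := integral_inv_segment (ρ := ρ) (α := ω₁) (β := -ω₂ / 2) hρ0 (by
    intro t ht
    apply hslit
    · have := hne (x := t) (y := -1 / 2) (Or.inr (by norm_num))
      convert this using 1
      push_cast; ring
    · have : ((t * ω₁ + -ω₂ / 2) * conj a).im = (ω₁ * conj ω₂).im * (t + 1 / 2) / 2 := by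
        simp [hare, haim]; ring
      rw [this]
      have := ht.1
      have : 0 ≤ t + 1 / 2 := by linarith
      positivity)
  have i2 := integral_inv_segment (ρ := ρ) (α := ω₂) (β := ω₁ / 2) hρ0 (by
    intro t ht
    apply hslit
    · have := hne (x := 1 / 2) (y := t) (Or.inl (by norm_num))
      convert this using 1
      push_cast; ring
    · have : ((t * ω₂ + ω₁ / 2) * conj a).im = (ω₁ * conj ω₂).im * (1 / 2 - t) / 2 := by
        simp [hare, haim]; ring
      rw [this]
      have := ht.2
      have : 0 ≤ 1 / 2 - t := by linarith
      positivity)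
  have neg : ∀ α β : ℂ, ∫ t in (-1 / 2 : ℝ)..(1 / 2), ((t : ℂ) * α + β)⁻¹
      = -∫ t in (-1 / 2 : ℝ)..(1 / 2), ((t : ℂ) * α - β)⁻¹ := by
    intro α β
    have := intervalIntegral.integral_comp_neg (a := (-1 / 2 : ℝ)) (b := 1 / 2)
      (fun t : ℝ => ((t : ℂ) * α + β)⁻¹)
    rw [show -(1 / 2 : ℝ) = -1 / 2 by ring, show -(-1 / 2 : ℝ) = 1 / 2 by ring] at this
    rw [← this, ← intervalIntegral.integral_neg]
    congr 1
    funext t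
    rw [← inv_neg]
    push_cast
    congr 1; ring
  have e1 : ρ * (ω₁ / 2 + -ω₂ / 2) = ρ * (-ω₂ / 2 + ω₁ / 2) := by ring
  have e2 : ρ * (-ω₁ / 2 + -ω₂ / 2) = Complex.I := by
    rw [hρ, show -ω₁ / 2 + -ω₂ / 2 = -a by rw [ha]; ring]; field_simp
  have e3 : ρ * (ω₂ / 2 + ω₁ / 2) = -Complex.I := by
    rw [hρ, show ω₂ / 2 + ω₁ / 2 = a by rw [ha]; ring]; field_simp
  rw [e1, e2] at i1
  rw [e3] at i2
  rw [paraIntegral, neg ω₁ (ω₂ / 2)]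
  have n2 := neg ω₂ (ω₁ / 2)
  simp only [sub_eq_add_neg, ← neg_div] at n2 i1 i2 ⊢
  rw [Complex.log_I] at i1
  rw [Complex.log_neg_I] at i2
  linear_combination 2 * i1 + 2 * i2 - ω₂ * n2

end Parallelogram

/-! ### Legendre's relation for a basis of the zeros. -/

section Legendre

variable {m : ℂ} {S N : ℂ → ℂ}

/-- The centred parallelogram contains only the zero `0` of `S`, which is simple. So `S'/S` is `1/z`
plus a function holomorphic there, while opposite sides differ by the constants `eta`. -/
theorem SnPair.legendre_of_pos (h : SnPair m S N) {ω₁ ω₂ : h.zeros}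
    (hpos : 0 < ((ω₁ : ℂ) * conj (ω₂ : ℂ)).im)
    (hgen : ∀ z, S z = 0 → ∃ a b : ℤ, z = a * (ω₁ : ℂ) + b * (ω₂ : ℂ)) :
    h.eta ω₁ * ω₂ - h.eta ω₂ * ω₁ = 2 * Real.pi * Complex.I := by
  have le : (-1 / 2 : ℝ) ≤ 1 / 2 := by norm_num
  have hne := @ne_zero_of_im_mul_conj ω₁ ω₂ hpos.ne'
  have hS : ∀ x ∈ Icc (-1 / 2 : ℝ) (1 / 2), ∀ y ∈ Icc (-1 / 2 : ℝ) (1 / 2),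
      S (x * ω₁ + y * ω₂) = 0 → x = 0 ∧ y = 0 := by
    intro x hx y hy h0
    obtain ⟨a, b, hab⟩ := hgen _ h0
    have hxa : x = a ∧ y = b := by
      by_contra hc
      rw [not_and_or] at hc
      apply hne (hc.imp sub_ne_zero.2 sub_ne_zero.2)
      push_cast
      linear_combination hab
    have small : ∀ n : ℤ, (n : ℝ) ∈ Icc (-1 / 2 : ℝ) (1 / 2) → n = 0 := by
      intro n hn
      have h1 : (-1 : ℝ) < n := by linarith [hn.1]
      have h2 : (n : ℝ) < 1 := by linarith [hn.2]
      have h1' : -1 < n := by exact_mod_cast h1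
      have h2' : n < 1 := by exact_mod_cast h2
      omega
    rw [hxa.1] at hx
    rw [hxa.2] at hy
    rw [hxa.1, hxa.2, small a hx, small b hy]
    simp
  set S₁ : ℂ → ℂ := dslope S 0 with hS₁
  have dS₁ : Differentiable ℂ S₁ := by
    have : DifferentiableOn ℂ S₁ univ := (Complex.differentiableOn_dslope univ_mem).2
      h.diffS.differentiableOn
    exact differentiableOn_univ.1 this
  have hSS : ∀ z, S z = z * S₁ z := by
    intro z
    have := sub_smul_dslope S 0 z
    simpa [h.S_zero] using this.symm
  have hS₁ne : ∀ x ∈ Icc (-1 / 2 : ℝ) (1 / 2), ∀ y ∈ Icc (-1 / 2 : ℝ) (1 / 2),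
      S₁ (x * ω₁ + y * ω₂) ≠ 0 := by
    intro x hx y hy h0
    obtain ⟨rfl, rfl⟩ := hS x hx y hy (by rw [hSS, h0, mul_zero])
    simp only [Complex.ofReal_zero, zero_mul, add_zero] at h0
    rw [hS₁, dslope_same, h.deriv_S_zero] at h0
    exact one_ne_zero h0
  have hz := paraIntegral_eq_zero (ω₁ := ω₁) (ω₂ := ω₂) (f := fun z => deriv S₁ z / S₁ z)
    (fun x hx y hy => (dS₁.deriv _).div (dS₁ _) (hS₁ne x hx y hy))
  have hinv := paraIntegral_inv hpos
  have hlog : ∀ z, S z ≠ 0 → -deriv S z / S z = -z⁻¹ - deriv S₁ z / S₁ z := by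
    intro z hz0
    have hz1 := hz0
    rw [hSS] at hz1
    have a := left_ne_zero_of_mul hz1
    have b := right_ne_zero_of_mul hz1
    have hd : deriv S z = S₁ z + z * deriv S₁ z := by
      rw [show S = fun z => z * S₁ z from funext hSS]
      have : HasDerivAt (fun z => z * S₁ z) _ z := (hasDerivAt_id z).mul (dS₁ z).hasDerivAt
      rw [this.deriv]; simp
    rw [hd, hSS]
    field_simp
    ring
  have half : (1 / 2 : ℝ) ∈ Icc (-1 / 2 : ℝ) (1 / 2) := ⟨le, le_rfl⟩
  have nhalf : (-1 / 2 : ℝ) ∈ Icc (-1 / 2 : ℝ) (1 / 2) := ⟨le_rfl, le⟩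
  have cS := h.diffS.continuous
  have cS' := h.diffS.deriv.continuous
  have cS₁ := dS₁.continuous
  have cS₁' := dS₁.deriv.continuous
  -- the integrals over opposite sides
  have side : ∀ (ω ω' : h.zeros), (∀ t ∈ Icc (-1 / 2 : ℝ) (1 / 2),
        (t : ℂ) * ω - ω' / 2 ≠ 0 ∧ (t : ℂ) * ω + ω' / 2 ≠ 0 ∧
        S₁ (t * ω - ω' / 2) ≠ 0 ∧ S₁ (t * ω + ω' / 2) ≠ 0) →
      ((∫ t in (-1 / 2 : ℝ)..(1 / 2), ((t : ℂ) * ω - ω' / 2)⁻¹) -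
        ∫ t in (-1 / 2 : ℝ)..(1 / 2), ((t : ℂ) * ω + ω' / 2)⁻¹) +
      ((∫ t in (-1 / 2 : ℝ)..(1 / 2), deriv S₁ (t * ω - ω' / 2) / S₁ (t * ω - ω' / 2)) -
        ∫ t in (-1 / 2 : ℝ)..(1 / 2), deriv S₁ (t * ω + ω' / 2) / S₁ (t * ω + ω' / 2))
      = h.eta ω' := by
    intro ω ω' hω
    have I : ∀ {f g : ℝ → ℂ}, Continuous f → Continuous g →
        (∀ t ∈ Icc (-1 / 2 : ℝ) (1 / 2), g t ≠ 0) →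
        IntervalIntegrable (fun t => f t / g t) volume (-1 / 2) (1 / 2) := by
      intro f g hf hg h0
      apply ContinuousOn.intervalIntegrable
      rw [uIcc_of_le le]
      exact hf.continuousOn.div hg.continuousOn h0
    have J : ∀ {g : ℝ → ℂ}, Continuous g →
        (∀ t ∈ Icc (-1 / 2 : ℝ) (1 / 2), g t ≠ 0) →
        IntervalIntegrable (fun t => (g t)⁻¹) volume (-1 / 2) (1 / 2) := by
      intro g hg h0
      simpa using I continuous_const (f := fun _ => 1) hg h0
    have j1 := J (g := fun t : ℝ => (t : ℂ) * ω - ω' / 2) (by fun_prop) fun t ht => (hω t ht).1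
    have j2 := J (g := fun t : ℝ => (t : ℂ) * ω + ω' / 2) (by fun_prop) fun t ht => (hω t ht).2.1
    have j3 := I (f := fun t : ℝ => deriv S₁ (t * ω - ω' / 2))
      (g := fun t : ℝ => S₁ (t * ω - ω' / 2)) (by fun_prop) (by fun_prop)
      fun t ht => (hω t ht).2.2.1
    have j4 := I (f := fun t : ℝ => deriv S₁ (t * ω + ω' / 2))
      (g := fun t : ℝ => S₁ (t * ω + ω' / 2)) (by fun_prop) (by fun_prop)
      fun t ht => (hω t ht).2.2.2
    rw [← intervalIntegral.integral_sub j1 j2, ← intervalIntegral.integral_sub j3 j4,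
      ← intervalIntegral.integral_add (j1.sub j2) (j3.sub j4)]
    have : ∀ t ∈ uIcc (-1 / 2 : ℝ) (1 / 2), ((t : ℂ) * ω - ω' / 2)⁻¹ - ((t : ℂ) * ω + ω' / 2)⁻¹ +
        (deriv S₁ (t * ω - ω' / 2) / S₁ (t * ω - ω' / 2)
          - deriv S₁ (t * ω + ω' / 2) / S₁ (t * ω + ω' / 2)) = h.eta ω' := by
      intro t ht
      rw [uIcc_of_le le] at ht
      obtain ⟨h1, h2, h3, h4⟩ := hω t ht
      have s1 : S ((t : ℂ) * ω - ω' / 2) ≠ 0 := by rw [hSS]; exact mul_ne_zero h1 h3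
      have s2 : S ((t : ℂ) * ω + ω' / 2) ≠ 0 := by rw [hSS]; exact mul_ne_zero h2 h4
      have q := ((h.eta_spec ω').1 _ s1).2
      rw [show (t : ℂ) * ω - ω' / 2 + ω' = t * ω + ω' / 2 by ring, hlog _ s1, hlog _ s2] at q
      linear_combination q
    rw [intervalIntegral.integral_congr (g := fun _ => h.eta ω') this]
    simp
    norm_num
  have s1 := side ω₁ ω₂ (by
    intro t ht
    have a := hS₁ne t ht _ half
    have b := hS₁ne t ht _ nhalf
    have c := hne (x := t) (y := 1 / 2) (Or.inr (by norm_num))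
    have d := hne (x := t) (y := -1 / 2) (Or.inr (by norm_num))
    rw [show (t : ℂ) * ω₁ - ω₂ / 2 = t * ω₁ + ((-1 / 2 : ℝ) : ℂ) * ω₂ by push_cast; ring,
      show (t : ℂ) * ω₁ + ω₂ / 2 = t * ω₁ + ((1 / 2 : ℝ) : ℂ) * ω₂ by push_cast; ring]
    exact ⟨d, c, b, a⟩)
  have s2 := side ω₂ ω₁ (by
    intro t ht
    have a := hS₁ne _ half t ht
    have b := hS₁ne _ nhalf t ht
    have c := hne (x := 1 / 2) (y := t) (Or.inl (by norm_num))
    have d := hne (x := -1 / 2) (y := t) (Or.inl (by norm_num))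
    rw [show (t : ℂ) * ω₂ - ω₁ / 2 = ((-1 / 2 : ℝ) : ℂ) * ω₁ + t * ω₂ by push_cast; ring,
      show (t : ℂ) * ω₂ + ω₁ / 2 = ((1 / 2 : ℝ) : ℂ) * ω₁ + t * ω₂ by push_cast; ring]
    exact ⟨d, c, b, a⟩)
  rw [paraIntegral] at hz hinv
  linear_combination -hz - hinv + (ω₁ : ℂ) * s1 - (ω₂ : ℂ) * s2

/-- Squaring absorbs the sign that depends on the orientation of the basis. -/
theorem SnPair.legendre (h : SnPair m S N) {ω₁ ω₂ : h.zeros}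
    (hne : ((ω₁ : ℂ) * conj (ω₂ : ℂ)).im ≠ 0)
    (hgen : ∀ z, S z = 0 → ∃ a b : ℤ, z = a * (ω₁ : ℂ) + b * (ω₂ : ℂ)) :
    (h.eta ω₁ * ω₂ - h.eta ω₂ * ω₁) ^ 2 = (2 * Real.pi * Complex.I) ^ 2 := by
  rcases hne.lt_or_gt with hlt | hgt
  · rw [← h.legendre_of_pos (ω₁ := ω₂) (ω₂ := ω₁) (by
      simp at hlt ⊢; linarith) (fun z hz => by
        obtain ⟨a, b, hab⟩ := hgen z hz
        exact ⟨b, a, by rw [hab, add_comm]⟩)]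
    ring
  · rw [h.legendre_of_pos hgt hgen]

end Legendre
end JacobiElliptic


namespace JacobiElliptic
open Set Filter Topology MeasureTheory ComplexConjugate

/-! ### The lattice of zeros and a criterion for a basis. -/

section Lattice

variable {m : ℂ} {S N : ℂ → ℂ}

theorem exists_real_coords {α β : ℂ} (h : (α * conj β).im ≠ 0) (z : ℂ) :
    ∃ x y : ℝ, z = x * α + y * β := by
  have h' : α.im * β.re - α.re * β.im ≠ 0 := by
    simpa [sub_eq_neg_add] using h
  refine ⟨(z.im * β.re - z.re * β.im) / (α.im * β.re - α.re * β.im),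
    (α.im * z.re - α.re * z.im) / (α.im * β.re - α.re * β.im), ?_⟩
  apply Complex.ext
  · rw [Complex.add_re, Complex.re_ofReal_mul, Complex.re_ofReal_mul,
      div_mul_eq_mul_div, div_mul_eq_mul_div, ← add_div, eq_div_iff h']
    ring
  · rw [Complex.add_im, Complex.im_ofReal_mul, Complex.im_ofReal_mul,
      div_mul_eq_mul_div, div_mul_eq_mul_div, ← add_div, eq_div_iff h']
    ring

theorem linearIndependent_pair {α β : ℂ} (h : (α * conj β).im ≠ 0) :
    LinearIndependent ℝ ![α, β] := by
  rw [LinearIndependent.pair_iff]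
  intro x y hxy
  by_contra hc
  rw [not_and_or] at hc
  exact ne_zero_of_im_mul_conj h hc (by simpa using hxy)

theorem SnPair.isolated_zero (h : SnPair m S N) :
    ∃ ε > 0, ∀ z, S z = 0 → ‖z‖ < ε → z = 0 := by
  have := entire_eventually_ne_zero h.diffS h.exists_S_ne_zero 0
  rw [eventually_nhdsWithin_iff, Metric.eventually_nhds_iff] at this
  obtain ⟨ε, hε, hb⟩ := this
  refine ⟨ε, hε, fun z hz hn => ?_⟩
  by_contra h0
  exact hb (by simpa using hn) h0 hz

/-- Zeros on a common real line form a discrete, hence cyclic, group. Then `α` and `β` are multiples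
of one zero, and the Legendre expression vanishes by additivity of `eta`. -/
theorem SnPair.im_ne_zero (h : SnPair m S N) {α β : h.zeros}
    (hL : h.eta α * β - h.eta β * α ≠ 0) : ((α : ℂ) * conj (β : ℂ)).im ≠ 0 := by
  intro him
  have hα : (α : ℂ) ≠ 0 := by
    intro h0
    have : α = 0 := Subtype.ext h0
    rw [this] at hL
    simp at hL
  obtain ⟨r, hr⟩ : ∃ r : ℝ, (β : ℂ) = r * α := by
    refine ⟨((β : ℂ) * conj (α : ℂ)).re / Complex.normSq α, ?_⟩
    have e : (β : ℂ) * conj (α : ℂ) = (((β : ℂ) * conj (α : ℂ)).re : ℂ) := by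
      apply Complex.ext
      · simp
      · simp at him ⊢; linarith
    rw [Complex.ofReal_div, ← e, Complex.normSq_eq_conj_mul_self]
    have : conj (α : ℂ) ≠ 0 := by simpa using hα
    field_simp
  let φ : ℝ →+ ℂ := (AddMonoidHom.mulRight (α : ℂ)).comp Complex.ofRealHom.toAddMonoidHom
  have hφ : ∀ x, φ x = x * α := fun x => rfl
  obtain ⟨ε, hε, hb⟩ := h.isolated_zero
  rcases (h.zeros.comap φ).dense_or_cyclic with hd | ⟨g, hg⟩
  · have hna : 0 < ‖(α : ℂ)‖ := norm_pos_iff.2 hα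
    obtain ⟨x, hx, hx2⟩ := hd.exists_between (div_pos hε hna)
    have : φ x = 0 := hb _ hx (by
      rw [hφ, norm_mul, Complex.norm_real, Real.norm_of_nonneg hx2.1.le]
      exact (lt_div_iff₀ hna).1 hx2.2)
    rw [hφ] at this
    exact (mul_ne_zero (by exact_mod_cast hx2.1.ne') hα) this
  · have hgm : φ g ∈ h.zeros := by
      have : g ∈ h.zeros.comap φ := by rw [hg]; exact AddSubgroup.mem_closure_singleton_self g
      exact this
    have h1 : (1 : ℝ) ∈ h.zeros.comap φ := by
      rw [AddSubgroup.mem_comap, hφ, Complex.ofReal_one, one_mul]; exact α.2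
    have h2 : r ∈ h.zeros.comap φ := by
      rw [AddSubgroup.mem_comap, hφ, ← hr]; exact β.2
    rw [hg, AddSubgroup.mem_closure_singleton] at h1 h2
    obtain ⟨a, ha⟩ := h1
    obtain ⟨b, hb'⟩ := h2
    set ω : h.zeros := ⟨φ g, hgm⟩ with hω
    have e1 : α = a • ω := by
      apply Subtype.ext
      rw [AddSubgroup.coe_zsmul, hω, ← map_zsmul, ha, hφ]; simp
    have e2 : β = b • ω := by
      apply Subtype.ext
      rw [AddSubgroup.coe_zsmul, hω, ← map_zsmul, hb', hφ, hr]
    apply hL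
    rw [e1, e2, map_zsmul, map_zsmul, AddSubgroup.coe_zsmul, AddSubgroup.coe_zsmul]
    simp only [zsmul_eq_mul]
    ring

/-- Two zeros of `S` with the Legendre relation generate all zeros. -/
theorem SnPair.generate (h : SnPair m S N) {α β : h.zeros}
    (hL : h.eta α * β - h.eta β * α = 2 * Real.pi * Complex.I) :
    ∀ z, S z = 0 → ∃ a b : ℤ, z = a * (α : ℂ) + b * (β : ℂ) := by
  have hπ : (2 * Real.pi * Complex.I : ℂ) ≠ 0 := Complex.two_pi_I_ne_zero
  have him := h.im_ne_zero (α := α) (β := β) (by rw [hL]; exact hπ)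
  -- The zeros form a full lattice and so have some basis `ω₁, ω₂`; it is compared with `α, β`.
  let Λ : Submodule ℤ ℂ := h.zeros.toIntSubmodule
  have hΛ : ∀ z, z ∈ Λ ↔ S z = 0 := fun z => Iff.rfl
  have hdisc : DiscreteTopology Λ := by
    obtain ⟨ε, hε, hb⟩ := h.isolated_zero
    refine discreteTopology_iff_isOpen_singleton_zero.mpr ⟨Metric.ball 0 ε, Metric.isOpen_ball, ?_⟩
    ext z
    simp only [mem_preimage, mem_ball_zero_iff, mem_singleton_iff]
    constructor
    · intro hz
      exact Subtype.ext (hb _ ((hΛ _).1 z.2) hz)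
    · rintro rfl
      simpa using hε
  have hlat : IsZLattice ℝ Λ := by
    refine ⟨eq_top_iff.2 fun z _ => ?_⟩
    obtain ⟨x, y, rfl⟩ := exists_real_coords him z
    refine Submodule.add_mem _ ?_ ?_
    · have := Submodule.smul_mem (Submodule.span ℝ (Λ : Set ℂ)) x
        (Submodule.subset_span (show (α : ℂ) ∈ (Λ : Set ℂ) from α.2))
      simpa using this
    · have := Submodule.smul_mem (Submodule.span ℝ (Λ : Set ℂ)) y
        (Submodule.subset_span (show (β : ℂ) ∈ (Λ : Set ℂ) from β.2))
      simpa using this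
  have hfree := ZLattice.module_free ℝ Λ
  have hfin := ZLattice.module_finite ℝ Λ
  have hrank : Module.finrank ℤ Λ = 2 := by
    rw [ZLattice.rank ℝ Λ, Complex.finrank_real_complex]
  let B := Module.finBasisOfFinrankEq ℤ Λ hrank
  set ω₁ : h.zeros := ⟨B 0, (B 0).2⟩ with hω₁
  set ω₂ : h.zeros := ⟨B 1, (B 1).2⟩ with hω₂
  have hrep : ∀ ω : h.zeros, ∃ a b : ℤ, ω = a • ω₁ + b • ω₂ := by
    intro ω
    have := B.sum_repr (⟨ω, ω.2⟩ : Λ)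
    rw [Fin.sum_univ_two] at this
    refine ⟨_, _, Subtype.ext (congrArg Subtype.val this).symm⟩
  have hgen : ∀ z, S z = 0 → ∃ a b : ℤ, z = a * (ω₁ : ℂ) + b * (ω₂ : ℂ) := by
    intro z hz
    obtain ⟨a, b, hab⟩ := hrep ⟨z, hz⟩
    refine ⟨a, b, ?_⟩
    have := congrArg Subtype.val hab
    simpa using this
  obtain ⟨a, b, hα⟩ := hrep α
  obtain ⟨c, d, hβ⟩ := hrep β
  have cα : (α : ℂ) = a * (ω₁ : ℂ) + b * (ω₂ : ℂ) := by
    simpa using congrArg Subtype.val hα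
  have cβ : (β : ℂ) = c * (ω₁ : ℂ) + d * (ω₂ : ℂ) := by
    simpa using congrArg Subtype.val hβ
  have eα : h.eta α = a * h.eta ω₁ + b * h.eta ω₂ := by
    rw [hα, map_add, map_zsmul, map_zsmul]; simp
  have eβ : h.eta β = c * h.eta ω₁ + d * h.eta ω₂ := by
    rw [hβ, map_add, map_zsmul, map_zsmul]; simp
  have hdet : h.eta α * β - h.eta β * α
      = (a * d - b * c) * (h.eta ω₁ * ω₂ - h.eta ω₂ * ω₁) := by
    rw [eα, eβ, cα, cβ]; ring
  have hne : ((ω₁ : ℂ) * conj (ω₂ : ℂ)).im ≠ 0 := by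
    refine h.im_ne_zero fun h0 => hπ ?_
    rw [← hL, hdet, h0, mul_zero]
  have hleg := h.legendre hne hgen
  -- The Legendre expression of `α, β` is the determinant times that of the basis, and both have
  -- square `(2πi)²`.
  have hsq : ((a * d - b * c : ℤ) : ℂ) ^ 2 = 1 := by
    have : ((a * d - b * c : ℤ) : ℂ) ^ 2 * (2 * Real.pi * Complex.I) ^ 2
        = 1 * (2 * Real.pi * Complex.I) ^ 2 := by
      rw [← hleg, one_mul]
      conv_rhs => rw [hleg, ← hL, hdet]
      push_cast; ring
    exact mul_right_cancel₀ (pow_ne_zero 2 hπ) this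
  have hsq' : (a * d - b * c) ^ 2 = 1 := by exact_mod_cast hsq
  intro z hz
  obtain ⟨x, y, hxy⟩ := hgen z hz
  -- Cramer's rule, with the determinant equal to its own inverse.
  refine ⟨(a * d - b * c) * (x * d - y * c), (a * d - b * c) * (y * a - x * b), ?_⟩
  rw [hxy, cα, cβ]
  push_cast at hsq ⊢
  linear_combination -(x * (ω₁ : ℂ) + y * ω₂) * hsq

end Lattice

/-! ### Surjectivity onto the elliptic curve. -/

section Surjective

variable {m : ℂ} {S N : ℂ → ℂ}

/-- An elliptic function attains every value. -/
theorem SnPair.exists_quo_eq (h : SnPair m S N) {ω₁ ω₂ : ℂ} (hne : (ω₁ * conj ω₂).im ≠ 0)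
    (h1 : SignPeriod S N 1 ω₁) (h2 : SignPeriod S N 1 ω₂) (x : ℂ) : ∃ z, S z = x * N z := by
  by_contra! hc
  have hc' : ∀ z, S z - x * N z ≠ 0 := fun z => sub_ne_zero.2 (hc z)
  -- If `x` were omitted, `1 / (s - x)` would be entire and doubly periodic, hence constant by
  -- Liouville.
  set F : ℂ → ℂ := fun z => N z / (S z - x * N z) with hF
  have dF : Differentiable ℂ F := h.diffN.div (h.diffS.sub (h.diffN.const_mul x)) hc'
  have per : ∀ ω, SignPeriod S N 1 ω → Function.Periodic F ω := by
    intro ω hω z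
    have := hω z
    simp only [hF]
    rw [div_eq_div_iff (hc' _) (hc' _)]
    linear_combination -this
  have hb : Bornology.IsBounded (range F) := by
    have hK : IsCompact ((fun p : ℝ × ℝ => F (p.1 * ω₁ + p.2 * ω₂)) ''
        (Icc (0 : ℝ) 1 ×ˢ Icc (0 : ℝ) 1)) := by
      refine (isCompact_Icc.prod isCompact_Icc).image ?_
      have := dF.continuous
      fun_prop
    refine hK.isBounded.subset ?_
    rintro _ ⟨z, rfl⟩
    obtain ⟨a, b, rfl⟩ := exists_real_coords hne z
    refine ⟨(Int.fract a, Int.fract b), ⟨⟨Int.fract_nonneg a, (Int.fract_lt_one a).le⟩,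
      ⟨Int.fract_nonneg b, (Int.fract_lt_one b).le⟩⟩, ?_⟩
    have e := ((per ω₁ h1).int_mul ⌊a⌋).add_period ((per ω₂ h2).int_mul ⌊b⌋)
      ((Int.fract a : ℝ) * ω₁ + (Int.fract b : ℝ) * ω₂)
    simp only
    rw [← e]
    congr 1
    have ea : (a : ℂ) = (⌊a⌋ : ℂ) + (Int.fract a : ℝ) := by
      have := Int.floor_add_fract a
      exact_mod_cast this.symm
    have eb : (b : ℂ) = (⌊b⌋ : ℂ) + (Int.fract b : ℝ) := by
      have := Int.floor_add_fract b
      exact_mod_cast this.symm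
    linear_combination -ω₁ * ea - ω₂ * eb
  obtain ⟨C, hC⟩ := dF.exists_const_forall_eq_of_bounded hb
  have e : ∀ z, N z = C * (S z - x * N z) := by
    intro z
    rw [← hC z, hF]
    exact (div_mul_cancel₀ _ (hc' z)).symm
  have e0 := e 0
  rw [h.S_zero, h.N_zero] at e0
  obtain ⟨z, hz⟩ := h.exists_S_ne_zero
  have e1 := e z
  have : C * S z = 0 := by linear_combination -e1 + N z * e0
  rcases mul_eq_zero.1 this with h0 | h0
  · rw [h0] at e0; simp at e0
  · exact hz h0

/-- Every point of the curve `v ^ 2 = (1 - u ^ 2) (1 - m u ^ 2)` is attained. -/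
theorem SnPair.exists_point (h : SnPair m S N) {α ω₂ : ℂ} (hne : (α * conj ω₂).im ≠ 0)
    (h1 : SignPeriod S N (-1) α) (h2 : SignPeriod S N 1 ω₂) {u v : ℂ}
    (huv : v ^ 2 = (1 - u ^ 2) * (1 - m * u ^ 2)) :
    ∃ z, N z ≠ 0 ∧ quo S N z = u ∧ quoD S N z = v := by
  have h11 : SignPeriod S N 1 (2 * α) := by
    refine h.period_iff.1 fun z => ?_
    rw [two_mul, ← add_assoc, h.quo_add (by norm_num) h1, h.quo_add (by norm_num) h1]
    ring
  obtain ⟨z, hz⟩ := h.exists_quo_eq (ω₁ := 2 * α) (ω₂ := ω₂) (by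
    have : 2 * α * conj ω₂ = (2 : ℝ) * (α * conj ω₂) := by push_cast; ring
    rw [this, Complex.im_ofReal_mul]
    exact mul_ne_zero two_ne_zero hne) h11 h2 u
  obtain ⟨hN, hq⟩ := h.quo_eq_iff hz
  have hsq := h.quoD_sq hN
  rw [hq, ← huv] at hsq
  rcases sq_eq_sq_iff_eq_or_eq_neg.1 hsq with hv | hv
  · exact ⟨z, hN, hq, hv⟩
  · have hNneg : N (-z) ≠ 0 := by
      intro h0
      have e := h.quo_neg z
      rw [h0, mul_zero, neg_zero] at e
      exact (mul_ne_zero (h.no_common_zero _ h0) hN) e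
    have hodd : ∀ w, quo S N (-w) = -quo S N w := by
      intro w
      have e := h.quo_neg w
      have e' := h.quo_neg (-w)
      rw [neg_neg] at e'
      unfold quo
      by_cases a : N w = 0
      · have : N (-w) = 0 := by
          rw [a, mul_zero] at e
          have := neg_eq_zero.1 e.symm
          exact (mul_eq_zero.1 this).resolve_left (h.no_common_zero _ a)
        simp [a, this]
      · have b : N (-w) ≠ 0 := by
          intro b
          rw [b, mul_zero, neg_zero] at e
          exact (mul_ne_zero (h.no_common_zero _ b) a) e
        field_simp
        linear_combination e
    have hoddD : quoD S N (-z) = quoD S N z := by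
      have d1 : HasDerivAt (fun w => quo S N (-w)) (-quoD S N (-z)) z :=
        ((h.hasDerivAt_quo hNneg).comp z (hasDerivAt_neg z)).congr_deriv (by ring)
      rw [show (fun w => quo S N (-w)) = fun w => -quo S N w from funext hodd] at d1
      exact neg_injective (d1.unique (h.hasDerivAt_quo hN).neg)
    -- Since `s` is odd, `s'` is even and `α` reverses both signs, `-z + α` keeps `u` and flips `v`.
    refine ⟨-z + α, fun h0 => hNneg ((h.N_add_eq_zero_iff (by norm_num) h1 _).1 h0), ?_, ?_⟩
    · rw [h.quo_add (by norm_num) h1, hodd, hq]; ring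
    · rw [h.quoD_add (by norm_num) h1 hNneg, hoddD, hv]; ring

end Surjective
end JacobiElliptic


namespace JacobiElliptic
open Set Filter Topology MeasureTheory ComplexConjugate

/-! ### The principal square root on the slit plane. -/

section SquareRoot

open Complex (slitPlane)

theorem sqrt_sq (z : ℂ) : z.sqrt ^ 2 = z := by
  simp [Complex.sqrt]

theorem sqrt_ne_zero {z : ℂ} (hz : z ≠ 0) : z.sqrt ≠ 0 := fun h => hz (by
  rw [← sqrt_sq z, h]; ring)

theorem hasDerivAt_sqrt {z : ℂ} (hz : z ∈ slitPlane) :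
    HasDerivAt Complex.sqrt (1 / (2 * z.sqrt)) z := by
  have h := (hasDerivAt_id z).cpow_const (c := 2⁻¹) hz
  refine h.congr_deriv ?_
  have hz0 := Complex.slitPlane_ne_zero hz
  have e : z ^ ((2 : ℂ)⁻¹ - 1) = z.sqrt / z := by
    rw [Complex.cpow_sub _ _ hz0, Complex.cpow_one]; rfl
  have hs := sqrt_ne_zero hz0
  have h2 := sqrt_sq z
  simp only [id]
  rw [e]
  generalize z.sqrt = s at *
  subst h2
  field_simp

theorem continuousOn_sqrt : ContinuousOn Complex.sqrt slitPlane := fun _ hz =>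
  (hasDerivAt_sqrt hz).continuousAt.continuousWithinAt

theorem sqrt_re_pos {z : ℂ} (hz : z ∈ slitPlane) : 0 < z.sqrt.re := by
  have h0 : 0 ≤ z.sqrt.re := by
    unfold Complex.sqrt
    rw [Complex.cpow_inv_two_re]; positivity
  refine h0.lt_of_ne fun h => ?_
  have h2 := sqrt_sq z
  have e1 : z.re = -z.sqrt.im ^ 2 := by
    conv_lhs => rw [← h2]
    simp [sq, ← h]
  have e2 : z.im = 0 := by
    conv_lhs => rw [← h2]
    simp [sq, ← h]
  rcases hz with hz | hz
  · rw [e1] at hz; nlinarith [sq_nonneg z.sqrt.im]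
  · exact hz e2

theorem mem_slitPlane_combo {z : ℂ} (hz : z ∈ slitPlane) {x y : ℝ} (hx : 0 ≤ x) (hy : 0 ≤ y)
    (hxy : x + y = 1) : (x : ℂ) + y * z ∈ slitPlane := by
  have := Complex.starConvex_one_slitPlane hz hx hy hxy
  simpa using this

theorem cos_sq_add_mem_slitPlane {z : ℂ} (hz : z ∈ slitPlane) (t : ℝ) :
    (Real.cos t : ℂ) ^ 2 + (Real.sin t : ℂ) ^ 2 * z ∈ slitPlane := by
  have := mem_slitPlane_combo hz (sq_nonneg (Real.cos t)) (sq_nonneg (Real.sin t))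
    (Real.cos_sq_add_sin_sq t)
  push_cast at this ⊢
  exact this

end SquareRoot

/-! ### The complete elliptic integral and its differential equation. -/

section Quarter

open Complex (slitPlane)

/-- The complement of the ray `[1, ∞)`. -/
def slitDomain : Set ℂ := {μ | 1 - μ ∈ slitPlane}

theorem isOpen_slitDomain : IsOpen slitDomain :=
  Complex.isOpen_slitPlane.preimage (by fun_prop : Continuous fun μ : ℂ => 1 - μ)

theorem ball_subset_slitDomain : Metric.ball (0 : ℂ) 1 ⊆ slitDomain := by
  intro μ hμ
  rw [mem_ball_zero_iff] at hμ
  refine Or.inl ?_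
  have := (Complex.abs_re_le_norm μ).trans_lt hμ
  rw [abs_lt] at this
  simp only [Complex.sub_re, Complex.one_re]
  linarith

/-- `Δ(μ, t) = √(1 - μ sin² t)`. -/
noncomputable def del (μ : ℂ) (t : ℝ) : ℂ := Complex.sqrt (1 - μ * (Real.sin t : ℂ) ^ 2)

theorem ofReal_cos_sq (t : ℝ) : (Real.cos t : ℂ) ^ 2 = 1 - (Real.sin t : ℂ) ^ 2 := by
  have := Real.cos_sq' t
  exact_mod_cast this

/-- `1 - μ sin² t` is a convex combination of `1` and `1 - μ`, and the slit plane is star-shaped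
about `1`. -/
theorem del_base_mem {μ : ℂ} (hμ : μ ∈ slitDomain) (t : ℝ) :
    1 - μ * (Real.sin t : ℂ) ^ 2 ∈ slitPlane := by
  have := cos_sq_add_mem_slitPlane hμ t
  rw [ofReal_cos_sq] at this
  convert this using 1
  ring

theorem del_sq (μ : ℂ) (t : ℝ) : del μ t ^ 2 = 1 - μ * (Real.sin t : ℂ) ^ 2 := sqrt_sq _

theorem del_ne_zero {μ : ℂ} (hμ : μ ∈ slitDomain) (t : ℝ) : del μ t ≠ 0 :=
  sqrt_ne_zero (Complex.slitPlane_ne_zero (del_base_mem hμ t))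

theorem hasDerivAt_del_param {μ : ℂ} (hμ : μ ∈ slitDomain) (t : ℝ) :
    HasDerivAt (fun μ => del μ t) (-(Real.sin t : ℂ) ^ 2 / (2 * del μ t)) μ := by
  have h1 : HasDerivAt (fun μ : ℂ => 1 - μ * (Real.sin t : ℂ) ^ 2) (-(Real.sin t : ℂ) ^ 2) μ := by
    have := ((hasDerivAt_id μ).mul_const ((Real.sin t : ℂ) ^ 2)).const_sub 1
    exact this.congr_deriv (by ring)
  exact ((hasDerivAt_sqrt (del_base_mem hμ t)).comp μ h1).congr_deriv (by
    change _ = _ / (2 * Complex.sqrt _); ring)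

theorem hasDerivAt_ofReal_sin (t : ℝ) :
    HasDerivAt (fun t : ℝ => (Real.sin t : ℂ)) (Real.cos t) t := (Real.hasDerivAt_sin t).ofReal_comp

theorem hasDerivAt_ofReal_cos (t : ℝ) :
    HasDerivAt (fun t : ℝ => (Real.cos t : ℂ)) (-Real.sin t) t := by
  have := (Real.hasDerivAt_cos t).ofReal_comp
  push_cast at this ⊢
  exact this

theorem hasDerivAt_del {μ : ℂ} (hμ : μ ∈ slitDomain) (t : ℝ) :
    HasDerivAt (del μ) (-(μ * Real.sin t * Real.cos t) / del μ t) t := by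
  have h1 : HasDerivAt (fun t : ℝ => 1 - μ * (Real.sin t : ℂ) ^ 2)
      (-(μ * (2 * Real.sin t * Real.cos t))) t := by
    have := (((hasDerivAt_ofReal_sin t).pow 2).const_mul μ).const_sub 1
    exact this.congr_deriv (by push_cast; ring)
  refine ((hasDerivAt_sqrt (del_base_mem hμ t)).comp t h1).congr_deriv ?_
  change 1 / (2 * del μ t) * _ = _
  have := del_ne_zero hμ t
  field_simp

theorem continuousOn_del (s : Set ℝ) :
    ContinuousOn (fun p : ℂ × ℝ => del p.1 p.2) (slitDomain ×ˢ s) := by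
  refine continuousOn_sqrt.comp (f := fun p : ℂ × ℝ => 1 - p.1 * (Real.sin p.2 : ℂ) ^ 2)
    (by fun_prop) ?_
  rintro ⟨μ, t⟩ ⟨hμ, -⟩
  exact del_base_mem hμ t

theorem continuous_del {μ : ℂ} (hμ : μ ∈ slitDomain) : Continuous (del μ) :=
  continuous_iff_continuousAt.2 fun t => (hasDerivAt_del hμ t).continuousAt

/-- Twice the complete elliptic integral of the first kind. -/
noncomputable def ellH (μ : ℂ) : ℂ := ∫ t in (0 : ℝ)..Real.pi, 1 / del μ t

noncomputable def ellH₁ (μ : ℂ) : ℂ := ∫ t in (0 : ℝ)..Real.pi, (Real.sin t : ℂ) ^ 2 / (2 * del μ t ^ 3)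

noncomputable def ellH₂ (μ : ℂ) : ℂ := ∫ t in (0 : ℝ)..Real.pi, 3 * (Real.sin t : ℂ) ^ 4 / (4 * del μ t ^ 5)

theorem hasDerivAt_ellH {μ : ℂ} (hμ : μ ∈ slitDomain) : HasDerivAt ellH (ellH₁ μ) μ := by
  refine hasDerivAt_integral_param isOpen_slitDomain (F := fun μ t => 1 / del μ t)
    (F' := fun μ t => (Real.sin t : ℂ) ^ 2 / (2 * del μ t ^ 3)) ?_ ?_ ?_ hμ
  · exact continuousOn_const.div (continuousOn_del _) fun p hp => del_ne_zero hp.1 _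
  · exact ContinuousOn.div (by fun_prop) (continuousOn_const.mul ((continuousOn_del _).pow 3))
      fun p hp => mul_ne_zero two_ne_zero (pow_ne_zero 3 (del_ne_zero hp.1 _))
  · intro x hx t _
    have h0 := del_ne_zero hx t
    refine ((hasDerivAt_const x (1 : ℂ)).div (hasDerivAt_del_param hx t) h0).congr_deriv ?_
    field_simp
    ring

theorem hasDerivAt_ellH₁ {μ : ℂ} (hμ : μ ∈ slitDomain) : HasDerivAt ellH₁ (ellH₂ μ) μ := by
  refine hasDerivAt_integral_param isOpen_slitDomain
    (F := fun μ t => (Real.sin t : ℂ) ^ 2 / (2 * del μ t ^ 3))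
    (F' := fun μ t => 3 * (Real.sin t : ℂ) ^ 4 / (4 * del μ t ^ 5)) ?_ ?_ ?_ hμ
  · exact ContinuousOn.div (by fun_prop) (continuousOn_const.mul ((continuousOn_del _).pow 3))
      fun p hp => mul_ne_zero two_ne_zero (pow_ne_zero 3 (del_ne_zero hp.1 _))
  · exact ContinuousOn.div (by fun_prop) (continuousOn_const.mul ((continuousOn_del _).pow 5))
      fun p hp => mul_ne_zero (by norm_num) (pow_ne_zero 5 (del_ne_zero hp.1 _))
  · intro x hx t _
    have h0 := del_ne_zero hx t
    refine ((hasDerivAt_const x ((Real.sin t : ℂ) ^ 2)).div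
      (((hasDerivAt_del_param hx t).pow 3).const_mul 2)
      (mul_ne_zero two_ne_zero (pow_ne_zero 3 h0))).congr_deriv ?_
    simp only [Pi.pow_apply]
    push_cast
    field_simp
    ring

theorem continuous_div_del {μ : ℂ} (hμ : μ ∈ slitDomain) {f : ℝ → ℂ} (hf : Continuous f)
    (c : ℂ) (hc : c ≠ 0) (n : ℕ) : Continuous fun t => f t / (c * del μ t ^ n) :=
  hf.div (continuous_const.mul ((continuous_del hμ).pow n))
    fun t => mul_ne_zero hc (pow_ne_zero n (del_ne_zero hμ t))

/-- The combination of integrands is the derivative of `-sin t cos t / (4 Δ³)`, which vanishes at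
`0` and `π`. -/
theorem ellH_ode {μ : ℂ} (hμ : μ ∈ slitDomain) :
    μ * (1 - μ) * ellH₂ μ + (1 - 2 * μ) * ellH₁ μ - 1 / 4 * ellH μ = 0 := by
  have hd : ∀ t : ℝ, HasDerivAt (fun t => (Real.sin t : ℂ) * Real.cos t / (-4 * del μ t ^ 3))
      (μ * (1 - μ) * (3 * (Real.sin t : ℂ) ^ 4 / (4 * del μ t ^ 5)) +
        (1 - 2 * μ) * ((Real.sin t : ℂ) ^ 2 / (2 * del μ t ^ 3)) - 1 / 4 * (1 / del μ t)) t := by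
    intro t
    have h0 := del_ne_zero hμ t
    refine (((hasDerivAt_ofReal_sin t).mul (hasDerivAt_ofReal_cos t)).div
      (((hasDerivAt_del hμ t).pow 3).const_mul (-4))
      (mul_ne_zero (by norm_num) (pow_ne_zero 3 h0))).congr_deriv ?_
    simp only [Pi.pow_apply, Pi.mul_apply]
    have h2 := del_sq μ t
    have hc := ofReal_cos_sq t
    push_cast
    generalize del μ t = d at *
    rw [← Complex.ofReal_sin, ← Complex.ofReal_cos]
    generalize (Real.sin t : ℂ) = s at *
    generalize (Real.cos t : ℂ) = c at *
    field_simp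
    rw [show d ^ 4 = (d ^ 2) ^ 2 by ring, h2, hc]
    ring
  have i0 : IntervalIntegrable (fun t => 1 / del μ t) volume 0 Real.pi :=
    (continuous_const.div (continuous_del hμ) (del_ne_zero hμ)).intervalIntegrable _ _
  have i1 := (continuous_div_del hμ (f := fun t => (Real.sin t : ℂ) ^ 2) (by fun_prop) 2
    two_ne_zero 3).intervalIntegrable (μ := volume) 0 Real.pi
  have i2 := (continuous_div_del hμ (f := fun t => 3 * (Real.sin t : ℂ) ^ 4) (by fun_prop) 4
    (by norm_num) 5).intervalIntegrable (μ := volume) 0 Real.pi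
  have key := intervalIntegral.integral_eq_sub_of_hasDerivAt (a := 0) (b := Real.pi)
    (fun t _ => hd t) (((i2.const_mul _).add (i1.const_mul _)).sub (i0.const_mul _))
  rw [intervalIntegral.integral_sub ((i2.const_mul _).add (i1.const_mul _)) (i0.const_mul _),
    intervalIntegral.integral_add (i2.const_mul _) (i1.const_mul _)] at key
  simp only [intervalIntegral.integral_const_mul] at key
  simp only [Real.sin_pi, Real.sin_zero, Complex.ofReal_zero, zero_mul, zero_div, sub_zero] at key
  exact key

/-- The principal root `Δ` has positive real part, and so has `1 / Δ`. This is what permits division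
by `ellH` later. -/
theorem ellH_re_pos {μ : ℂ} (hμ : μ ∈ slitDomain) : 0 < (ellH μ).re := by
  have hc : Continuous fun t => 1 / del μ t :=
    continuous_const.div (continuous_del hμ) (del_ne_zero hμ)
  have e : (ellH μ).re = ∫ t in (0 : ℝ)..Real.pi, (1 / del μ t).re := by
    have := Complex.reCLM.intervalIntegral_comp_comm (hc.intervalIntegrable (μ := volume) 0 Real.pi)
    exact this.symm
  rw [e]
  refine intervalIntegral.intervalIntegral_pos_of_pos
    ((Complex.continuous_re.comp hc).intervalIntegrable _ _) (fun t => ?_) Real.pi_pos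
  rw [one_div, Complex.inv_re]
  exact div_pos (sqrt_re_pos (del_base_mem hμ t)) (Complex.normSq_pos.2 (del_ne_zero hμ t))

end Quarter

end JacobiElliptic


namespace JacobiElliptic
open Set Filter Topology MeasureTheory ComplexConjugate

/-! ### The power series of the period. -/

section Series

/-- The coefficients of `(1 - x)^(-1/2)`. -/
noncomputable def halfCoeff (n : ℕ) : ℝ := ∏ i ∈ Finset.range n, (2 * (i : ℝ) + 1) / (2 * i + 2)

theorem halfCoeff_zero : halfCoeff 0 = 1 := by simp [halfCoeff]

theorem halfCoeff_succ (n : ℕ) :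
    halfCoeff (n + 1) = halfCoeff n * ((2 * n + 1) / (2 * n + 2)) := by
  unfold halfCoeff; rw [Finset.prod_range_succ]

theorem halfCoeff_pos (n : ℕ) : 0 < halfCoeff n := Finset.prod_pos fun i _ => by positivity

theorem halfCoeff_le_one (n : ℕ) : halfCoeff n ≤ 1 :=
  Finset.prod_le_one (fun i _ => by positivity)
    fun i _ => (div_le_one (by positivity)).2 (by linarith)

theorem multichoose_half (n : ℕ) : Ring.multichoose (1 / 2 : ℂ) n = halfCoeff n := by
  have h1 : ∀ n : ℕ, (ascPochhammer ℂ n).eval (1 / 2) = n.factorial * halfCoeff n := by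
    intro n
    induction n with
    | zero => simp [halfCoeff_zero]
    | succ n ih =>
      rw [ascPochhammer_succ_eval, ih, halfCoeff_succ, Nat.factorial_succ]
      push_cast
      have : (2 * (n : ℂ) + 2) ≠ 0 := by
        have : ((2 * n + 2 : ℕ) : ℂ) ≠ 0 := Nat.cast_ne_zero.2 (by omega)
        exact_mod_cast this
      field_simp
      ring
  have h2 := Ring.factorial_nsmul_multichoose_eq_ascPochhammer (1 / 2 : ℂ) n
  rw [Polynomial.ascPochhammer_smeval_eq_eval, h1, nsmul_eq_mul] at h2
  exact mul_left_cancel₀ (Nat.cast_ne_zero.2 n.factorial_ne_zero) h2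

theorem hasSum_inv_sqrt {x : ℂ} (hx : ‖x‖ < 1) :
    HasSum (fun n => (halfCoeff n : ℂ) * x ^ n) (1 / Complex.sqrt (1 - x)) := by
  have h := (Complex.one_div_one_sub_cpow_hasFPowerSeriesOnBall_zero (1 / 2)).hasSum (y := x)
    (by rw [Metric.mem_eball, edist_zero_right]; rw [← ofReal_norm]; exact ENNReal.ofReal_lt_one.2 hx)
  have e : (1 - (0 + x)) ^ (1 / 2 : ℂ) = Complex.sqrt (1 - x) := by simp [Complex.sqrt]
  rw [e] at h
  refine h.congr_fun ?_
  intro n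
  simp [← Ring.multichoose_eq, ← multichoose_half, mul_comm]

theorem periodCoeff_eq (n : ℕ) : periodCoeff n = Real.pi * (halfCoeff n : ℂ) ^ 2 := by
  induction n with
  | zero =>
    have hp : (Real.pi : ℂ) ≠ 0 := Complex.ofReal_ne_zero.2 Real.pi_ne_zero
    have : ((Real.pi : ℂ) ^ (1 / 2 : ℂ)) ^ 2 = Real.pi := by
      rw [one_div]; exact sqrt_sq _
    unfold periodCoeff
    rw [Nat.cast_zero, zero_add, zero_add, Complex.Gamma_one_half_eq, this, halfCoeff_zero]
    simp
  | succ n ih =>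
    have h1 : ((n : ℂ) + 1 / 2) ≠ 0 := by
      intro h
      have := congrArg Complex.re h
      simp at this
      have h0 : (0 : ℝ) ≤ n := n.cast_nonneg
      linarith
    have h2 : ((n : ℂ) + 1) ≠ 0 := Nat.cast_add_one_ne_zero n
    have e1 : Complex.Gamma (((n + 1 : ℕ) : ℂ) + 1 / 2) = (n + 1 / 2) * Complex.Gamma (n + 1 / 2) := by
      rw [← Complex.Gamma_add_one _ h1]; congr 1; push_cast; ring
    have e2 : Complex.Gamma (((n + 1 : ℕ) : ℂ) + 1) = (n + 1) * Complex.Gamma (n + 1) := by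
      rw [← Complex.Gamma_add_one _ h2]; congr 1; push_cast; ring
    have e3 : periodCoeff (n + 1) = (((n : ℂ) + 1 / 2) / (n + 1)) ^ 2 * periodCoeff n := by
      unfold periodCoeff
      rw [e1, e2, mul_pow, mul_pow, div_pow]
      rw [mul_div_mul_comm]
    rw [e3, ih, halfCoeff_succ]
    push_cast
    have h3 : (2 * (n : ℂ) + 2) ≠ 0 := by
      rw [show 2 * (n : ℂ) + 2 = 2 * (n + 1) by ring]; exact mul_ne_zero two_ne_zero h2
    field_simp

theorem integral_sin_pow_coeff (n : ℕ) :
    ∫ t in (0 : ℝ)..Real.pi, ((Real.sin t : ℂ) ^ 2) ^ n = Real.pi * halfCoeff n := by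
  have h := integral_sin_pow_even (n := n)
  have e : ∀ t : ℝ, ((Real.sin t : ℂ) ^ 2) ^ n = ((Real.sin t ^ (2 * n) : ℝ) : ℂ) := by
    intro t; push_cast; rw [pow_mul]
  simp only [e]
  rw [intervalIntegral.integral_ofReal, h, halfCoeff]
  push_cast
  rfl

/-- The binomial series of `1 / Δ` is integrated term by term. One factor `halfCoeff n` is the
binomial coefficient, the other comes from Wallis' integral of `sin ^ (2n)`. -/
theorem hasSum_ellH {μ : ℂ} (hμ : ‖μ‖ < 1) :
    HasSum (fun n => periodCoeff n * μ ^ n) (ellH μ) := by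
  have hs : ∀ t : ℝ, ‖(Real.sin t : ℂ) ^ 2‖ ≤ 1 := by
    intro t
    rw [norm_pow, Complex.norm_real, Real.norm_eq_abs, sq_abs]
    exact Real.sin_sq_le_one t
  have hlt : ∀ t : ℝ, ‖μ * (Real.sin t : ℂ) ^ 2‖ ≤ ‖μ‖ := by
    intro t
    rw [norm_mul]
    exact mul_le_of_le_one_right (norm_nonneg _) (hs t)
  have key := intervalIntegral.hasSum_integral_of_dominated_convergence (μ := volume) (a := 0)
    (b := Real.pi)
    (F := fun (n : ℕ) (t : ℝ) => (halfCoeff n : ℂ) * (μ * (Real.sin t : ℂ) ^ 2) ^ n)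
    (f := fun t => 1 / del μ t) (fun n _ => ‖μ‖ ^ n)
    (fun n => Continuous.aestronglyMeasurable (by fun_prop))
    (fun n => Eventually.of_forall fun t _ => ?_)
    (Eventually.of_forall fun t _ => summable_geometric_of_lt_one (norm_nonneg _) hμ)
    intervalIntegrable_const
    (Eventually.of_forall fun t _ => hasSum_inv_sqrt ((hlt t).trans_lt hμ))
  · refine key.congr_fun fun n => ?_
    simp only [mul_pow _ _ n]
    rw [intervalIntegral.integral_const_mul, intervalIntegral.integral_const_mul,
      integral_sin_pow_coeff, periodCoeff_eq]
    ring
  · rw [norm_mul, norm_pow, Complex.norm_real, Real.norm_eq_abs, abs_of_pos (halfCoeff_pos n)]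
    calc halfCoeff n * ‖μ * (Real.sin t : ℂ) ^ 2‖ ^ n ≤ 1 * ‖μ‖ ^ n := by
          gcongr
          · exact halfCoeff_le_one n
          · exact hlt t
      _ = ‖μ‖ ^ n := one_mul _

theorem periodSeries_eq_ellH {μ : ℂ} (hμ : ‖μ‖ < 1) : periodSeries μ = ellH μ :=
  (hasSum_ellH hμ).tsum_eq

theorem hasSum_periodSeries {μ : ℂ} (hμ : ‖μ‖ < 1) :
    HasSum (fun n => periodCoeff n * μ ^ n) (periodSeries μ) := by
  rw [periodSeries_eq_ellH hμ]; exact hasSum_ellH hμ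

theorem solvesPeriodODE_of_hasDerivAt {F F₁ F₂ : ℂ → ℂ} {U : Set ℂ} (hU : IsOpen U)
    (h1 : ∀ m ∈ U, HasDerivAt F (F₁ m) m) (h2 : ∀ m ∈ U, HasDerivAt F₁ (F₂ m) m)
    (h : ∀ m ∈ U, m * (1 - m) * F₂ m + (1 - 2 * m) * F₁ m - 1 / 4 * F m = 0) :
    SolvesPeriodODE F U := by
  refine ⟨fun m hm => (h1 m hm).differentiableAt.differentiableWithinAt, fun m hm => ?_⟩
  have e : deriv F =ᶠ[𝓝 m] F₁ := by
    filter_upwards [hU.mem_nhds hm] with x hx using (h1 x hx).deriv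
  rw [e.deriv_eq, (h2 m hm).deriv, (h1 m hm).deriv, h m hm]

theorem solvesPeriodODE_two_mul_periodSeries :
    SolvesPeriodODE (fun m => 2 * periodSeries m) (Metric.ball 0 1) := by
  refine solvesPeriodODE_of_hasDerivAt (F₁ := fun m => 2 * ellH₁ m) (F₂ := fun m => 2 * ellH₂ m)
    Metric.isOpen_ball (fun m hm => ?_) (fun m hm => ?_) (fun m hm => ?_)
  · refine ((hasDerivAt_ellH (ball_subset_slitDomain hm)).const_mul 2).congr_of_eventuallyEq ?_
    filter_upwards [Metric.isOpen_ball.mem_nhds hm] with x hx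
    rw [periodSeries_eq_ellH (mem_ball_zero_iff.1 hx)]
  · exact (hasDerivAt_ellH₁ (ball_subset_slitDomain hm)).const_mul 2
  · have := ellH_ode (ball_subset_slitDomain hm)
    rw [periodSeries_eq_ellH (mem_ball_zero_iff.1 hm)]
    linear_combination 2 * this

end Series

end JacobiElliptic


namespace JacobiElliptic
open Set Filter Topology MeasureTheory ComplexConjugate

/-! ### The Wronskian of `ellH m` and `ellH (1 - m)`. -/

section Wronskian

open Complex (slitPlane)

/-- The two sides differ by the integral of the derivative of `-sin t cos t / Δ`. It expresses the
quasi-period of `ellH` through `ellH` and its derivative. -/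
theorem integral_sin_sq_div_del {μ : ℂ} (hμ : μ ∈ slitDomain) :
    ∫ t in (0 : ℝ)..Real.pi, (Real.sin t : ℂ) ^ 2 / del μ t =
      ellH μ - 2 * (1 - μ) * ellH₁ μ := by
  have hd : ∀ t : ℝ, HasDerivAt (fun t => -((Real.sin t : ℂ) * Real.cos t / del μ t))
      ((Real.sin t : ℂ) ^ 2 / del μ t - (1 / del μ t -
        2 * (1 - μ) * ((Real.sin t : ℂ) ^ 2 / (2 * del μ t ^ 3)))) t := by
    intro t
    have h0 := del_ne_zero hμ t
    refine (((hasDerivAt_ofReal_sin t).mul (hasDerivAt_ofReal_cos t)).div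
      (hasDerivAt_del hμ t) h0).neg.congr_deriv ?_
    simp only [Pi.mul_apply]
    have h2 := del_sq μ t
    have hc := ofReal_cos_sq t
    generalize del μ t = d at *
    generalize (Real.sin t : ℂ) = s at *
    generalize (Real.cos t : ℂ) = c at *
    field_simp
    rw [h2, hc]
    ring
  have i0 : IntervalIntegrable (fun t => 1 / del μ t) volume 0 Real.pi :=
    (continuous_const.div (continuous_del hμ) (del_ne_zero hμ)).intervalIntegrable _ _
  have i1 := (continuous_div_del hμ (f := fun t => (Real.sin t : ℂ) ^ 2) (by fun_prop) 2
    two_ne_zero 3).intervalIntegrable (μ := volume) 0 Real.pi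
  have i2 : IntervalIntegrable (fun t => (Real.sin t : ℂ) ^ 2 / del μ t) volume 0 Real.pi :=
    (Continuous.div (by fun_prop) (continuous_del hμ) (del_ne_zero hμ)).intervalIntegrable _ _
  have key := intervalIntegral.integral_eq_sub_of_hasDerivAt (a := 0) (b := Real.pi)
    (fun t _ => hd t) (i2.sub (i0.sub (i1.const_mul _)))
  rw [intervalIntegral.integral_sub i2 (i0.sub (i1.const_mul _)),
    intervalIntegral.integral_sub i0 (i1.const_mul _), intervalIntegral.integral_const_mul] at key
  simp only [Real.sin_pi, Real.sin_zero, Complex.ofReal_zero, zero_mul, zero_div, sub_zero,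
    neg_zero] at key
  exact sub_eq_zero.1 key

theorem integral_del {μ : ℂ} (hμ : μ ∈ slitDomain) :
    ∫ t in (0 : ℝ)..Real.pi, del μ t = (1 - μ) * ellH μ + 2 * μ * (1 - μ) * ellH₁ μ := by
  have i0 : IntervalIntegrable (fun t => 1 / del μ t) volume 0 Real.pi :=
    (continuous_const.div (continuous_del hμ) (del_ne_zero hμ)).intervalIntegrable _ _
  have i2 : IntervalIntegrable (fun t => (Real.sin t : ℂ) ^ 2 / del μ t) volume 0 Real.pi :=
    (Continuous.div (by fun_prop) (continuous_del hμ) (del_ne_zero hμ)).intervalIntegrable _ _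
  have e : ∀ t : ℝ, del μ t = 1 / del μ t - μ * ((Real.sin t : ℂ) ^ 2 / del μ t) := by
    intro t
    have h0 := del_ne_zero hμ t
    have h2 := del_sq μ t
    field_simp
    exact h2
  rw [intervalIntegral.integral_congr (fun t _ => e t),
    intervalIntegral.integral_sub i0 (i2.const_mul _), intervalIntegral.integral_const_mul,
    integral_sin_sq_div_del hμ]
  change ellH μ - _ = _
  ring

theorem one_sub_ofReal_mem {y : ℝ} (hy : 0 < y) : (1 : ℂ) - y ∈ slitDomain := by
  refine Or.inl ?_
  simpa using hy

theorem del_one_sub_ofReal {y : ℝ} (hy : 0 ≤ y) (t : ℝ) :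
    del (1 - y) t = (√(Real.cos t ^ 2 + y * Real.sin t ^ 2) : ℝ) := by
  have e : (1 : ℂ) - (1 - y) * (Real.sin t : ℂ) ^ 2 =
      ((Real.cos t ^ 2 + y * Real.sin t ^ 2 : ℝ) : ℂ) := by
    push_cast
    have := ofReal_cos_sq t
    push_cast at this
    rw [this]; ring
  have h0 : 0 ≤ Real.cos t ^ 2 + y * Real.sin t ^ 2 := by positivity
  rw [del, e, Complex.sqrt_of_nonneg (by exact_mod_cast h0), Complex.ofReal_re]

theorem integral_abs_cos : ∫ t in (0 : ℝ)..Real.pi, |Real.cos t| = 2 := by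
  have hp := Real.pi_pos
  have hi : ∀ a b : ℝ, IntervalIntegrable (fun t => |Real.cos t|) volume a b := fun a b =>
    Real.continuous_cos.abs.intervalIntegrable a b
  rw [← intervalIntegral.integral_add_adjacent_intervals (hi 0 (Real.pi / 2)) (hi _ _),
    intervalIntegral.integral_congr (g := Real.cos) (a := 0) fun t ht => ?_,
    intervalIntegral.integral_congr (g := fun t => -Real.cos t) (a := Real.pi / 2) fun t ht => ?_]
  · simp
    norm_num
  · rw [uIcc_of_le (by linarith)] at ht
    exact abs_of_nonpos (Real.cos_nonpos_of_pi_div_two_le_of_le ht.1 (by linarith [ht.2]))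
  · rw [uIcc_of_le (by linarith)] at ht
    exact abs_of_nonneg (Real.cos_nonneg_of_mem_Icc ⟨by linarith [ht.1], ht.2⟩)

theorem tendsto_integral_del :
    Tendsto (fun y : ℝ => ∫ t in (0 : ℝ)..Real.pi, del (1 - y) t) (𝓝[>] 0) (𝓝 2) := by
  have h := continuousAt_integral_param (X := ℝ) isOpen_univ (a := 0) (b := Real.pi)
    (F := fun y t => ((√(Real.cos t ^ 2 + y * Real.sin t ^ 2) : ℝ) : ℂ))
    (Continuous.continuousOn (by fun_prop)) (mem_univ (0 : ℝ))
  have e0 : ∫ t in (0 : ℝ)..Real.pi, ((√(Real.cos t ^ 2 + 0 * Real.sin t ^ 2) : ℝ) : ℂ) = 2 := by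
    simp only [zero_mul, add_zero, Real.sqrt_sq_eq_abs]
    rw [intervalIntegral.integral_ofReal, integral_abs_cos]
    norm_num
  unfold ContinuousAt at h
  beta_reduce at h
  rw [e0] at h
  refine (h.mono_left nhdsWithin_le_nhds).congr' ?_
  filter_upwards [self_mem_nhdsWithin] with y hy
  exact intervalIntegral.integral_congr fun t _ => (del_one_sub_ofReal (le_of_lt hy) t).symm

/-- For `0 < y ≤ 1`, `cos² + y sin² ≥ y` bounds `ellH (1 - y)` by `π / √y`. -/
theorem tendsto_mul_ellH :
    Tendsto (fun y : ℝ => (y : ℂ) * ellH (1 - y)) (𝓝[>] 0) (𝓝 0) := by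
  have hb : ∀ᶠ y : ℝ in 𝓝[>] 0, ‖(y : ℂ) * ellH (1 - y)‖ ≤ √y * Real.pi := by
    filter_upwards [Ioc_mem_nhdsGT (zero_lt_one' ℝ)] with y hy
    have hs : 0 < √y := Real.sqrt_pos.2 hy.1
    have h1 : ‖ellH (1 - y)‖ ≤ 1 / √y * |Real.pi - 0| := by
      refine intervalIntegral.norm_integral_le_of_norm_le_const fun t _ => ?_
      rw [norm_div, norm_one, del_one_sub_ofReal hy.1.le, Complex.norm_real, Real.norm_eq_abs,
        abs_of_nonneg (Real.sqrt_nonneg _)]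
      refine one_div_le_one_div_of_le hs (Real.sqrt_le_sqrt ?_)
      nlinarith [Real.sin_sq_add_cos_sq t, sq_nonneg (Real.cos t), hy.2]
    rw [sub_zero, abs_of_pos Real.pi_pos] at h1
    rw [norm_mul, Complex.norm_real, Real.norm_eq_abs, abs_of_pos hy.1]
    calc y * ‖ellH (1 - y)‖ ≤ y * (1 / √y * Real.pi) := by gcongr; exact hy.1.le
      _ = √y * Real.pi := by
        have := Real.sq_sqrt hy.1.le
        field_simp
        rw [this]
  refine squeeze_zero_norm' hb ?_
  have : Tendsto (fun y : ℝ => √y * Real.pi) (𝓝 0) (𝓝 (√0 * Real.pi)) :=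
    (Continuous.tendsto (by fun_prop) 0)
  rw [Real.sqrt_zero, zero_mul] at this
  exact this.mono_left nhdsWithin_le_nhds

theorem ellH_zero : ellH 0 = Real.pi := by
  simp [ellH, del]

/-- The Wronskian of `ellH m` and `ellH (1 - m)`, normalised to be constant. -/
noncomputable def ellWronskian (m : ℂ) : ℂ :=
  m * (1 - m) * (ellH m * ellH₁ (1 - m) + ellH₁ m * ellH (1 - m))

theorem one_sub_mem_slitDomain {m : ℂ} (hm : m ∈ slitPlane) : 1 - m ∈ slitDomain := by
  change 1 - (1 - m) ∈ slitPlane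
  rwa [sub_sub_cancel]

theorem hasDerivAt_ellH_one_sub {m : ℂ} (hm : m ∈ slitPlane) :
    HasDerivAt (fun m => ellH (1 - m)) (-ellH₁ (1 - m)) m := by
  have := (hasDerivAt_ellH (one_sub_mem_slitDomain hm)).comp m ((hasDerivAt_id m).const_sub 1)
  exact this.congr_deriv (by ring)

theorem hasDerivAt_ellH₁_one_sub {m : ℂ} (hm : m ∈ slitPlane) :
    HasDerivAt (fun m => ellH₁ (1 - m)) (-ellH₂ (1 - m)) m := by
  have := (hasDerivAt_ellH₁ (one_sub_mem_slitDomain hm)).comp m ((hasDerivAt_id m).const_sub 1)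
  exact this.congr_deriv (by ring)

/-- Abel's identity: the hypergeometric equation is invariant under `m ↦ 1 - m`, and `m (1 - m)` is
its integrating factor. -/
theorem hasDerivAt_ellWronskian {m : ℂ} (h1 : m ∈ slitDomain) (h2 : m ∈ slitPlane) :
    HasDerivAt ellWronskian 0 m := by
  have d1 := hasDerivAt_ellH h1
  have d2 := hasDerivAt_ellH₁ h1
  have d3 := hasDerivAt_ellH_one_sub h2
  have d4 := hasDerivAt_ellH₁_one_sub h2
  have d5 := (hasDerivAt_id m).mul ((hasDerivAt_id m).const_sub 1)
  refine (d5.mul ((d1.mul d4).add (d2.mul d3))).congr_deriv ?_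
  have o1 := ellH_ode h1
  have o2 := ellH_ode (one_sub_mem_slitDomain h2)
  simp only [Pi.mul_apply, Pi.add_apply, id]
  linear_combination ellH (1 - m) * o1 - ellH m * o2

theorem starConvex_slitPlane_half : StarConvex ℝ ((1 : ℂ) / 2) slitPlane := by
  exact Complex.starConvex_slitPlane (by norm_num [Complex.lt_def])

theorem starConvex_slitDomain_half : StarConvex ℝ ((1 : ℂ) / 2) slitDomain := by
  intro z hz a b ha hb hab
  have := starConvex_slitPlane_half hz ha hb hab
  change 1 - _ ∈ slitPlane
  convert this using 1
  have : (a : ℂ) + b = 1 := by exact_mod_cast hab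
  simp only [Complex.real_smul]
  linear_combination (-1 : ℂ) * this

theorem half_mem_slitPlane : (1 : ℂ) / 2 ∈ slitPlane := Or.inl (by norm_num)

theorem half_mem_slitDomain : (1 : ℂ) / 2 ∈ slitDomain := by
  have := one_sub_mem_slitDomain half_mem_slitPlane
  norm_num at this ⊢
  exact this

theorem ellWronskian_eq {m : ℂ} (h1 : m ∈ slitDomain) (h2 : m ∈ slitPlane) :
    ellWronskian m = Real.pi := by
  have hconn : IsPreconnected (slitDomain ∩ slitPlane) :=
    ((starConvex_slitDomain_half.inter starConvex_slitPlane_half).isPathConnected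
      ⟨half_mem_slitDomain, half_mem_slitPlane⟩).isConnected.isPreconnected
  have hconst : ∀ y ∈ slitDomain ∩ slitPlane, ellWronskian y = ellWronskian m := fun y hy =>
    IsOpen.is_const_of_deriv_eq_zero (isOpen_slitDomain.inter Complex.isOpen_slitPlane) hconn
      (fun z hz => (hasDerivAt_ellWronskian hz.1 hz.2).differentiableAt.differentiableWithinAt)
      (fun z hz => (hasDerivAt_ellWronskian hz.1 hz.2).deriv) hy ⟨h1, h2⟩
  have c0 : Tendsto (fun y : ℝ => (y : ℂ)) (𝓝[>] 0) (𝓝 0) :=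
    (Complex.continuous_ofReal.tendsto 0).mono_left nhdsWithin_le_nhds
  have h0 : (0 : ℂ) ∈ slitDomain := ball_subset_slitDomain (by simp)
  have t1 : Tendsto (fun y : ℝ => ellH y) (𝓝[>] 0) (𝓝 (ellH 0)) :=
    (hasDerivAt_ellH h0).continuousAt.tendsto.comp c0
  have t2 : Tendsto (fun y : ℝ => ellH₁ y) (𝓝[>] 0) (𝓝 (ellH₁ 0)) :=
    (hasDerivAt_ellH₁ h0).continuousAt.tendsto.comp c0
  have t3 := tendsto_mul_ellH
  have t4 := tendsto_integral_del
  -- By `integral_del`, `y (1 - y) ellH₁ (1 - y)` is half of `∫ Δ - y ellH (1 - y)`. In this form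
  -- every factor has a limit at `0+`, and the total is `ellH 0 = π`.
  have t5 : Tendsto (fun y : ℝ => ellH y * (1 / 2 * ((∫ t in (0 : ℝ)..Real.pi, del (1 - y) t)
      - (y : ℂ) * ellH (1 - y))) + (1 - (y : ℂ)) * (ellH₁ y * ((y : ℂ) * ellH (1 - y)))) (𝓝[>] 0)
      (𝓝 (ellH 0 * (1 / 2 * (2 - 0)) + (1 - 0) * (ellH₁ 0 * 0))) :=
    (t1.mul ((t4.sub t3).const_mul _)).add ((c0.const_sub 1).mul (t2.mul t3))
  have t6 : (fun y : ℝ => ellH y * (1 / 2 * ((∫ t in (0 : ℝ)..Real.pi, del (1 - y) t)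
      - (y : ℂ) * ellH (1 - y))) + (1 - (y : ℂ)) * (ellH₁ y * ((y : ℂ) * ellH (1 - y))))
      =ᶠ[𝓝[>] 0] fun _ => ellWronskian m := by
    filter_upwards [Ioo_mem_nhdsGT (zero_lt_one' ℝ)] with y hy
    have m1 : (y : ℂ) ∈ slitPlane := Or.inl (by simpa using hy.1)
    have m2 : (y : ℂ) ∈ slitDomain := Or.inl (by simpa using hy.2)
    rw [← hconst y ⟨m2, m1⟩, integral_del (one_sub_ofReal_mem hy.1)]
    unfold ellWronskian
    ring
  have := tendsto_nhds_unique (t5.congr' t6) tendsto_const_nhds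
  rw [← this, ellH_zero]
  ring

end Wronskian

end JacobiElliptic


namespace JacobiElliptic
open Set Filter Topology MeasureTheory ComplexConjugate

/-! ### Analytic continuation of the second period. -/

section SecondPeriod

open Complex (slitPlane I)
open Metric (ball)

theorem ellH_ne_zero {μ : ℂ} (hμ : μ ∈ slitDomain) : ellH μ ≠ 0 := fun h => by
  have := ellH_re_pos hμ
  rw [h] at this
  exact lt_irrefl _ this

theorem starConvex_cut_disc :
    StarConvex ℝ ((1 : ℂ) / 2) (ball (0 : ℂ) 1 ∩ slitPlane) :=
  ((convex_ball 0 1).starConvex (by simp; norm_num)).inter starConvex_slitPlane_half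

theorem half_mem_cut_disc : (1 : ℂ) / 2 ∈ ball (0 : ℂ) 1 ∩ slitPlane :=
  ⟨by simp; norm_num, half_mem_slitPlane⟩

theorem hasDerivAt_ellH_quotient {m : ℂ} (h1 : m ∈ ball (0 : ℂ) 1) (h2 : m ∈ slitPlane) :
    HasDerivAt (fun m => I * ellH (1 - m) / ellH m)
      (-I * Real.pi / ((1 - m) * ellH m ^ 2) / m) m := by
  have h1' := ball_subset_slitDomain h1
  have hne := ellH_ne_zero h1'
  refine (((hasDerivAt_ellH_one_sub h2).const_mul I).div (hasDerivAt_ellH h1') hne).congr_deriv ?_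
  have w := ellWronskian_eq h1' h2
  have m0 := Complex.slitPlane_ne_zero h2
  have m1 : 1 - m ≠ 0 := Complex.slitPlane_ne_zero h1'
  unfold ellWronskian at w
  rw [← w]
  field_simp
  ring

/-- There is a function of the logarithm that continues `i h (1 - m)` analytically. -/
theorem exists_secondPeriod : ∃ P : ℂ → ℂ, DifferentiableOn ℂ P {w : ℂ | w.re < 0} ∧
    (∀ w : ℂ, P (w + 2 * Real.pi * I) = P w + 2 * ellH (Complex.exp w)) ∧
    ∀ m ∈ ball (0 : ℂ) 1 ∩ slitPlane, P (Complex.log m) = I * ellH (1 - m) := by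
  have hpi : (Real.pi : ℂ) ≠ 0 := Complex.ofReal_ne_zero.2 Real.pi_ne_zero
  set g : ℂ → ℂ := fun m => -I * Real.pi / ((1 - m) * ellH m ^ 2) with hg
  have dH : DifferentiableOn ℂ ellH (ball 0 1) := fun m hm =>
    (hasDerivAt_ellH (ball_subset_slitDomain hm)).differentiableAt.differentiableWithinAt
  have dg : DifferentiableOn ℂ g (ball 0 1) := by
    refine DifferentiableOn.div (by fun_prop) (DifferentiableOn.mul (by fun_prop) (dH.pow 2)) ?_
    intro m hm
    exact mul_ne_zero (Complex.slitPlane_ne_zero (ball_subset_slitDomain hm))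
      (pow_ne_zero 2 (ellH_ne_zero (ball_subset_slitDomain hm)))
  have h0mem : (0 : ℂ) ∈ ball (0 : ℂ) 1 := by simp
  have g0 : g 0 = 1 / (Real.pi * I) := by
    rw [hg]; beta_reduce
    rw [ellH_zero, sub_zero, one_mul]
    field_simp
    rw [Complex.I_sq]; ring
  have ds : DifferentiableOn ℂ (dslope g 0) (ball 0 1) :=
    (Complex.differentiableOn_dslope (Metric.isOpen_ball.mem_nhds h0mem)).2 dg
  obtain ⟨φ, -, hφ⟩ := ds.isExactOn_ball.with_val_at 0 0
  set R : ℂ → ℂ := fun m => I * ellH (1 - m) / ellH m - Complex.log m / (Real.pi * I) - φ m with hR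
  have dR : ∀ m ∈ ball (0 : ℂ) 1 ∩ slitPlane, HasDerivAt R 0 m := by
    rintro m ⟨h1, h2⟩
    have m0 := Complex.slitPlane_ne_zero h2
    refine (((hasDerivAt_ellH_quotient h1 h2).sub
      ((Complex.hasDerivAt_log h2).div_const (Real.pi * I))).sub (hφ m h1)).congr_deriv ?_
    rw [dslope_of_ne _ m0, slope_def_field, g0, hg]
    field_simp
    ring
  set C := R (1 / 2) with hC
  have hRC : ∀ m ∈ ball (0 : ℂ) 1 ∩ slitPlane, R m = C := fun m hm =>
    IsOpen.is_const_of_deriv_eq_zero (Metric.isOpen_ball.inter Complex.isOpen_slitPlane)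
      (starConvex_cut_disc.isPathConnected half_mem_cut_disc).isConnected.isPreconnected
      (fun z hz => (dR z hz).differentiableAt.differentiableWithinAt)
      (fun z hz => (dR z hz).deriv) hm half_mem_cut_disc
  have hexp : MapsTo Complex.exp {w : ℂ | w.re < 0} (ball 0 1) := by
    intro w hw
    rw [mem_ball_zero_iff, Complex.norm_exp]
    exact (Real.exp_lt_exp.2 hw).trans_eq Real.exp_zero
  -- Only the term `w / (πi)` changes under `w ↦ w + 2πi`, by `2`.
  refine ⟨fun w => ellH (Complex.exp w) * (C + w / (Real.pi * I) + φ (Complex.exp w)), ?_, ?_, ?_⟩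
  · have dφ : DifferentiableOn ℂ φ (ball 0 1) := fun m hm =>
      (hφ m hm).differentiableAt.differentiableWithinAt
    have e1 : DifferentiableOn ℂ (fun w => φ (Complex.exp w)) {w : ℂ | w.re < 0} :=
      dφ.comp Complex.differentiable_exp.differentiableOn hexp
    have e2 : DifferentiableOn ℂ (fun w => ellH (Complex.exp w)) {w : ℂ | w.re < 0} :=
      dH.comp Complex.differentiable_exp.differentiableOn hexp
    exact e2.mul (DifferentiableOn.add (by fun_prop) e1)
  · intro w
    beta_reduce
    rw [Complex.exp_periodic w]
    have := Complex.I_ne_zero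
    field_simp
    ring
  · rintro m hm
    have m0 := Complex.slitPlane_ne_zero hm.2
    have hne := ellH_ne_zero (ball_subset_slitDomain hm.1)
    have := hRC m hm
    beta_reduce
    rw [Complex.exp_log m0, ← this, hR]
    field_simp
    ring

theorem solvesPeriodODE_secondPeriod {P : ℂ → ℂ}
    (hP : ∀ m ∈ ball (0 : ℂ) 1 ∩ slitPlane, P (Complex.log m) = I * ellH (1 - m)) :
    SolvesPeriodODE (fun m => P (Complex.log m)) (ball 0 1 ∩ slitPlane) := by
  have hopen := (Metric.isOpen_ball (x := (0 : ℂ)) (ε := 1)).inter Complex.isOpen_slitPlane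
  refine solvesPeriodODE_of_hasDerivAt (F₁ := fun m => I * -ellH₁ (1 - m))
    (F₂ := fun m => I * ellH₂ (1 - m)) hopen (fun m hm => ?_) (fun m hm => ?_) (fun m hm => ?_)
  · refine ((hasDerivAt_ellH_one_sub hm.2).const_mul I).congr_of_eventuallyEq ?_
    filter_upwards [hopen.mem_nhds hm] with x hx using hP x hx
  · exact ((hasDerivAt_ellH₁_one_sub hm.2).neg.const_mul I).congr_deriv (by ring)
  · have := ellH_ode (one_sub_mem_slitDomain hm.2)
    rw [hP m hm]
    linear_combination I * this

end SecondPeriod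

end JacobiElliptic


namespace JacobiElliptic
open Set Filter Topology MeasureTheory ComplexConjugate

/-! ### Two explicit paths on the curve and their Legendre relation. -/

section Paths

open Complex (slitPlane I)

variable {m : ℂ} {S N : ℂ → ℂ}

theorem continuous_one_div_del {μ : ℂ} (hμ : μ ∈ slitDomain) : Continuous fun t => 1 / del μ t :=
  continuous_const.div (continuous_del hμ) (del_ne_zero hμ)

/-- The path `u = sin t`, `v = cos t Δ` passes the branch point `u = 1` at `t = π/2`, where `v = 0`.
The velocity `1 / Δ` stays regular there, which is why lifting is done for the pair `(u, v)`. It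
ends at `(0, -1)`. -/
theorem SnPair.lift_sin (h : SnPair m S N) (hm : m ∈ slitDomain) :
    ∀ t ∈ Icc 0 Real.pi, N (liftPath 0 (fun t => 1 / del m t) t) ≠ 0 ∧
      quo S N (liftPath 0 (fun t => 1 / del m t) t) = Real.sin t ∧
      quoD S N (liftPath 0 (fun t => 1 / del m t) t) = Real.cos t * del m t := by
  refine h.lift (u := fun t => (Real.sin t : ℂ)) (v := fun t => Real.cos t * del m t)
    (continuous_one_div_del hm) (by fun_prop) (Continuous.continuousOn ?_) ?_ ?_ ?_ ?_ ?_
  · have := continuous_del hm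
    fun_prop
  · intro t _
    have h0 := del_ne_zero hm t
    refine ((hasDerivAt_ofReal_sin t).congr_deriv ?_).hasDerivWithinAt
    field_simp
  · intro t _
    have h0 := del_ne_zero hm t
    refine (((hasDerivAt_ofReal_cos t).mul (hasDerivAt_del hm t)).congr_deriv ?_).hasDerivWithinAt
    have h2 := del_sq m t
    have hc := ofReal_cos_sq t
    unfold snAccel
    generalize del m t = d at *
    generalize (Real.sin t : ℂ) = s at *
    generalize (Real.cos t : ℂ) = c at *
    field_simp
    rw [h2, hc]
    ring
  · rw [h.N_zero]; exact one_ne_zero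
  · simp [h.quo_zero]
  · simp [h.quoD_zero, del]

theorem liftPath_ellH : liftPath 0 (fun t => 1 / del m t) Real.pi = ellH m := by
  rw [liftPath, zero_add, ellH]

theorem SnPair.signPeriod_ellH (h : SnPair m S N) (hm : m ∈ slitDomain) :
    SignPeriod S N (-1) (ellH m) := by
  obtain ⟨h0, h1, h2⟩ := h.lift_sin hm Real.pi ⟨Real.pi_pos.le, le_rfl⟩
  rw [liftPath_ellH] at h0 h1 h2
  rw [Real.sin_pi, Complex.ofReal_zero, quo, div_eq_zero_iff] at h1
  obtain ⟨σ, -, h4, h5⟩ := h.exists_signPeriod (h1.resolve_right h0)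
  rw [h4] at h2
  have : σ = -1 := by rw [h2]; simp [del]
  rwa [this] at h5

theorem SnPair.eta_ellH (h : SnPair m S N) (hm : m ∈ slitDomain) (ω : h.zeros)
    (hω : (ω : ℂ) = ellH m) : h.eta ω = m * (ellH m - 2 * (1 - m) * ellH₁ m) := by
  have := h.eta_eq_integral Real.pi_pos.le (continuous_one_div_del hm)
    (u := fun t => (Real.sin t : ℂ)) (z₀ := 0) (by fun_prop)
    (fun t ht => ⟨(h.lift_sin hm t ht).1, (h.lift_sin hm t ht).2.1⟩) ω hω
  rw [this, ← integral_sin_sq_div_del hm, ← intervalIntegral.integral_const_mul]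
  refine intervalIntegral.integral_congr fun t _ => ?_
  ring

/-- The period obtained by integrating along the path `u = √(cos² + e sin²) / √(cos² + m e sin²)`. -/
noncomputable def twistPeriod (m e : ℂ) : ℂ :=
  ∫ t in (0 : ℝ)..Real.pi, I * e.sqrt / (del (1 - e) t * del (1 - m * e) t)

/-- The integral of `m u² dz` along the path that defines `twistPeriod`. -/
noncomputable def twistQuasiPeriod (m e : ℂ) : ℂ :=
  ∫ t in (0 : ℝ)..Real.pi, I * e.sqrt * m * del (1 - e) t / del (1 - m * e) t ^ 3

/-- In terms of `τ = tan² t` the path is `u² = (1 + eτ) / (1 + meτ)`, so `e` is the direction of a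
ray. Both `e` and `me` must avoid the negative axis to keep numerator and denominator nonzero. For
`e = 1` this is the classical path for `i ellH (1 - m)`; other `e` serve negative `m`. -/
theorem SnPair.lift_twist (h : SnPair m S N) {e z₀ : ℂ} (he : e ∈ slitPlane)
    (hme : m * e ∈ slitPlane) (h0 : N z₀ ≠ 0) (h1 : quo S N z₀ = 1) (h2 : quoD S N z₀ = 0) :
    ∀ t ∈ Icc 0 Real.pi,
      N (liftPath z₀ (fun t => I * e.sqrt / (del (1 - e) t * del (1 - m * e) t)) t) ≠ 0 ∧
      quo S N (liftPath z₀ (fun t => I * e.sqrt / (del (1 - e) t * del (1 - m * e) t)) t) =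
        del (1 - e) t / del (1 - m * e) t ∧
      quoD S N (liftPath z₀ (fun t => I * e.sqrt / (del (1 - e) t * del (1 - m * e) t)) t) =
        -I * e.sqrt * (1 - m) * Real.sin t * Real.cos t / del (1 - m * e) t ^ 2 := by
  have he' := one_sub_mem_slitDomain he
  have hme' := one_sub_mem_slitDomain hme
  have ca := continuous_del he'
  have cb := continuous_del hme'
  refine h.lift (u := fun t => del (1 - e) t / del (1 - m * e) t)
    (v := fun t => -I * e.sqrt * (1 - m) * Real.sin t * Real.cos t / del (1 - m * e) t ^ 2)
    ?_ ?_ ?_ ?_ ?_ h0 ?_ ?_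
  · exact continuous_const.div (ca.mul cb)
      fun t => mul_ne_zero (del_ne_zero he' t) (del_ne_zero hme' t)
  · exact (ca.div cb (del_ne_zero hme')).continuousOn
  · exact (Continuous.div (by fun_prop) (cb.pow 2)
      fun t => pow_ne_zero 2 (del_ne_zero hme' t)).continuousOn
  · intro t _
    have a0 := del_ne_zero he' t
    have b0 := del_ne_zero hme' t
    refine (((hasDerivAt_del he' t).div (hasDerivAt_del hme' t) b0).congr_deriv
      ?_).hasDerivWithinAt
    have a2 := del_sq (1 - e) t
    have b2 := del_sq (1 - m * e) t
    have e2 := sqrt_sq e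
    generalize del (1 - e) t = a at *
    generalize del (1 - m * e) t = b at *
    generalize (Real.sin t : ℂ) = s at *
    generalize (Real.cos t : ℂ) = c at *
    generalize e.sqrt = r at *
    have : a ^ 2 * (1 - m * e) - (1 - e) * b ^ 2 = e * (1 - m) := by rw [a2, b2]; ring
    field_simp
    rw [Complex.I_sq]
    linear_combination (s * c) * this - (s * c * (1 - m)) * e2
  · intro t _
    have a0 := del_ne_zero he' t
    have b0 := del_ne_zero hme' t
    have hd := ((((hasDerivAt_ofReal_sin t).const_mul (-I * e.sqrt * (1 - m))).mul
      (hasDerivAt_ofReal_cos t)).div ((hasDerivAt_del hme' t).pow 2) (pow_ne_zero 2 b0))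
    refine (hd.congr_deriv ?_).hasDerivWithinAt
    simp only [Pi.pow_apply, Pi.mul_apply]
    have a2 := del_sq (1 - e) t
    have b2 := del_sq (1 - m * e) t
    have hc := ofReal_cos_sq t
    unfold snAccel
    generalize del (1 - e) t = a at *
    generalize del (1 - m * e) t = b at *
    generalize (Real.sin t : ℂ) = s at *
    generalize (Real.cos t : ℂ) = c at *
    generalize e.sqrt = r at *
    push_cast
    field_simp
    rw [a2, b2, hc]
    ring
  · simp [h1, del]
  · simp [h2]

theorem continuous_twist {e : ℂ} (he : e ∈ slitPlane) (hme : m * e ∈ slitPlane) :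
    Continuous fun t => I * e.sqrt / (del (1 - e) t * del (1 - m * e) t) :=
  continuous_const.div
    ((continuous_del (one_sub_mem_slitDomain he)).mul (continuous_del (one_sub_mem_slitDomain hme)))
    fun t => mul_ne_zero (del_ne_zero (one_sub_mem_slitDomain he) t)
      (del_ne_zero (one_sub_mem_slitDomain hme) t)

theorem SnPair.exists_quarter (h : SnPair m S N) (hm : m ∈ slitDomain) :
    ∃ z₀, N z₀ ≠ 0 ∧ quo S N z₀ = 1 ∧ quoD S N z₀ = 0 := by
  have := h.lift_sin hm (Real.pi / 2) ⟨Real.pi_div_two_pos.le, by linarith [Real.pi_pos]⟩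
  rw [Real.sin_pi_div_two, Real.cos_pi_div_two] at this
  exact ⟨_, by simpa using this⟩

theorem SnPair.twist (h : SnPair m S N) (hm : m ∈ slitDomain) {e : ℂ} (he : e ∈ slitPlane)
    (hme : m * e ∈ slitPlane) : SignPeriod S N 1 (twistPeriod m e) ∧
      ∀ ω : h.zeros, (ω : ℂ) = twistPeriod m e → h.eta ω = twistQuasiPeriod m e := by
  obtain ⟨z₀, h0, h1, h2⟩ := h.exists_quarter hm
  have hl := h.lift_twist he hme h0 h1 h2
  constructor
  · obtain ⟨l0, l1, l2⟩ := hl Real.pi ⟨Real.pi_pos.le, le_rfl⟩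
    have key := h.signPeriod_of_eq (σ := 1) (by norm_num) h0 l0 (by rw [l1, h1]; simp [del])
      (by rw [l2, h2]; simp)
    rwa [liftPath, add_sub_cancel_left] at key
  · intro ω hω
    rw [h.eta_eq_integral Real.pi_pos.le (continuous_twist he hme)
      (((continuous_del (one_sub_mem_slitDomain he)).div
        (continuous_del (one_sub_mem_slitDomain hme))
        (del_ne_zero (one_sub_mem_slitDomain hme))).continuousOn)
      (fun t ht => ⟨(hl t ht).1, (hl t ht).2.1⟩) ω hω]
    refine intervalIntegral.integral_congr fun t _ => ?_
    have a0 := del_ne_zero (one_sub_mem_slitDomain he) t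
    have b0 := del_ne_zero (one_sub_mem_slitDomain hme) t
    simp only [Pi.div_apply]
    field_simp

theorem twistPeriod_one : twistPeriod m 1 = I * ellH (1 - m) := by
  unfold twistPeriod ellH
  rw [← intervalIntegral.integral_const_mul]
  refine intervalIntegral.integral_congr fun t _ => ?_
  simp [del, div_eq_mul_inv]

theorem twistQuasiPeriod_one (hm : m ∈ slitPlane) :
    twistQuasiPeriod m 1 = I * m * (ellH (1 - m) + 2 * (1 - m) * ellH₁ (1 - m)) := by
  have hm' := one_sub_mem_slitDomain hm
  have i1 := (continuous_div_del hm' (f := fun t => (Real.sin t : ℂ) ^ 2) (by fun_prop) 2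
    two_ne_zero 3).intervalIntegrable (μ := volume) 0 Real.pi
  have i0 := (continuous_one_div_del hm').intervalIntegrable (μ := volume) 0 Real.pi
  unfold ellH ellH₁ twistQuasiPeriod
  rw [← intervalIntegral.integral_const_mul, ← intervalIntegral.integral_add i0 (i1.const_mul _),
    ← intervalIntegral.integral_const_mul]
  refine intervalIntegral.integral_congr fun t _ => ?_
  have b0 := del_ne_zero hm' t
  have b2 := del_sq (1 - m) t
  have a1 : del 0 t = 1 := by simp [del]
  simp only [sub_self, mul_one, Complex.sqrt_one, a1]
  generalize del (1 - m) t = b at *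
  field_simp
  rw [b2]
  ring

theorem isOpen_twistDomain :
    IsOpen {p : ℂ × ℂ | p.2 ∈ slitPlane ∧ p.1 * p.2 ∈ slitPlane} :=
  (Complex.isOpen_slitPlane.preimage continuous_snd).inter
    (Complex.isOpen_slitPlane.preimage (continuous_fst.mul continuous_snd))

theorem continuousOn_twist_del :
    ContinuousOn (fun p : (ℂ × ℂ) × ℝ => del (1 - p.1.2) p.2)
      ({p : ℂ × ℂ | p.2 ∈ slitPlane ∧ p.1 * p.2 ∈ slitPlane} ×ˢ univ) ∧
    ContinuousOn (fun p : (ℂ × ℂ) × ℝ => del (1 - p.1.1 * p.1.2) p.2)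
      ({p : ℂ × ℂ | p.2 ∈ slitPlane ∧ p.1 * p.2 ∈ slitPlane} ×ˢ univ) := by
  constructor
  · exact (continuousOn_del univ).comp (f := fun p : (ℂ × ℂ) × ℝ => (1 - p.1.2, p.2))
      (by fun_prop) fun p hp => ⟨one_sub_mem_slitDomain hp.1.1, mem_univ _⟩
  · exact (continuousOn_del univ).comp (f := fun p : (ℂ × ℂ) × ℝ => (1 - p.1.1 * p.1.2, p.2))
      (by fun_prop) fun p hp => ⟨one_sub_mem_slitDomain hp.1.2, mem_univ _⟩

theorem continuousAt_twistPeriod {p : ℂ × ℂ} (h1 : p.2 ∈ slitPlane) (h2 : p.1 * p.2 ∈ slitPlane) :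
    ContinuousAt (fun p : ℂ × ℂ => twistPeriod p.1 p.2) p := by
  refine continuousAt_integral_param isOpen_twistDomain (a := 0) (b := Real.pi)
    (F := fun p t => I * p.2.sqrt / (del (1 - p.2) t * del (1 - p.1 * p.2) t))
    (ContinuousOn.div (continuousOn_const.mul
      (continuousOn_sqrt.comp (f := fun p : (ℂ × ℂ) × ℝ => p.1.2) (by fun_prop) fun p hp => hp.1.1))
      ((continuousOn_twist_del.1.mul continuousOn_twist_del.2).mono
        (prod_mono Subset.rfl (subset_univ _)))
      fun p hp => mul_ne_zero (del_ne_zero (one_sub_mem_slitDomain hp.1.1) _)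
        (del_ne_zero (one_sub_mem_slitDomain hp.1.2) _)) ⟨h1, h2⟩

theorem continuousAt_twistQuasiPeriod {p : ℂ × ℂ} (h1 : p.2 ∈ slitPlane)
    (h2 : p.1 * p.2 ∈ slitPlane) :
    ContinuousAt (fun p : ℂ × ℂ => twistQuasiPeriod p.1 p.2) p := by
  have hs := prod_mono (Subset.rfl (s := {p : ℂ × ℂ | p.2 ∈ slitPlane ∧ p.1 * p.2 ∈ slitPlane}))
    (subset_univ (uIcc 0 Real.pi))
  refine continuousAt_integral_param isOpen_twistDomain (a := 0) (b := Real.pi)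
    (F := fun p t => I * p.2.sqrt * p.1 * del (1 - p.2) t / del (1 - p.1 * p.2) t ^ 3)
    (ContinuousOn.div (ContinuousOn.mul (ContinuousOn.mul (continuousOn_const.mul
      (continuousOn_sqrt.comp (f := fun p : (ℂ × ℂ) × ℝ => p.1.2) (by fun_prop) fun p hp => hp.1.1))
      (by fun_prop)) (continuousOn_twist_del.1.mono hs)) ((continuousOn_twist_del.2.mono hs).pow 3)
      fun p hp => pow_ne_zero 3 (del_ne_zero (one_sub_mem_slitDomain hp.1.2) _)) ⟨h1, h2⟩

theorem continuousAt_twistPeriod_left {e : ℂ} (h1 : e ∈ slitPlane) (h2 : m * e ∈ slitPlane) :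
    ContinuousAt (fun m => twistPeriod m e) m :=
  ContinuousAt.comp (f := fun m : ℂ => (m, e)) (g := fun p : ℂ × ℂ => twistPeriod p.1 p.2)
    (continuousAt_twistPeriod h1 h2) (by fun_prop)

theorem continuousAt_twistQuasiPeriod_left {e : ℂ} (h1 : e ∈ slitPlane)
    (h2 : m * e ∈ slitPlane) : ContinuousAt (fun m => twistQuasiPeriod m e) m :=
  ContinuousAt.comp (f := fun m : ℂ => (m, e)) (g := fun p : ℂ × ℂ => twistQuasiPeriod p.1 p.2)
    (continuousAt_twistQuasiPeriod h1 h2) (by fun_prop)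

/-- For `m` in the upper half-plane the direction `e` can be turned from `1` to `-i` without leaving
the admissible range. -/
theorem mul_segment_mem_slitPlane {m : ℂ} (hm : 0 < m.im) {s : ℝ} (h0 : 0 ≤ s) (h1 : s ≤ 1) :
    (1 - s : ℂ) - s * I ∈ slitPlane ∧ m * ((1 - s : ℂ) - s * I) ∈ slitPlane := by
  constructor
  · rcases h0.eq_or_lt with rfl | h0
    · exact Or.inl (by simp)
    · exact Or.inr (by simp; exact h0.ne')
  · rw [Complex.mem_slitPlane_iff]
    by_contra! hc
    obtain ⟨c1, c2⟩ := hc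
    simp at c1 c2
    rcases h0.eq_or_lt with rfl | h0
    · simp at c2
      linarith
    · have : 0 ≤ m.re * s := by nlinarith
      have : 0 ≤ m.re := by
        by_contra! hneg
        nlinarith
      nlinarith [mul_pos h0 hm, mul_nonneg this (sub_nonneg.2 h1)]

/-- While `e` moves from `1` to `-i`, `twistPeriod` varies continuously within the countable set of
zeros of `S`, hence is constant; the quasi-period is determined by the zero. -/
theorem twist_neg_I (hm0 : 0 < m.im) (hm : m ∈ slitDomain) :
    twistPeriod m (-I) = twistPeriod m 1 ∧ twistQuasiPeriod m (-I) = twistQuasiPeriod m 1 := by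
  have hne0 : m ≠ 0 := by rintro rfl; simp at hm0
  have hne1 : m ≠ 1 := by rintro rfl; simp at hm0
  obtain ⟨S, N, h⟩ := exists_snPair hne0 hne1
  have hseg : ∀ s ∈ Icc (0 : ℝ) 1, (1 - s : ℂ) - s * I ∈ slitPlane ∧
      m * ((1 - s : ℂ) - s * I) ∈ slitPlane := fun s hs => mul_segment_mem_slitPlane hm0 hs.1 hs.2
  have hcont : ContinuousOn (fun s : ℝ => twistPeriod m ((1 - s : ℂ) - s * I)) (Icc 0 1) := by
    intro s hs
    refine ContinuousAt.continuousWithinAt ?_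
    exact ContinuousAt.comp (f := fun s : ℝ => (m, (1 - s : ℂ) - s * I))
      (continuousAt_twistPeriod (hseg s hs).1 (hseg s hs).2) (by fun_prop)
  have hS : ∀ s ∈ Icc (0 : ℝ) 1, S (twistPeriod m ((1 - s : ℂ) - s * I)) = 0 := fun s hs =>
    h.S_eq_zero_of_signPeriod (h.twist hm (hseg s hs).1 (hseg s hs).2).1
  have hsub := (countable_zeros h.diffS h.exists_S_ne_zero).isTotallyDisconnected _
    (by rintro _ ⟨s, hs, rfl⟩; exact hS s hs) (isPreconnected_Icc.image _ hcont)
  have e0 : twistPeriod m (-I) = twistPeriod m 1 := by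
    have := hsub (mem_image_of_mem _ (right_mem_Icc.2 zero_le_one))
      (mem_image_of_mem _ (left_mem_Icc.2 zero_le_one))
    simpa using this
  refine ⟨e0, ?_⟩
  have s0 := hseg 0 (by simp)
  have s1 := hseg 1 (by simp)
  simp only [Complex.ofReal_zero, Complex.ofReal_one, sub_zero, zero_mul, sub_self, one_mul,
    zero_sub] at s0 s1
  have t0 := h.twist hm s0.1 s0.2
  have t1 := h.twist hm s1.1 s1.2
  have hz := h.S_eq_zero_of_signPeriod t0.1
  rw [← t0.2 ⟨_, hz⟩ rfl, ← t1.2 ⟨_, hz⟩ e0.symm]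

theorem legendre_one (h1 : m ∈ slitDomain) (h2 : m ∈ slitPlane) :
    twistQuasiPeriod m 1 * ellH m - m * (ellH m - 2 * (1 - m) * ellH₁ m) * twistPeriod m 1 =
      2 * Real.pi * I := by
  have w := ellWronskian_eq h1 h2
  unfold ellWronskian at w
  rw [twistPeriod_one, twistQuasiPeriod_one h2]
  linear_combination 2 * I * w

/-- `ellH m` and the value of the second period at the principal logarithm satisfy the Legendre
relation. -/
theorem SnPair.exists_basis (h : SnPair m S N) (hm0 : m ≠ 0) (hm : m ∈ Metric.ball (0 : ℂ) 1)
    {P : ℂ → ℂ} (hP : DifferentiableOn ℂ P {w : ℂ | w.re < 0})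
    (hPlog : ∀ m ∈ Metric.ball (0 : ℂ) 1 ∩ slitPlane, P (Complex.log m) = I * ellH (1 - m)) :
    ∃ α β : h.zeros, (α : ℂ) = P (Complex.log m) ∧ (β : ℂ) = ellH m ∧
      h.eta α * β - h.eta β * α = 2 * Real.pi * I ∧ SignPeriod S N 1 (P (Complex.log m)) ∧
      SignPeriod S N (-1) (ellH m) := by
  have hmD := ball_subset_slitDomain hm
  have pβ := h.signPeriod_ellH hmD
  suffices key : ∃ e : ℂ, e ∈ slitPlane ∧ m * e ∈ slitPlane ∧
      twistPeriod m e = P (Complex.log m) ∧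
      twistQuasiPeriod m e * ellH m - m * (ellH m - 2 * (1 - m) * ellH₁ m) * twistPeriod m e =
      2 * Real.pi * I by
    obtain ⟨e, he, hme, e1, e2⟩ := key
    obtain ⟨t1, t2⟩ := h.twist hmD he hme
    rw [e1] at t1
    refine ⟨⟨_, h.S_eq_zero_of_signPeriod t1⟩, ⟨_, h.S_eq_zero_of_signPeriod pβ⟩, rfl, rfl, ?_, t1,
      pβ⟩
    rw [t2 _ e1.symm, h.eta_ellH hmD _ rfl]
    rw [e1] at e2
    exact e2
  by_cases hs : m ∈ slitPlane
  · refine ⟨1, Complex.one_mem_slitPlane, by rwa [mul_one], ?_, legendre_one hmD hs⟩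
    rw [twistPeriod_one, hPlog m ⟨hm, hs⟩]
  · rw [Complex.mem_slitPlane_iff, not_or, not_lt, not_ne_iff] at hs
    have hre : m.re < 0 := hs.1.lt_of_ne fun h0 => hm0 (Complex.ext h0 hs.2)
    have hI : (-I) ∈ slitPlane := Or.inr (by simp)
    have hmI : m * -I ∈ slitPlane := Or.inr (by simpa using hre.ne)
    -- On the negative axis `e = 1` is inadmissible but `e = -i` is not. All quantities are limits
    -- along `m + iy`, `y → 0+`, where `-i` may be replaced by `1`; the principal logarithm is
    -- continuous from above on its cut.
    refine ⟨-I, hI, hmI, ?_⟩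
    have c0 : Tendsto (fun y : ℝ => m + y * I) (𝓝[>] 0) (𝓝 m) := by
      have : Tendsto (fun y : ℝ => m + y * I) (𝓝 0) (𝓝 (m + (0 : ℝ) * I)) :=
        Continuous.tendsto (by fun_prop) 0
      rw [Complex.ofReal_zero, zero_mul, add_zero] at this
      exact this.mono_left nhdsWithin_le_nhds
    have him : ∀ᶠ y : ℝ in 𝓝[>] 0, 0 < (m + y * I).im := by
      filter_upwards [self_mem_nhdsWithin] with y hy
      simpa [hs.2] using hy
    have hball : ∀ᶠ y : ℝ in 𝓝[>] 0, m + y * I ∈ Metric.ball (0 : ℂ) 1 :=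
      c0.eventually (Metric.isOpen_ball.mem_nhds hm)
    have tP : Tendsto (fun y : ℝ => twistPeriod (m + y * I) (-I)) (𝓝[>] 0)
        (𝓝 (twistPeriod m (-I))) :=
      (continuousAt_twistPeriod_left hI hmI).tendsto.comp c0
    have tQ : Tendsto (fun y : ℝ => twistQuasiPeriod (m + y * I) (-I)) (𝓝[>] 0)
        (𝓝 (twistQuasiPeriod m (-I))) :=
      (continuousAt_twistQuasiPeriod_left hI hmI).tendsto.comp c0
    have tH : Tendsto (fun y : ℝ => ellH (m + y * I)) (𝓝[>] 0) (𝓝 (ellH m)) :=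
      (hasDerivAt_ellH hmD).continuousAt.tendsto.comp c0
    have tH₁ : Tendsto (fun y : ℝ => ellH₁ (m + y * I)) (𝓝[>] 0) (𝓝 (ellH₁ m)) :=
      (hasDerivAt_ellH₁ hmD).continuousAt.tendsto.comp c0
    have tlog : Tendsto (fun y : ℝ => Complex.log (m + y * I)) (𝓝[>] 0) (𝓝 (Complex.log m)) :=
      (Complex.continuousWithinAt_log_of_re_neg_of_im_zero hre hs.2).tendsto.comp
        (tendsto_nhdsWithin_iff.2 ⟨c0, him.mono fun y hy => le_of_lt hy⟩)
    have hlogre : (Complex.log m).re < 0 := by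
      rw [Complex.log_re]
      exact Real.log_neg (norm_pos_iff.2 hm0) (mem_ball_zero_iff.1 hm)
    have tPl : Tendsto (fun y : ℝ => P (Complex.log (m + y * I))) (𝓝[>] 0)
        (𝓝 (P (Complex.log m))) :=
      (hP.differentiableAt ((isOpen_lt Complex.continuous_re continuous_const).mem_nhds
        hlogre)).continuousAt.tendsto.comp tlog
    constructor
    · refine tendsto_nhds_unique (tP.congr' ?_) tPl
      filter_upwards [him, hball] with y h1 h2
      rw [(twist_neg_I h1 (ball_subset_slitDomain h2)).1, twistPeriod_one,
        hPlog _ ⟨h2, Or.inr h1.ne'⟩]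
    · have tL := (tQ.mul tH).sub
        ((c0.mul (tH.sub (((c0.const_sub 1).const_mul 2).mul tH₁))).mul tP)
      refine tendsto_nhds_unique (tL.congr' ?_) tendsto_const_nhds
      filter_upwards [him, hball] with y h1 h2
      have hD := ball_subset_slitDomain h2
      rw [(twist_neg_I h1 hD).1, (twist_neg_I h1 hD).2, legendre_one hD (Or.inr h1.ne')]

end Paths

end JacobiElliptic


namespace JacobiElliptic
open Set Filter Topology MeasureTheory ComplexConjugate

/-! ### The fundamental pair of periods for every logarithm. -/

section Periods

open Complex (slitPlane I)

variable {m : ℂ} {S N : ℂ → ℂ}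

theorem SnPair.not_quo_eq_zero (h : SnPair m S N) : ¬ ∀ z, quo S N z = 0 := by
  intro h0
  have d := h.hasDerivAt_quo (z := 0) (by rw [h.N_zero]; exact one_ne_zero)
  rw [show quo S N = fun _ => 0 from funext h0, h.quoD_zero] at d
  exact zero_ne_one ((hasDerivAt_const (0 : ℂ) (0 : ℂ)).unique d)

/-- All zeros are integer combinations of `α` and `β`. An odd multiple of the antiperiod `β` would
give `quo = -quo`, so its coefficient is even. -/
theorem SnPair.signPeriod_one_iff_exists (h : SnPair m S N) {α β : h.zeros}
    (hL : h.eta α * β - h.eta β * α = 2 * Real.pi * I) (hα : SignPeriod S N 1 α)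
    (hβ : SignPeriod S N (-1) β) (ω : ℂ) :
    SignPeriod S N 1 ω ↔ ∃ a b : ℤ, ω = a * (2 * (β : ℂ)) + b * (α : ℂ) := by
  have pα : Function.Periodic (quo S N) (α : ℂ) := h.period_iff.2 hα
  have pβ : Function.Antiperiodic (quo S N) (β : ℂ) := fun z => by
    rw [h.quo_add (by norm_num) hβ]; ring
  constructor
  · intro hω
    obtain ⟨a, b, hab⟩ := h.generate hL ω (h.S_eq_zero_of_signPeriod hω)
    rcases Int.even_or_odd' b with ⟨n, rfl | rfl⟩
    · exact ⟨n, a, by rw [hab]; push_cast; ring⟩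
    · exfalso
      have p1 := (pα.int_mul a).add_antiperiod (pβ.int_odd_mul_antiperiodic n)
      have e : (a : ℂ) * α + ((n : ℂ) * (2 * β) + β) = ω := by rw [hab]; push_cast; ring
      rw [e] at p1
      refine h.not_quo_eq_zero fun z => ?_
      have e1 := p1 z
      rw [h.period_iff.2 hω z] at e1
      exact self_eq_neg.1 e1
  · rintro ⟨a, b, rfl⟩
    exact h.period_iff.1 ((pβ.int_even_mul_periodic a).add_period (pα.int_mul b))

theorem period_add_int {P : ℂ → ℂ}
    (hP : ∀ w : ℂ, P (w + 2 * Real.pi * I) = P w + 2 * ellH (Complex.exp w)) (w : ℂ) (n : ℤ) :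
    P (w + n * (2 * Real.pi * I)) = P w + n * (2 * ellH (Complex.exp w)) := by
  induction n with
  | zero => simp
  | succ n ih =>
    have := hP (w + n * (2 * Real.pi * I))
    rw [Complex.exp_periodic.nat_mul n w] at this
    push_cast at ih ⊢
    rw [add_mul, one_mul, ← add_assoc, this, ih]
    ring
  | pred n ih =>
    have := hP (w + ((-n - 1 : ℤ) : ℂ) * (2 * Real.pi * I))
    rw [Complex.exp_periodic.int_mul _ w] at this
    rw [show w + ((-n - 1 : ℤ) : ℂ) * (2 * Real.pi * I) + 2 * Real.pi * I =
      w + ((-n : ℤ) : ℂ) * (2 * Real.pi * I) by push_cast; ring, ih] at this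
    push_cast at this ⊢
    linear_combination -this

/-- Passing from the principal logarithm to `w` replaces `α` by `α + 2nβ`, which leaves the Legendre
expression unchanged. -/
theorem SnPair.exists_basis_of_exp (h : SnPair m S N) (hm0 : m ≠ 0)
    (hm : m ∈ Metric.ball (0 : ℂ) 1) {P : ℂ → ℂ} (hP : DifferentiableOn ℂ P {w : ℂ | w.re < 0})
    (hPadd : ∀ w : ℂ, P (w + 2 * Real.pi * I) = P w + 2 * ellH (Complex.exp w))
    (hPlog : ∀ m ∈ Metric.ball (0 : ℂ) 1 ∩ slitPlane, P (Complex.log m) = I * ellH (1 - m))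
    {w : ℂ} (hw : Complex.exp w = m) :
    ∃ α β : h.zeros, (α : ℂ) = P w ∧ (β : ℂ) = ellH m ∧
      h.eta α * β - h.eta β * α = 2 * Real.pi * I ∧ SignPeriod S N 1 α ∧
      SignPeriod S N (-1) β := by
  obtain ⟨α, β, hα, hβ, hL, pα, pβ⟩ := h.exists_basis hm0 hm hP hPlog
  rw [← hα] at pα
  rw [← hβ] at pβ
  obtain ⟨n, hn⟩ := Complex.exp_eq_exp_iff_exists_int.1 (hw.trans (Complex.exp_log hm0).symm)
  have key : ((α + (2 * n) • β : h.zeros) : ℂ) = n * (2 * (β : ℂ)) + (1 : ℤ) * (α : ℂ) := by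
    push_cast
    rw [zsmul_eq_mul]
    push_cast
    ring
  refine ⟨α + (2 * n) • β, β, ?_, hβ, ?_, ?_, pβ⟩
  · rw [hn, period_add_int hPadd, key, Complex.exp_log hm0, hα, hβ]
    push_cast
    ring
  · rw [key, map_add, map_zsmul, zsmul_eq_mul]
    push_cast
    linear_combination hL
  · exact (h.signPeriod_one_iff_exists hL pα pβ _).2 ⟨n, 1, key⟩

theorem SnPair.isFundamentalPeriodPair {k A : ℂ} (h : SnPair (k ^ 2) S N) (hA : A ≠ 0)
    {α β : h.zeros} (hL : h.eta α * β - h.eta β * α = 2 * Real.pi * I)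
    (hα : SignPeriod S N 1 α) (hβ : SignPeriod S N (-1) β) :
    IsFundamentalPeriodPair (fun z => A * jacobiSn k z) (2 * (β : ℂ)) α := by
  have him := h.im_ne_zero (α := α) (β := β) (by rw [hL]; exact Complex.two_pi_I_ne_zero)
  refine ⟨linearIndependent_pair ?_, fun ω => ?_⟩
  · intro h0
    apply him
    simp only [Complex.mul_im, Complex.mul_re, Complex.conj_im, Complex.conj_re, Complex.re_ofNat,
      Complex.im_ofNat] at h0 ⊢
    linarith
  · rw [h.jacobiSn_eq, ← h.signPeriod_one_iff_exists hL hα hβ, ← h.period_iff]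
    exact forall_congr' fun z => mul_right_inj' hA

end Periods

/-! ### Closed contours and periods. -/

section Contours

open Complex (I)

variable {m : ℂ} {S N : ℂ → ℂ}

theorem exists_line_avoiding {F : ℂ → ℂ} (hF : {z | F z = 0}.Countable) {ω : ℂ} (hω : ω ≠ 0) :
    ∃ z₀ : ℂ, ∀ t : ℝ, F (z₀ + t * ω) ≠ 0 := by
  obtain ⟨y, hy⟩ : ((fun z : ℂ => (z / ω).im) '' {z | F z = 0})ᶜ.Nonempty := by
    by_contra hc
    rw [not_nonempty_iff_eq_empty, compl_empty_iff] at hc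
    exact Cardinal.not_countable_real (hc ▸ hF.image _)
  refine ⟨y * I * ω, fun t h0 => hy ⟨_, h0, ?_⟩⟩
  beta_reduce
  rw [← add_mul, mul_div_cancel_right₀ _ hω]
  simp

/-- The contour is the image under `(s, s')` of a segment from `z₀` to `z₀ + ω` that avoids the
poles and the zeros of `s'`; there `du / v = ω dt`. -/
theorem SnPair.exists_closedContour (h : SnPair m S N) {ω : ℂ} (hω : ω ≠ 0)
    (hp : SignPeriod S N 1 ω) :
    ∃ u v : ℝ → ℂ, IsClosedContour m u v ∧ ellipticIntegral u v = ω := by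
  have hwr : wr S N 0 ≠ 0 := by simp [wr, h.S_zero, h.N_zero, h.deriv_S_zero]
  obtain ⟨z₀, hz₀⟩ := exists_line_avoiding (F := fun z => N z * wr S N z)
    (countable_zeros (h.diffN.mul h.differentiable_wr)
      ⟨0, mul_ne_zero (by rw [h.N_zero]; exact one_ne_zero) hwr⟩) hω
  have hN : ∀ t : ℝ, N (z₀ + t * ω) ≠ 0 := fun t => left_ne_zero_of_mul (hz₀ t)
  have hv : ∀ t : ℝ, quoD S N (z₀ + t * ω) ≠ 0 := fun t =>
    div_ne_zero (right_ne_zero_of_mul (hz₀ t)) (pow_ne_zero 2 (hN t))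
  have hline : ∀ t : ℝ, HasDerivAt (fun t : ℝ => z₀ + t * ω) ω t := fun t => by
    have := ((hasDerivAt_id (t : ℂ)).comp_ofReal.mul_const ω).const_add z₀
    exact this.congr_deriv (by ring)
  have hd : ∀ t : ℝ, HasDerivAt (fun t : ℝ => quo S N (z₀ + t * ω))
      (ω * quoD S N (z₀ + t * ω)) t := fun t =>
    HasDerivAt.scomp (g₁ := quo S N) t (h.hasDerivAt_quo (hN t)) (hline t)
  have hvc : Continuous fun t : ℝ => quoD S N (z₀ + t * ω) :=
    continuous_iff_continuousAt.2 fun t =>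
      (HasDerivAt.scomp (g₁ := quoD S N) t (h.hasDerivAt_quoD (hN t)) (hline t)).continuousAt
  refine ⟨fun t => quo S N (z₀ + t * ω), fun t => quoD S N (z₀ + t * ω), ⟨?_, hvc.continuousOn,
    fun t _ => h.quoD_sq (hN t), fun t _ => hv t, ?_, ?_⟩, ?_⟩
  · refine ContDiff.contDiffOn (contDiff_one_iff_deriv.2 ⟨fun t => (hd t).differentiableAt, ?_⟩)
    rw [funext fun t => (hd t).deriv]
    exact continuous_const.mul hvc
  · have := h.quo_add one_ne_zero hp z₀
    simp [this]
  · have := h.quoD_add one_ne_zero hp (z := z₀) (by simpa using hN 0)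
    simp [this]
  · unfold ellipticIntegral
    rw [intervalIntegral.integral_congr (g := fun _ => ω) fun t _ => ?_]
    · simp
    · beta_reduce
      rw [(hd t).deriv, mul_div_cancel_right₀ _ (hv t)]

/-- The slope of `v` is the slope of `v²` divided by `v y + v x`. It is used both along the path and
in the parameter `m`, whence the general field. -/
theorem hasDerivWithinAt_of_sq {𝕜 : Type*} [NontriviallyNormedField 𝕜] [NormedAlgebra 𝕜 ℂ]
    {v : 𝕜 → ℂ} {s : Set 𝕜} {x : 𝕜} {F' : ℂ} (hv : ContinuousWithinAt v s x) (h0 : v x ≠ 0)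
    (h : HasDerivWithinAt (fun y => v y ^ 2) F' s x) : HasDerivWithinAt v (F' / (2 * v x)) s x := by
  rw [hasDerivWithinAt_iff_tendsto_slope] at h ⊢
  have hv' : Tendsto v (𝓝[s \ {x}] x) (𝓝 (v x)) := hv.mono_left (nhdsWithin_mono _ sdiff_subset)
  have hsum : Tendsto (fun y => v y + v x) (𝓝[s \ {x}] x) (𝓝 (v x + v x)) := hv'.add_const _
  have h2 : v x + v x ≠ 0 := by rw [← two_mul]; exact mul_ne_zero two_ne_zero h0
  rw [two_mul]
  refine (h.div hsum h2).congr' ?_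
  filter_upwards [hsum.eventually_ne h2] with y hy
  rw [Pi.div_apply, slope_def_module, slope_def_module, div_eq_iff hy, smul_mul_assoc]
  congr 1
  ring

theorem snCurve_hasDerivWithinAt {u : ℝ → ℂ} {s : Set ℝ} {t : ℝ} {u' : ℂ}
    (hu : HasDerivWithinAt u u' s t) :
    HasDerivWithinAt (fun t => (1 - u t ^ 2) * (1 - m * u t ^ 2)) (2 * (u' * snAccel m (u t)))
      s t := by
  refine (((hu.pow 2).const_sub 1).mul (((hu.pow 2).const_mul m).const_sub 1)).congr_deriv ?_
  unfold snAccel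
  simp only [Pi.pow_apply]
  push_cast
  ring

theorem closedContour_hasDerivWithinAt_u {u v : ℝ → ℂ} (hc : IsClosedContour m u v) :
    ∀ t ∈ Icc (0 : ℝ) 1, HasDerivWithinAt u (derivWithin u (Icc 0 1) t) (Icc 0 1) t := fun t ht =>
  (hc.contDiffOn_u.differentiableOn one_ne_zero t ht).hasDerivWithinAt

theorem closedContour_continuousOn_derivWithin {u v : ℝ → ℂ} (hc : IsClosedContour m u v) :
    ContinuousOn (derivWithin u (Icc 0 1)) (Icc 0 1) :=
  hc.contDiffOn_u.continuousOn_derivWithin (uniqueDiffOn_Icc zero_lt_one) le_rfl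

theorem closedContour_hasDerivWithinAt_v {u v : ℝ → ℂ} (hc : IsClosedContour m u v) :
    ∀ t ∈ Icc (0 : ℝ) 1, HasDerivWithinAt v
      (derivWithin u (Icc 0 1) t / v t * snAccel m (u t)) (Icc 0 1) t := by
  intro t ht
  refine (hasDerivWithinAt_of_sq (hc.continuousOn_v t ht) (hc.ne_zero t ht)
    ((snCurve_hasDerivWithinAt (m := m) (closedContour_hasDerivWithinAt_u hc t ht)).congr hc.sq_eq
      (hc.sq_eq t ht))).congr_deriv ?_
  have := hc.ne_zero t ht
  field_simp

/-- `deriv u` at the endpoints involves values of `u` outside `[0, 1]`, but the endpoints do not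
affect the integral. -/
theorem ellipticIntegral_eq {u v : ℝ → ℂ} :
    ellipticIntegral u v = ∫ t in (0 : ℝ)..1, derivWithin u (Icc 0 1) t / v t :=
  intervalIntegral.integral_congr_Ioo_of_le zero_le_one fun t ht => by
    rw [derivWithin_of_mem_nhds (Icc_mem_nhds ht.1 ht.2)]

/-- The contour is lifted from a preimage of its starting point with velocity `u' / v`. Both ends of
the lift carry the same `(s, s')`, so their difference, the integral, is a period. -/
theorem SnPair.signPeriod_ellipticIntegral (h : SnPair m S N) {α β : ℂ}
    (hne : (α * conj β).im ≠ 0) (hα : SignPeriod S N (-1) α) (hβ : SignPeriod S N 1 β)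
    {u v : ℝ → ℂ} (hc : IsClosedContour m u v) : SignPeriod S N 1 (ellipticIntegral u v) := by
  set u' : ℝ → ℂ := derivWithin u (Icc 0 1) with hu'
  have hdu := closedContour_hasDerivWithinAt_u hc
  have hcu' := closedContour_continuousOn_derivWithin hc
  have hdv := closedContour_hasDerivWithinAt_v hc
  have hcc : ContinuousOn (fun t => u' t / v t) (Icc 0 1) := hcu'.div hc.continuousOn_v hc.ne_zero
  set c : ℝ → ℂ := IccExtend zero_le_one ((Icc (0 : ℝ) 1).domRestrict fun t => u' t / v t) with hcdef
  have hcext : Continuous c := (continuousOn_iff_continuous_domRestrict.1 hcc).Icc_extend'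
  have hceq : ∀ t ∈ Icc (0 : ℝ) 1, c t = u' t / v t := fun t ht => by
    rw [hcdef, IccExtend_of_mem _ _ ht]; rfl
  obtain ⟨z₀, h0, h1, h2⟩ := h.exists_point hne hα hβ (hc.sq_eq 0 ⟨le_rfl, zero_le_one⟩)
  have hl := h.lift hcext hc.contDiffOn_u.continuousOn hc.continuousOn_v (fun t ht => ?_)
    (fun t ht => ?_) h0 h1 h2
  · obtain ⟨l0, l1, l2⟩ := hl 1 ⟨zero_le_one, le_rfl⟩
    have key := h.signPeriod_of_eq (σ := 1) (by norm_num) h0 l0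
      (by rw [l1, h1, one_mul, hc.closed_u]) (by rw [l2, h2, one_mul, hc.closed_v])
    rw [liftPath, add_sub_cancel_left] at key
    convert key using 1
    rw [ellipticIntegral_eq]
    refine intervalIntegral.integral_congr_Ioo_of_le zero_le_one fun t ht => ?_
    rw [hceq t (Ioo_subset_Icc_self ht)]
  · have ht' := Ico_subset_Icc_self ht
    rw [hceq t ht', div_mul_cancel₀ _ (hc.ne_zero t ht')]
    exact (hdu t ht').mono_of_mem_nhdsWithin (Icc_mem_nhdsGE_of_mem ht)
  · have ht' := Ico_subset_Icc_self ht
    rw [hceq t ht']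
    exact (hdv t ht').mono_of_mem_nhdsWithin (Icc_mem_nhdsGE_of_mem ht)

end Contours

end JacobiElliptic


namespace JacobiElliptic
open Set Filter Topology MeasureTheory ComplexConjugate

/-! ### The hypergeometric equation for contour integrals. -/

section ContourODE

theorem closedContour_factor_ne_zero {m : ℂ} {u v : ℝ → ℂ} (hc : IsClosedContour m u v) {t : ℝ}
    (ht : t ∈ Icc (0 : ℝ) 1) : 1 - m * u t ^ 2 ≠ 0 := fun h => by
  have := hc.sq_eq t ht
  rw [h, mul_zero] at this
  exact hc.ne_zero t ht (pow_eq_zero_iff two_ne_zero |>.1 this)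

/-- The derivative of the integrand of the elliptic integral and its derivatives with respect to
the parameter combine to an exact differential. -/
theorem integral_exact_differential {m : ℂ} {u v : ℝ → ℂ} (hc : IsClosedContour m u v) :
    ∫ t in (0 : ℝ)..1, derivWithin u (Icc 0 1) t / v t *
      (m * (1 - m) * (3 * u t ^ 4 / (4 * (1 - m * u t ^ 2) ^ 2)) +
        (1 - 2 * m) * (u t ^ 2 / (2 * (1 - m * u t ^ 2))) - 1 / 4) = 0 := by
  have hu := hc.contDiffOn_u.continuousOn
  have hv := hc.continuousOn_v
  have hu' := closedContour_continuousOn_derivWithin hc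
  have hq0 : ∀ t ∈ Icc (0 : ℝ) 1, 1 - m * u t ^ 2 ≠ 0 := fun t ht =>
    closedContour_factor_ne_zero hc ht
  have hq : ContinuousOn (fun t => 1 - m * u t ^ 2) (Icc 0 1) := by fun_prop
  -- For `u = sin t`, `v = cos t Δ` this is the primitive `-sin t cos t / (4 Δ³)` of `ellH_ode`; it
  -- takes equal values at both ends of a closed contour.
  have hF : ContinuousOn (fun t => -(1 / 4) * (u t * v t / (1 - m * u t ^ 2) ^ 2)) (Icc 0 1) :=
    continuousOn_const.mul ((hu.mul hv).div (hq.pow 2) fun t ht => pow_ne_zero 2 (hq0 t ht))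
  refine (intervalIntegral.integral_eq_sub_of_hasDerivAt_of_le zero_le_one hF
    (fun t ht => ?_) ?_).trans (by rw [hc.closed_u, hc.closed_v, sub_self])
  · have ht' := Ioo_subset_Icc_self ht
    have du := closedContour_hasDerivWithinAt_u hc t ht'
    have dv := closedContour_hasDerivWithinAt_v hc t ht'
    have q0 := hq0 t ht'
    have v0 := hc.ne_zero t ht'
    have v2 := hc.sq_eq t ht'
    have d := ((du.mul dv).div ((((du.pow 2).const_mul m).const_sub 1).pow 2)
      (pow_ne_zero 2 q0)).const_mul (-(1 / 4 : ℂ))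
    refine (d.congr_deriv ?_).hasDerivAt (Icc_mem_nhds ht.1 ht.2)
    simp only [Pi.pow_apply, Pi.mul_apply]
    unfold snAccel
    push_cast
    generalize u t = x at *
    generalize v t = y at *
    generalize derivWithin u (Icc 0 1) t = x' at *
    obtain ⟨q, hq⟩ : ∃ q, q = 1 - m * x ^ 2 := ⟨_, rfl⟩
    rw [← hq] at q0 v2 ⊢
    field_simp
    rw [v2]
    rw [hq]
    ring
  · refine ContinuousOn.intervalIntegrable ?_
    rw [uIcc_of_le zero_le_one]
    refine (hu'.div hv hc.ne_zero).mul (((continuousOn_const.mul ((continuousOn_const.mul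
      (hu.pow 4)).div (continuousOn_const.mul (hq.pow 2)) fun t ht => ?_)).add
      (continuousOn_const.mul ((hu.pow 2).div (continuousOn_const.mul hq) fun t ht => ?_))).sub
      continuousOn_const)
    · exact mul_ne_zero (by norm_num) (pow_ne_zero 2 (hq0 t ht))
    · exact mul_ne_zero two_ne_zero (hq0 t ht)

/-- Continuity of `v` in `m` already makes it holomorphic, being a nonvanishing square root. Two
differentiations under the integral sign then lead to `integral_exact_differential`. -/
theorem solvesPeriodODE_ellipticIntegral {U : Set ℂ} {u : ℝ → ℂ} {v : ℂ → ℝ → ℂ} (hU : IsOpen U)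
    (hc : ∀ m ∈ U, IsClosedContour m u (v m))
    (hv : ContinuousOn (fun p : ℂ × ℝ => v p.1 p.2) (U ×ˢ Icc (0 : ℝ) 1)) :
    SolvesPeriodODE (fun m => ellipticIntegral u (v m)) U := by
  rcases U.eq_empty_or_nonempty with rfl | ⟨m₀, hm₀⟩
  · exact ⟨differentiableOn_empty, fun m hm => absurd hm (notMem_empty m)⟩
  set u' := derivWithin u (Icc 0 1) with hu'
  have cu' : ContinuousOn (fun p : ℂ × ℝ => u' p.2) (U ×ˢ Icc (0 : ℝ) 1) :=
    (closedContour_continuousOn_derivWithin (hc m₀ hm₀)).comp continuousOn_snd fun p hp => hp.2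
  have cu : ContinuousOn (fun p : ℂ × ℝ => u p.2) (U ×ˢ Icc (0 : ℝ) 1) :=
    (hc m₀ hm₀).contDiffOn_u.continuousOn.comp continuousOn_snd fun p hp => hp.2
  have cq : ContinuousOn (fun p : ℂ × ℝ => 1 - p.1 * u p.2 ^ 2) (U ×ˢ Icc (0 : ℝ) 1) :=
    continuousOn_const.sub (continuousOn_fst.mul (cu.pow 2))
  have v0 : ∀ p ∈ U ×ˢ Icc (0 : ℝ) 1, v p.1 p.2 ≠ 0 := fun p hp => (hc p.1 hp.1).ne_zero p.2 hp.2
  have q0 : ∀ p ∈ U ×ˢ Icc (0 : ℝ) 1, 1 - p.1 * u p.2 ^ 2 ≠ 0 := fun p hp =>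
    closedContour_factor_ne_zero (hc p.1 hp.1) hp.2
  have c0 : ContinuousOn (fun p : ℂ × ℝ => u' p.2 / v p.1 p.2) (U ×ˢ Icc (0 : ℝ) 1) :=
    cu'.div hv v0
  have c1 : ContinuousOn (fun p : ℂ × ℝ => u' p.2 / v p.1 p.2 *
      (u p.2 ^ 2 / (2 * (1 - p.1 * u p.2 ^ 2)))) (U ×ˢ Icc (0 : ℝ) 1) :=
    c0.mul ((cu.pow 2).div (continuousOn_const.mul cq) fun p hp => mul_ne_zero two_ne_zero (q0 p hp))
  have c2 : ContinuousOn (fun p : ℂ × ℝ => u' p.2 / v p.1 p.2 *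
      (3 * u p.2 ^ 4 / (4 * (1 - p.1 * u p.2 ^ 2) ^ 2))) (U ×ˢ Icc (0 : ℝ) 1) :=
    c0.mul ((continuousOn_const.mul (cu.pow 4)).div (continuousOn_const.mul (cq.pow 2))
      fun p hp => mul_ne_zero (by norm_num) (pow_ne_zero 2 (q0 p hp)))
  have dq : ∀ m t, HasDerivAt (fun m : ℂ => 1 - m * u t ^ 2) (-(u t ^ 2)) m := fun m t =>
    (((hasDerivAt_id m).mul_const (u t ^ 2)).const_sub 1).congr_deriv (by ring)
  have dv : ∀ m ∈ U, ∀ t ∈ Icc (0 : ℝ) 1,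
      HasDerivAt (fun m => v m t) (-(u t ^ 2) * v m t / (2 * (1 - m * u t ^ 2))) m := by
    intro m hm t ht
    have hcont : ContinuousWithinAt (fun m => v m t) U m :=
      (hv (m, t) ⟨hm, ht⟩).comp (f := fun m => (m, t)) (by fun_prop) fun x hx => ⟨hx, ht⟩
    have hsq : HasDerivWithinAt (fun m => v m t ^ 2) ((1 - u t ^ 2) * -(u t ^ 2)) U m :=
      ((dq m t).const_mul (1 - u t ^ 2)).hasDerivWithinAt.congr
        (fun x hx => (hc x hx).sq_eq t ht) ((hc m hm).sq_eq t ht)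
    refine ((hasDerivWithinAt_of_sq hcont (v0 (m, t) ⟨hm, ht⟩) hsq).hasDerivAt
      (hU.mem_nhds hm)).congr_deriv ?_
    have h1 : v m t ≠ 0 := v0 (m, t) ⟨hm, ht⟩
    have h2 : 1 - m * u t ^ 2 ≠ 0 := q0 (m, t) ⟨hm, ht⟩
    have h3 := (hc m hm).sq_eq t ht
    rw [div_eq_div_iff (mul_ne_zero two_ne_zero h1) (mul_ne_zero two_ne_zero h2)]
    linear_combination (2 * u t ^ 2) * h3
  have d0 : ∀ m ∈ U, ∀ t ∈ Icc (0 : ℝ) 1, HasDerivAt (fun m => u' t / v m t)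
      (u' t / v m t * (u t ^ 2 / (2 * (1 - m * u t ^ 2)))) m := by
    intro m hm t ht
    have h1 : v m t ≠ 0 := v0 (m, t) ⟨hm, ht⟩
    have h2 : 1 - m * u t ^ 2 ≠ 0 := q0 (m, t) ⟨hm, ht⟩
    refine ((hasDerivAt_const m (u' t)).div (dv m hm t ht) h1).congr_deriv ?_
    generalize 1 - m * u t ^ 2 = q at *
    field_simp
    ring
  have d1 : ∀ m ∈ U, ∀ t ∈ Icc (0 : ℝ) 1, HasDerivAt
      (fun m => u' t / v m t * (u t ^ 2 / (2 * (1 - m * u t ^ 2))))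
      (u' t / v m t * (3 * u t ^ 4 / (4 * (1 - m * u t ^ 2) ^ 2))) m := by
    intro m hm t ht
    have h1 : v m t ≠ 0 := v0 (m, t) ⟨hm, ht⟩
    have h2 : 1 - m * u t ^ 2 ≠ 0 := q0 (m, t) ⟨hm, ht⟩
    refine ((d0 m hm t ht).mul ((hasDerivAt_const m (u t ^ 2)).div ((dq m t).const_mul 2)
      (mul_ne_zero two_ne_zero h2))).congr_deriv ?_
    simp only [Pi.div_apply]
    generalize 1 - m * u t ^ 2 = q at *
    field_simp
    ring
  rw [← uIcc_of_le (zero_le_one' ℝ)] at c0 c1 c2 d0 d1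
  rw [show (fun m => ellipticIntegral u (v m)) = fun m => ∫ t in (0 : ℝ)..1, u' t / v m t from
    funext fun m => ellipticIntegral_eq]
  refine solvesPeriodODE_of_hasDerivAt hU
    (fun m hm => hasDerivAt_integral_param hU (F := fun m t => u' t / v m t)
      (F' := fun m t => u' t / v m t * (u t ^ 2 / (2 * (1 - m * u t ^ 2)))) c0 c1 d0 hm)
    (fun m hm => hasDerivAt_integral_param hU
      (F' := fun m t => u' t / v m t * (3 * u t ^ 4 / (4 * (1 - m * u t ^ 2) ^ 2))) c1 c2 d1 hm)
    fun m hm => ?_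
  have i0 := (continuousOn_slice (F := fun m t => u' t / v m t) c0 hm).intervalIntegrable
    (μ := volume)
  have i1 := (continuousOn_slice (F := fun m t => u' t / v m t *
    (u t ^ 2 / (2 * (1 - m * u t ^ 2)))) c1 hm).intervalIntegrable (μ := volume)
  have i2 := (continuousOn_slice (F := fun m t => u' t / v m t *
    (3 * u t ^ 4 / (4 * (1 - m * u t ^ 2) ^ 2))) c2 hm).intervalIntegrable (μ := volume)
  rw [← integral_exact_differential (hc m hm), ← intervalIntegral.integral_const_mul,
    ← intervalIntegral.integral_const_mul, ← intervalIntegral.integral_const_mul,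
    ← intervalIntegral.integral_add (i2.const_mul _) (i1.const_mul _),
    ← intervalIntegral.integral_sub ((i2.const_mul _).add (i1.const_mul _)) (i0.const_mul _)]
  refine intervalIntegral.integral_congr fun t _ => ?_
  ring

end ContourODE

end JacobiElliptic


theorem mainTheorem4 :
    -- Jacobi's elliptic sine is well defined
    (∀ k : ℂ, 0 < ‖k‖ → ‖k‖ < 1 → ∃! s : ℂ → ℂ, IsJacobiSn k s) ∧
    -- the power series converges
    (∀ m : ℂ, ‖m‖ < 1 → HasSum (fun j : ℕ => periodCoeff j * m ^ j) (periodSeries m)) ∧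
    -- the elliptic integral over a fixed closed contour solves the hypergeometric equation
    (∀ (U : Set ℂ) (u : ℝ → ℂ) (v : ℂ → ℝ → ℂ), IsOpen U →
      (∀ m ∈ U, 0 < ‖m‖ ∧ ‖m‖ < 1) →
      (∀ m ∈ U, IsClosedContour m u (v m)) →
      ContinuousOn (fun p : ℂ × ℝ => v p.1 p.2) (U ×ˢ Set.Icc (0 : ℝ) 1) →
      SolvesPeriodODE (fun m => ellipticIntegral u (v m)) U) ∧
    -- the function `P` is `i h(1 - m)`, continued analytically to all `0 < |m| < 1`
    -- as a function of a logarithm of `m`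
    ∃ P : ℂ → ℂ,
      DifferentiableOn ℂ P {w : ℂ | w.re < 0} ∧
      (∀ m : ℂ, 0 < ‖m‖ → ‖m‖ < 1 → ‖1 - m‖ < 1 →
        P (Complex.log m) = Complex.I * periodSeries (1 - m)) ∧
      SolvesPeriodODE (fun m => 2 * periodSeries m) (Metric.ball 0 1) ∧
      SolvesPeriodODE (fun m => P (Complex.log m)) (Metric.ball 0 1 ∩ Complex.slitPlane) ∧
      ∀ k A : ℂ, 0 < ‖k‖ → ‖k‖ < 1 → A ^ 2 = k →
        -- the expansion of the periods where both series converge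
        (‖1 - k ^ 2‖ < 1 →
          IsFundamentalPeriodPair (fun z => A * jacobiSn k z)
            (2 * periodSeries (k ^ 2)) (Complex.I * periodSeries (1 - k ^ 2))) ∧
        -- the periods for every modulus and every branch
        ∀ w : ℂ, Complex.exp w = k ^ 2 →
          IsFundamentalPeriodPair (fun z => A * jacobiSn k z)
            (2 * periodSeries (k ^ 2)) (P w) ∧
          -- they are elliptic integrals over two closed contours
          (∃ u₁ v₁ u₂ v₂ : ℝ → ℂ,
            IsClosedContour (k ^ 2) u₁ v₁ ∧ IsClosedContour (k ^ 2) u₂ v₂ ∧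
            ellipticIntegral u₁ v₁ = 2 * periodSeries (k ^ 2) ∧
            ellipticIntegral u₂ v₂ = P w) ∧
          -- and every other closed contour gives an integer combination of them
          ∀ u v : ℝ → ℂ, IsClosedContour (k ^ 2) u v →
            ∃ a b : ℤ, ellipticIntegral u v = a * (2 * periodSeries (k ^ 2)) + b * P w := by
  refine ⟨fun k h0 h1 => JacobiElliptic.existsUnique_isJacobiSn h0 h1,
    fun m hm => JacobiElliptic.hasSum_periodSeries hm,
    fun U u v hU _ hc hv => JacobiElliptic.solvesPeriodODE_ellipticIntegral hU hc hv, ?_⟩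
  obtain ⟨P, hP, hPadd, hPlog⟩ := JacobiElliptic.exists_secondPeriod
  have hPseries : ∀ m : ℂ, 0 < ‖m‖ → ‖m‖ < 1 → ‖1 - m‖ < 1 →
      P (Complex.log m) = Complex.I * periodSeries (1 - m) := by
    intro m _ h1 h2
    rw [JacobiElliptic.periodSeries_eq_ellH h2]
    refine hPlog m ⟨mem_ball_zero_iff.2 h1, ?_⟩
    have := Complex.mem_slitPlane_of_norm_lt_one (z := m - 1) (by rwa [norm_sub_rev])
    rwa [add_sub_cancel] at this
  have main : ∀ k A w : ℂ, 0 < ‖k‖ → ‖k‖ < 1 → A ^ 2 = k → Complex.exp w = k ^ 2 →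
      IsFundamentalPeriodPair (fun z => A * jacobiSn k z) (2 * periodSeries (k ^ 2)) (P w) ∧
        (∃ u₁ v₁ u₂ v₂ : ℝ → ℂ,
          IsClosedContour (k ^ 2) u₁ v₁ ∧ IsClosedContour (k ^ 2) u₂ v₂ ∧
          ellipticIntegral u₁ v₁ = 2 * periodSeries (k ^ 2) ∧ ellipticIntegral u₂ v₂ = P w) ∧
        ∀ u v : ℝ → ℂ, IsClosedContour (k ^ 2) u v →
          ∃ a b : ℤ, ellipticIntegral u v = a * (2 * periodSeries (k ^ 2)) + b * P w := by
    intro k A w h0 h1 hA hw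
    obtain ⟨hm0, hm1⟩ := JacobiElliptic.sq_ne_zero_and_ne_one h0 h1
    have hA0 : A ≠ 0 := by
      rintro rfl
      rw [← hA] at h0
      simp at h0
    have hm : ‖k ^ 2‖ < 1 := by
      rw [norm_pow]
      exact pow_lt_one₀ h0.le h1 two_ne_zero
    obtain ⟨S, N, h⟩ := JacobiElliptic.exists_snPair hm0 hm1
    obtain ⟨α, β, hα, hβ, hL, pα, pβ⟩ :=
      h.exists_basis_of_exp hm0 (mem_ball_zero_iff.2 hm) hP hPadd hPlog hw
    have him := h.im_ne_zero (α := α) (β := β) (by rw [hL]; exact Complex.two_pi_I_ne_zero)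
    have hiff := h.signPeriod_one_iff_exists hL pα pβ
    have hne : (α : ℂ) ≠ 0 ∧ (β : ℂ) ≠ 0 := by
      constructor <;> intro hz <;> simp [hz] at him
    rw [JacobiElliptic.periodSeries_eq_ellH hm, ← hα, ← hβ]
    refine ⟨h.isFundamentalPeriodPair hA0 hL pα pβ, ?_, fun u v hc => ?_⟩
    · obtain ⟨u₁, v₁, c₁, e₁⟩ := h.exists_closedContour (mul_ne_zero two_ne_zero hne.2)
        ((hiff (2 * β)).2 ⟨1, 0, by simp⟩)
      obtain ⟨u₂, v₂, c₂, e₂⟩ := h.exists_closedContour hne.1 pα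
      exact ⟨u₁, v₁, u₂, v₂, c₁, c₂, e₁, e₂⟩
    · refine (hiff _).1 (h.signPeriod_ellipticIntegral (α := β) (β := α) ?_ pβ pα hc)
      intro hz
      apply him
      simp only [Complex.mul_im, Complex.conj_im, Complex.conj_re] at hz ⊢
      linarith
  refine ⟨P, hP, hPseries, JacobiElliptic.solvesPeriodODE_two_mul_periodSeries,
    JacobiElliptic.solvesPeriodODE_secondPeriod hPlog, fun k A h0 h1 hA => ⟨fun hk => ?_,
      fun w hw => main k A w h0 h1 hA hw⟩⟩
  have hm0 := (JacobiElliptic.sq_ne_zero_and_ne_one h0 h1).1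
  -- Where both series converge, the claim is the case `w = Log (k ^ 2)` of the general one.
  rw [← hPseries (k ^ 2) (norm_pos_iff.2 hm0)
    (by rw [norm_pow]; exact pow_lt_one₀ h0.le h1 two_ne_zero) hk]
  exact (main k A _ h0 h1 hA (Complex.exp_log hm0)).1
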